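/- Let $m\ge 1$, let $M$ be a connected smooth $m$-dimensional manifold, and let $\phi:M\to\mathbb S^{m+1}\subset\mathbb R^{m+2}$ be a smooth immersion into the unit sphere (a hypersurface of $\mathbb S^{m+1}$). Equip $M$ with the induced metric $g$. Let $\nabla$ be the connection induced on $\phi^{-1}T\mathbb S^{m+1}$, let $\Delta=-\operatorname{trace}\nabla^2$ be the rough Laplacian on its sections, and let $R(X,Y)Z=\langle Y,Z\rangle X-\langle X,Z\rangle Y$ be the curvature tensor of $\mathbb S^{m+1}$. The tension field and the bitension field of $\phi$ are $$\tau(\phi)=\operatorname{trace}\nabla d\phi,\qquad \tau_2(\phi)=-\Delta\tau(\phi)-\operatorname{trace}R(d\phi,\tau(\phi))d\phi .$$ Suppose that $M$ is proper biharmonic, that is, $\tau_2(\phi)=0$ on $M$ while $\tau(\phi)$ does not vanish identically, and that at every point of $M$ the shape operator has at most two distinct eigenvalues (principal curvatures). Then one of the following holds: (a) $M$ is an open part of a hypersphere $\mathbb S^m(\tfrac1{\sqrt2})$, i.e. of $\{\,y+\tfrac1{\sqrt2}v : y\perp v,\ |y|=\tfrac1{\sqrt2}\,\}$ for some unit vector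 $v\in\mathbb R^{m+2}$; (b) there are integers $m_1,m_2\ge1$ with $m_1+m_2=m$ and $m_1\ne m_2$ such that $M$ is an open part of a generalized Clifford torus $\mathbb S^{m_1}(\tfrac1{\sqrt2})\times\mathbb S^{m_2}(\tfrac1{\sqrt2})$, i.e. of $\{\,y+z : y\in V,\ z\in V^\perp,\ |y|=|z|=\tfrac1{\sqrt2}\,\}$ for some linear subspace $V\subset\mathbb R^{m+2}$ with $\dim V=m_1+1$ and $\dim V^\perp=m_2+1$. Here "$M$ is an open part of $S$" means that $\phi(M)\subset S$ and that $\phi$ maps open subsets of $M$ to relatively open subsets of $S$; in particular, if $M$ is an embedded submanifold and $\phi$ the inclusion, $M$ is an open subset of $S$. -/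

import Mathlib

open scoped Manifold ContDiff InnerProductSpace

noncomputable section

/-- Euclidean space `ℝⁿ`. -/
abbrev Euc (n : ℕ) : Type := EuclideanSpace ℝ (Fin n)

/-- The unit sphere `𝕊ⁿ ⊆ ℝⁿ⁺¹`, with the manifold structure of Mathlib. -/
abbrev UnitSphere (n : ℕ) : Type := Metric.sphere (0 : Euc (n + 1)) 1

namespace Biharmonic

/-! ### Maps into a unit sphere, in local coordinates

`G` is a Riemannian metric in coordinates `u ∈ ℝᵐ`, `X : ℝᵐ → F` is a map (only used near the point
under consideration) with values in the unit sphere of the Euclidean space `F`, and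
`V : ℝᵐ → F` is a vector field along `X`. -/

section Coordinates

variable {m : ℕ} {F : Type*} [NormedAddCommGroup F] [InnerProductSpace ℝ F]

/-- The partial derivative `∂ᵢ V`. -/
def pd (i : Fin m) (V : Euc m → F) (u : Euc m) : F :=
  fderiv ℝ V u (EuclideanSpace.single i 1)

/-- The metric induced by `X`: `gᵢⱼ = ⟨∂ᵢX, ∂ⱼX⟩`. -/
def inducedMetric (X : Euc m → F) (u : Euc m) : Matrix (Fin m) (Fin m) ℝ :=
  Matrix.of fun i j => ⟪pd i X u, pd j X u⟫_ℝ

/-- The Christoffel symbol `Γᵏᵢⱼ` of the Levi-Civita connection of the metric `G`. -/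
def christoffel (G : Euc m → Matrix (Fin m) (Fin m) ℝ) (k i j : Fin m) (u : Euc m) : ℝ :=
  (1 / 2) * ∑ l, (G u)⁻¹ k l *
    (pd i (fun w => G w j l) u + pd j (fun w => G w i l) u - pd l (fun w => G w i j) u)

/-- The trace `gⁱʲ Tᵢⱼ` with respect to `G`. -/
def metricTrace (G : Euc m → Matrix (Fin m) (Fin m) ℝ) (u : Euc m) (T : Fin m → Fin m → F) : F :=
  ∑ i, ∑ j, (G u)⁻¹ i j • T i j

/-- The connection of the pull-back `X⁻¹T𝕊` of the tangent bundle of the unit sphere: `∇ᵢV` is the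
orthogonal projection of `∂ᵢV` to the tangent space `X(u)^⊥` of the sphere at `X(u)`. -/
def nabla (X : Euc m → F) (i : Fin m) (V : Euc m → F) (u : Euc m) : F :=
  pd i V u - ⟪X u, pd i V u⟫_ℝ • X u

/-- The tension field `τ(X) = trace ∇dX = gⁱʲ (∇ᵢ∂ⱼX - Γᵏᵢⱼ ∂ₖX)`. -/
def tension (G : Euc m → Matrix (Fin m) (Fin m) ℝ) (X : Euc m → F) (u : Euc m) : F :=
  metricTrace G u fun i j =>
    nabla X i (pd j X) u - ∑ k, christoffel G k i j u • pd k X u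

/-- The rough Laplacian (with the sign that makes it a non-negative operator)
`ΔV = - gⁱʲ (∇ᵢ∇ⱼV - Γᵏᵢⱼ ∇ₖV)` on sections of `X⁻¹T𝕊`. -/
def roughLaplacian (G : Euc m → Matrix (Fin m) (Fin m) ℝ) (X V : Euc m → F) (u : Euc m) : F :=
  -metricTrace G u fun i j =>
    nabla X i (nabla X j V) u - ∑ k, christoffel G k i j u • nabla X k V u

/-- The curvature tensor `R(Y, Z)W = ⟨Z, W⟩Y - ⟨Y, W⟩Z` of the unit sphere. -/
def sphereCurvature (Y Z W : F) : F :=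
  ⟪Z, W⟫_ℝ • Y - ⟪Y, W⟫_ℝ • Z

/-- The bitension field `τ₂(X) = -Δτ(X) - trace R(dX, τ(X))dX`. -/
def bitension (G : Euc m → Matrix (Fin m) (Fin m) ℝ) (X : Euc m → F) (u : Euc m) : F :=
  -roughLaplacian G X (tension G X) u -
    metricTrace G u fun i j => sphereCurvature (pd i X u) (tension G X u) (pd j X u)

/-- `η` is a unit normal at `u` of the hypersurface `X` of the unit sphere: it is tangent to the
sphere at `X(u)` and orthogonal to the hypersurface. -/
def IsUnitNormal (X : Euc m → F) (u : Euc m) (η : F) : Prop :=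
  ‖η‖ = 1 ∧ ⟪X u, η⟫_ℝ = 0 ∧ ∀ i, ⟪pd i X u, η⟫_ℝ = 0

/-- The second fundamental form `hᵢⱼ = ⟨∇ᵢ∂ⱼX, η⟩` with respect to the unit normal `η`. -/
def secondFundamentalForm (X : Euc m → F) (u : Euc m) (η : F) : Matrix (Fin m) (Fin m) ℝ :=
  Matrix.of fun i j => ⟪nabla X i (pd j X) u, η⟫_ℝ

/-- The matrix `gⁱᵏ hₖⱼ` of the shape operator with respect to the unit normal `η`. -/
def shapeOperator (X : Euc m → F) (u : Euc m) (η : F) : Matrix (Fin m) (Fin m) ℝ :=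
  (inducedMetric X u)⁻¹ * secondFundamentalForm X u η

/-- The set of principal curvatures with respect to the unit normal `η`: the eigenvalues of the
shape operator. -/
def principalCurvatures (X : Euc m → F) (u : Euc m) (η : F) : Set ℝ :=
  {k | Module.End.HasEigenvalue (Matrix.toLin' (shapeOperator X u η)) k}

end Coordinates

/-! ### Immersed hypersurfaces of the unit sphere -/

section Hypersurfaces

variable {m : ℕ} {M : Type*} [TopologicalSpace M] [ChartedSpace (Euc m) M]

/-- A smooth immersion of the `m`-dimensional manifold `M` in `𝕊ᵐ⁺¹`. -/
def IsImmersedHypersurface (φ : M → UnitSphere (m + 1)) : Prop :=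
  ContMDiff (𝓡 m) (𝓡 (m + 1)) ∞ φ ∧
    ∀ p, Function.Injective (mfderiv (𝓡 m) (𝓡 (m + 1)) φ p)

/-- The expression of `φ` in the chart `e` of `M`, as a map to the ambient `ℝᵐ⁺²`. -/
def localRep (φ : M → UnitSphere (m + 1)) (e : OpenPartialHomeomorph M (Euc m)) :
    Euc m → Euc (m + 2) :=
  fun u => (φ (e.symm u) : Euc (m + 2))

/-- The tension field of `φ : (M, g) → 𝕊ᵐ⁺¹`, `g` the induced metric, vanishes identically. -/
def IsHarmonic (φ : M → UnitSphere (m + 1)) : Prop :=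
  ∀ e ∈ IsManifold.maximalAtlas (𝓡 m) ∞ M, ∀ u ∈ e.target,
    tension (inducedMetric (localRep φ e)) (localRep φ e) u = 0

/-- The bitension field of `φ : (M, g) → 𝕊ᵐ⁺¹`, `g` the induced metric, vanishes identically. -/
def IsBiharmonic (φ : M → UnitSphere (m + 1)) : Prop :=
  ∀ e ∈ IsManifold.maximalAtlas (𝓡 m) ∞ M, ∀ u ∈ e.target,
    bitension (inducedMetric (localRep φ e)) (localRep φ e) u = 0

/-- Proper biharmonic: biharmonic and not harmonic. -/
def IsProperBiharmonic (φ : M → UnitSphere (m + 1)) : Prop :=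
  IsBiharmonic φ ∧ ¬ IsHarmonic φ

/-- At each point there are at most two distinct principal curvatures. -/
def AtMostTwoPrincipalCurvatures (φ : M → UnitSphere (m + 1)) : Prop :=
  ∀ e ∈ IsManifold.maximalAtlas (𝓡 m) ∞ M, ∀ u ∈ e.target, ∀ η : Euc (m + 2),
    IsUnitNormal (localRep φ e) u η →
      (principalCurvatures (localRep φ e) u η).encard ≤ 2

/-- `M` is, through `φ`, an open part of `S`: `φ` takes values in `S`, and it maps open subsets of
`M` to relatively open subsets of `S`. -/
def IsOpenPartOf (φ : M → UnitSphere (m + 1)) (S : Set (Euc (m + 2))) : Prop :=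
  (∀ p, (φ p : Euc (m + 2)) ∈ S) ∧
    ∀ W : Set M, IsOpen W →
      ∃ O : Set (Euc (m + 2)), IsOpen O ∧ (fun p => (φ p : Euc (m + 2))) '' W = O ∩ S

end Hypersurfaces

/-! ### The model hypersurfaces -/

/-- The hypersphere `𝕊ᵐ(1/√2)` of `𝕊ᵐ⁺¹` with (Euclidean) center `v/√2`, where `v` is a unit
vector: the sphere of radius `1/√2` in the affine hyperplane through `v/√2` orthogonal to `v`. -/
def smallHypersphere {n : ℕ} (v : Euc n) : Set (Euc n) :=
  {x | ∃ y : Euc n, ⟪v, y⟫_ℝ = 0 ∧ ‖y‖ = 1 / √2 ∧ x = y + (1 / √2) • v}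

/-- The product of the spheres of radius `1/√2` of the orthogonal subspaces `V` and `V^⊥`. -/
def cliffordTorus {n : ℕ} (V : Submodule ℝ (Euc n)) : Set (Euc n) :=
  {x | ∃ y ∈ V, ∃ z ∈ Vᗮ, ‖y‖ = 1 / √2 ∧ ‖z‖ = 1 / √2 ∧ x = y + z}

end Biharmonic

end

/-!
Where the tension field `τ = f N` does not vanish, the biharmonic equation splits into its
tangential part `A (grad f) = -(f / 2) grad f` and its normal part, which gives the Laplacian of `f`
as `(|A|² - m) f`. If `grad f` does not vanish, then `-f / 2` is a simple principal curvature by the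
Codazzi equation, the other one is `c f` for a constant `c > 0`, and the Hessian of `f` is
determined by `f` and `|grad f|²`; the Gauss equation and the normal part of the biharmonic equation
are then incompatible. Hence `f` is constant and `|A|² = m`.

If `f = m`, then the hypersurface is umbilic, with all principal curvatures equal to `1`, and the
position vector plus the normal is constant: this is the small hypersphere. Otherwise there are two
constant principal curvatures `a ≠ b`, and the Gauss equation gives `a b = -1`, which together with
`|A|² = m` and the non-vanishing of `f` forces `{a, b} = {1, -1}`. Then the involution of the
ambient space which exchanges the position and the normal vector and is `-A` on the tangent space is
constant, and the two factors of the Clifford torus lie in its eigenspaces. Openness of the image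
follows from the inverse function theorem, applied to the parametrization of a neighborhood of the
hypersurface by its normal planes.
-/

noncomputable section

namespace Biharmonic

/-! ### Directional derivatives -/

/-- Smoothness at a point. The abbreviation gives `SmoothAt.differentiableAt` and
`SmoothAt.dirDeriv` without side conditions on the order of differentiability. -/
abbrev SmoothAt {E F : Type*} [NormedAddCommGroup E] [NormedSpace ℝ E] [NormedAddCommGroup F]
    [NormedSpace ℝ F] (V : E → F) (u : E) : Prop :=
  ContDiffAt ℝ ∞ V u

/-- The derivative of `V` in the fixed direction `v`; unlike `pd` it makes sense for every `v`, so
that identities can be stated without choosing coordinates. -/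
def dirDeriv {E F : Type*} [NormedAddCommGroup E] [NormedSpace ℝ E] [NormedAddCommGroup F]
    [NormedSpace ℝ F] (v : E) (V : E → F) (u : E) : F :=
  fderiv ℝ V u v

section Calculus

variable {E F : Type*} [NormedAddCommGroup E] [NormedSpace ℝ E] [NormedAddCommGroup F]
  [NormedSpace ℝ F] {V W : E → F} {c d : E → ℝ} {u : E}

lemma SmoothAt.differentiableAt (hV : SmoothAt V u) : DifferentiableAt ℝ V u :=
  ContDiffAt.differentiableAt hV (by simp)

lemma SmoothAt.dirDeriv (hV : SmoothAt V u) (a : E) : SmoothAt (dirDeriv a V) u :=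
  (hV.fderiv_right (m := ∞) (by simp)).clm_apply contDiffAt_const

lemma dirDeriv_add_dir (a b : E) (V : E → F) (u : E) :
    dirDeriv (a + b) V u = dirDeriv a V u + dirDeriv b V u := map_add _ _ _

lemma dirDeriv_smul_dir (r : ℝ) (a : E) (V : E → F) (u : E) :
    dirDeriv (r • a) V u = r • dirDeriv a V u := map_smul _ _ _

lemma dirDeriv_sub_dir (a b : E) (V : E → F) (u : E) :
    dirDeriv (a - b) V u = dirDeriv a V u - dirDeriv b V u := map_sub _ _ _

lemma dirDeriv_zero_dir (V : E → F) (u : E) : dirDeriv 0 V u = 0 := map_zero _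

lemma dirDeriv_add (hV : DifferentiableAt ℝ V u) (hW : DifferentiableAt ℝ W u) (a : E) :
    dirDeriv a (fun x => V x + W x) u = dirDeriv a V u + dirDeriv a W u := by
  rw [dirDeriv, fderiv_fun_add hV hW]; rfl

lemma dirDeriv_sub (hV : DifferentiableAt ℝ V u) (hW : DifferentiableAt ℝ W u) (a : E) :
    dirDeriv a (fun x => V x - W x) u = dirDeriv a V u - dirDeriv a W u := by
  rw [dirDeriv, fderiv_fun_sub hV hW]; rfl

lemma dirDeriv_neg (V : E → F) (u a : E) :
    dirDeriv a (fun x => -V x) u = -dirDeriv a V u := by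
  rw [dirDeriv, fderiv_fun_neg]; rfl

lemma dirDeriv_const (y : F) (u a : E) : dirDeriv a (fun _ => y) u = 0 := by
  simp [dirDeriv]

lemma dirDeriv_smul (hc : DifferentiableAt ℝ c u) (hV : DifferentiableAt ℝ V u) (a : E) :
    dirDeriv a (fun x => c x • V x) u = dirDeriv a c u • V u + c u • dirDeriv a V u := by
  rw [dirDeriv, fderiv_fun_smul hc hV, add_comm]; rfl

lemma dirDeriv_mul (hc : DifferentiableAt ℝ c u) (hd : DifferentiableAt ℝ d u) (a : E) :
    dirDeriv a (fun x => c x * d x) u = dirDeriv a c u * d u + c u * dirDeriv a d u :=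
  dirDeriv_smul hc hd a

lemma dirDeriv_const_smul (r : ℝ) (hV : DifferentiableAt ℝ V u) (a : E) :
    dirDeriv a (fun x => r • V x) u = r • dirDeriv a V u := by
  rw [dirDeriv, fderiv_fun_const_smul hV]; rfl

lemma dirDeriv_const_mul (r : ℝ) (hc : DifferentiableAt ℝ c u) (a : E) :
    dirDeriv a (fun x => r * c x) u = r * dirDeriv a c u :=
  dirDeriv_const_smul r hc a

lemma dirDeriv_sum {ι : Type*} (s : Finset ι) {V : ι → E → F}
    (hV : ∀ i ∈ s, DifferentiableAt ℝ (V i) u) (a : E) :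
    dirDeriv a (fun x => ∑ i ∈ s, V i x) u = ∑ i ∈ s, dirDeriv a (V i) u := by
  rw [dirDeriv, fderiv_fun_sum hV, _root_.sum_apply]; rfl

lemma dirDeriv_congr {U : Set E} (hU : IsOpen U) (hu : u ∈ U) (h : ∀ x ∈ U, V x = W x) (a : E) :
    dirDeriv a V u = dirDeriv a W u := by
  have hVW : V =ᶠ[nhds u] W := Filter.eventually_of_mem (hU.mem_nhds hu) h
  rw [dirDeriv, hVW.fderiv_eq]; rfl

lemma dirDeriv_eq_zero_of_const {U : Set E} (hU : IsOpen U) (hu : u ∈ U) {y : F}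
    (h : ∀ x ∈ U, V x = y) (a : E) : dirDeriv a V u = 0 := by
  rw [dirDeriv_congr hU hu h, dirDeriv_const]

lemma eq_of_dirDeriv_eq_zero {U : Set E} (hU : IsOpen U) (hU' : IsPreconnected U)
    (hV : ∀ u ∈ U, DifferentiableAt ℝ V u) (h : ∀ u ∈ U, ∀ a, dirDeriv a V u = 0) {x y : E}
    (hx : x ∈ U) (hy : y ∈ U) : V x = V y :=
  hU.is_const_of_fderiv_eq_zero hU' (fun u hu => (hV u hu).differentiableWithinAt)
    (fun u hu => ContinuousLinearMap.ext fun a => h u hu a) hx hy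

lemma dirDeriv_div (hc : DifferentiableAt ℝ c u) (hd : DifferentiableAt ℝ d u) (h0 : d u ≠ 0)
    (a : E) :
    dirDeriv a (fun x => c x / d x) u
      = (dirDeriv a c u * d u - c u * dirDeriv a d u) / (d u) ^ 2 := by
  have hcd : (fun x => c x / d x * d x) =ᶠ[nhds u] c := by
    filter_upwards [hd.continuousAt.eventually_ne h0] with x hx using div_mul_cancel₀ _ hx
  have hprod : dirDeriv a (fun x => c x / d x * d x) u = dirDeriv a c u := by
    rw [dirDeriv, hcd.fderiv_eq]; rfl
  have hdiv : DifferentiableAt ℝ (fun x => c x / d x) u := by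
    simpa only [div_eq_mul_inv] using hc.fun_mul (hd.fun_inv h0)
  rw [dirDeriv_mul hdiv hd] at hprod
  field_simp at hprod ⊢
  linarith

lemma dirDeriv_dirDeriv (hV : SmoothAt V u) (a b : E) :
    dirDeriv a (dirDeriv b V) u = fderiv ℝ (fderiv ℝ V) u a b := by
  have hV' : DifferentiableAt ℝ (fderiv ℝ V) u :=
    SmoothAt.differentiableAt (hV.fderiv_right (m := ∞) (by simp))
  change fderiv ℝ (fun x => fderiv ℝ V x b) u a = _
  rw [fderiv_clm_apply hV' (differentiableAt_const b)]
  simp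

lemma dirDeriv_comm (hV : SmoothAt V u) (a b : E) :
    dirDeriv a (dirDeriv b V) u = dirDeriv b (dirDeriv a V) u := by
  have hsymm : IsSymmSndFDerivAt ℝ V u := hV.isSymmSndFDerivAt <| by
    rw [minSmoothness_of_isRCLikeNormedField]
    exact WithTop.coe_le_coe.2 le_top
  rw [dirDeriv_dirDeriv hV, dirDeriv_dirDeriv hV, hsymm a b]

end Calculus

section InnerCalculus

variable {E F : Type*} [NormedAddCommGroup E] [NormedSpace ℝ E] [NormedAddCommGroup F]
  [InnerProductSpace ℝ F]

lemma dirDeriv_inner {V W : E → F} {u : E} (hV : DifferentiableAt ℝ V u)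
    (hW : DifferentiableAt ℝ W u) (a : E) :
    dirDeriv a (fun x => ⟪V x, W x⟫_ℝ) u = ⟪dirDeriv a V u, W u⟫_ℝ + ⟪V u, dirDeriv a W u⟫_ℝ := by
  rw [dirDeriv, fderiv_inner_apply ℝ hV hW, add_comm]; rfl

lemma pd_eq_dirDeriv {m : ℕ} (i : Fin m) (V : Euc m → F) :
    pd i V = dirDeriv (EuclideanSpace.single i 1) V := rfl

lemma dirDeriv_eq_sum_pd {m : ℕ} (V : Euc m → F) (u v : Euc m) :
    dirDeriv v V u = ∑ i, v i • pd i V u := by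
  have hv : v = ∑ i, v i • EuclideanSpace.single i (1 : ℝ) := by
    simpa using ((EuclideanSpace.basisFun (Fin m) ℝ).sum_repr v).symm
  conv_lhs => rw [hv]
  simp only [dirDeriv, map_sum, map_smul]
  rfl

lemma inner_dirDeriv_eq_neg_of_inner_const {V W : E → F} {U : Set E} (hU : IsOpen U) {u : E}
    (hu : u ∈ U) (hV : DifferentiableAt ℝ V u) (hW : DifferentiableAt ℝ W u) {c : ℝ}
    (h : ∀ x ∈ U, ⟪V x, W x⟫_ℝ = c) (a : E) :
    ⟪V u, dirDeriv a W u⟫_ℝ = -⟪dirDeriv a V u, W u⟫_ℝ := by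
  have hconst := dirDeriv_eq_zero_of_const hU hu h a
  rw [dirDeriv_inner hV hW] at hconst
  linarith

end InnerCalculus

/-! ### Smoothness of the inverse of a matrix -/

section MatrixInverse

variable {E ι : Type*} [NormedAddCommGroup E] [NormedSpace ℝ E] [Fintype ι] [DecidableEq ι]
  {G : E → Matrix ι ι ℝ} {u : E}

lemma smoothAt_det (h : ∀ i j, SmoothAt (fun x => G x i j) u) :
    SmoothAt (fun x => (G x).det) u := by
  simp only [Matrix.det_apply']
  exact ContDiffAt.sum fun σ _ => contDiffAt_const.mul (contDiffAt_prod fun i _ => h _ _)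

lemma smoothAt_inv_apply (h : ∀ i j, SmoothAt (fun x => G x i j) u) (h0 : (G u).det ≠ 0)
    (i j : ι) : SmoothAt (fun x => (G x)⁻¹ i j) u := by
  simp only [Matrix.inv_def, Matrix.smul_apply, Matrix.adjugate_apply, Ring.inverse_eq_inv']
  refine ((smoothAt_det h).inv h0).smul (smoothAt_det fun k l => ?_)
  simp only [Matrix.updateRow_apply]
  split_ifs
  · exact contDiffAt_const
  · exact h _ _

end MatrixInverse

/-! ### Oriented patches of hypersurfaces of the sphere -/

section Patches

variable {m : ℕ} {F : Type*} [NormedAddCommGroup F] [InnerProductSpace ℝ F]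

/-- An immersed patch `X : U → F` of a hypersurface of the unit sphere of the
`(m + 2)`-dimensional Euclidean space `F`, with a smooth unit normal `N`. The coordinate domain `U`
is open; the values of `X` and `N` outside `U` play no role. In names of lemmas, `DX` and `DDX`
stand for a first and a second directional derivative of `X`, and similarly for `N`. -/
structure Patch (X N : Euc m → F) (U : Set (Euc m)) : Prop where
  finrank_eq : Module.finrank ℝ F = m + 2
  isOpen : IsOpen U
  smoothAt_X : ∀ u ∈ U, SmoothAt X u
  smoothAt_N : ∀ u ∈ U, SmoothAt N u
  fderiv_injective : ∀ u ∈ U, Function.Injective (fderiv ℝ X u)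
  inner_X_X : ∀ u ∈ U, ⟪X u, X u⟫_ℝ = 1
  inner_N_N : ∀ u ∈ U, ⟪N u, N u⟫_ℝ = 1
  inner_X_N : ∀ u ∈ U, ⟪X u, N u⟫_ℝ = 0
  inner_DX_N : ∀ u ∈ U, ∀ v, ⟪dirDeriv v X u, N u⟫_ℝ = 0

/-- The frame `Xⁱ = gⁱʲ ∂ⱼX` dual to the coordinate frame. -/
def dualFrame (X : Euc m → F) (i : Fin m) (u : Euc m) : F :=
  ∑ j, (inducedMetric X u)⁻¹ i j • pd j X u

/-- The shape operator, as an endomorphism of the coordinate space. -/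
def shape (X N : Euc m → F) (u : Euc m) : Euc m →ₗ[ℝ] Euc m :=
  Matrix.toEuclideanLin (shapeOperator X u (N u))

/-- The unnormalised mean curvature: the trace of the shape operator (not divided by `m`; see
`Patch.trace_shape`), written with the dual frame so that its smoothness is apparent. -/
def meanCurv (X N : Euc m → F) (u : Euc m) : ℝ :=
  -∑ i, ⟪dualFrame X i u, pd i N u⟫_ℝ

/-- The gradient of the mean curvature with respect to the induced metric, as a vector field of the
ambient space along `X`. -/
def gradMeanCurv (X N : Euc m → F) (u : Euc m) : F :=
  ∑ k, pd k (meanCurv X N) u • dualFrame X k u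

/-- The gradient of the mean curvature with respect to the induced metric, as a vector field of the
coordinate space. -/
def gradMeanCurvCoord (X N : Euc m → F) (u : Euc m) : Euc m :=
  ∑ k, ⟪dualFrame X k u, gradMeanCurv X N u⟫_ℝ • EuclideanSpace.single k 1

lemma linearIndependent_pd {X : Euc m → F} {u : Euc m}
    (h : Function.Injective (fderiv ℝ X u)) : LinearIndependent ℝ fun i => pd i X u := by
  have hpd : (fun i => pd i X u)
      = (fderiv ℝ X u : Euc m →ₗ[ℝ] F) ∘ (EuclideanSpace.basisFun (Fin m) ℝ) := by
    funext i
    simp [pd]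
  rw [hpd]
  exact (EuclideanSpace.basisFun (Fin m) ℝ).orthonormal.linearIndependent.map' _
    (LinearMap.ker_eq_bot.2 h)

lemma det_inducedMetric_ne_zero {X : Euc m → F} {u : Euc m}
    (h : Function.Injective (fderiv ℝ X u)) : (inducedMetric X u).det ≠ 0 :=
  (Matrix.posDef_gram_of_linearIndependent (𝕜 := ℝ) (linearIndependent_pd h)).det_pos.ne'

lemma inv_inducedMetric_apply_comm (X : Euc m → F) (u : Euc m) (i j : Fin m) :
    (inducedMetric X u)⁻¹ i j = (inducedMetric X u)⁻¹ j i := by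
  have hsymm : (inducedMetric X u).transpose = inducedMetric X u := by
    ext i j
    simp [inducedMetric, real_inner_comm]
  have hsymm_inv : ((inducedMetric X u)⁻¹).transpose = (inducedMetric X u)⁻¹ := by
    rw [Matrix.transpose_nonsing_inv, hsymm]
  exact congrFun (congrFun hsymm_inv j) i

lemma inner_dualFrame {X : Euc m → F} {u : Euc m}
    (h : Function.Injective (fderiv ℝ X u)) (i j : Fin m) :
    ⟪dualFrame X i u, pd j X u⟫_ℝ = if i = j then 1 else 0 := by
  have hinv := congrFun (congrFun (Matrix.nonsing_inv_mul (inducedMetric X u)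
    (isUnit_iff_ne_zero.2 (det_inducedMetric_ne_zero h))) i) j
  rw [Matrix.mul_apply, Matrix.one_apply] at hinv
  rw [← hinv]
  simp [dualFrame, sum_inner, inner_smul_left, inducedMetric]

lemma smoothAt_inducedMetric {X : Euc m → F} {u : Euc m} (hX : SmoothAt X u)
    (i j : Fin m) : SmoothAt (fun x => inducedMetric X x i j) u :=
  (hX.dirDeriv _).inner ℝ (hX.dirDeriv _)

lemma smoothAt_dualFrame_of_injective {X : Euc m → F} {u : Euc m} (hX : SmoothAt X u)
    (h : Function.Injective (fderiv ℝ X u)) (i : Fin m) :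
    SmoothAt (dualFrame X i) u :=
  ContDiffAt.sum fun j _ => (smoothAt_inv_apply (smoothAt_inducedMetric hX)
    (det_inducedMetric_ne_zero h) i j).smul (hX.dirDeriv _)

lemma sum_inv_inducedMetric_mul_inner (X : Euc m → F) (u : Euc m) (P : Fin m → F) :
    ∑ i, ∑ j, (inducedMetric X u)⁻¹ i j * ⟪P i, pd j X u⟫_ℝ
      = ∑ i, ⟪P i, dualFrame X i u⟫_ℝ := by
  simp [dualFrame, inner_sum, inner_smul_right]

namespace Patch

variable {X N : Euc m → F} {U : Set (Euc m)} (h : Patch X N U) {u : Euc m} (hu : u ∈ U)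
include h

lemma mono {U' : Set (Euc m)} (hU' : IsOpen U') (hs : U' ⊆ U) : Patch X N U' :=
  ⟨h.finrank_eq, hU', fun u hu => h.smoothAt_X u (hs hu), fun u hu => h.smoothAt_N u (hs hu),
    fun u hu => h.fderiv_injective u (hs hu), fun u hu => h.inner_X_X u (hs hu),
    fun u hu => h.inner_N_N u (hs hu), fun u hu => h.inner_X_N u (hs hu),
    fun u hu => h.inner_DX_N u (hs hu)⟩

lemma finiteDimensional : FiniteDimensional ℝ F :=
  Module.finite_of_finrank_pos (by rw [h.finrank_eq]; omega)

include hu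

lemma differentiableAt_X : DifferentiableAt ℝ X u := (h.smoothAt_X u hu).differentiableAt

lemma differentiableAt_N : DifferentiableAt ℝ N u := (h.smoothAt_N u hu).differentiableAt

lemma differentiableAt_DX (v : Euc m) : DifferentiableAt ℝ (dirDeriv v X) u :=
  ((h.smoothAt_X u hu).dirDeriv v).differentiableAt

lemma differentiableAt_DN (v : Euc m) : DifferentiableAt ℝ (dirDeriv v N) u :=
  ((h.smoothAt_N u hu).dirDeriv v).differentiableAt

lemma inner_X_DX (v : Euc m) : ⟪X u, dirDeriv v X u⟫_ℝ = 0 := by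
  have hskew := inner_dirDeriv_eq_neg_of_inner_const h.isOpen hu (h.differentiableAt_X hu)
    (h.differentiableAt_X hu) h.inner_X_X v
  rw [real_inner_comm (X u)] at hskew
  linarith

lemma inner_N_DN (v : Euc m) : ⟪N u, dirDeriv v N u⟫_ℝ = 0 := by
  have hskew := inner_dirDeriv_eq_neg_of_inner_const h.isOpen hu (h.differentiableAt_N hu)
    (h.differentiableAt_N hu) h.inner_N_N v
  rw [real_inner_comm (N u)] at hskew
  linarith

lemma inner_N_DX (v : Euc m) : ⟪N u, dirDeriv v X u⟫_ℝ = 0 := by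
  rw [real_inner_comm, h.inner_DX_N u hu]

lemma inner_X_DN (v : Euc m) : ⟪X u, dirDeriv v N u⟫_ℝ = 0 := by
  rw [inner_dirDeriv_eq_neg_of_inner_const h.isOpen hu (h.differentiableAt_X hu)
    (h.differentiableAt_N hu) h.inner_X_N v, h.inner_DX_N u hu, neg_zero]

lemma inner_N_DDX (v w : Euc m) :
    ⟪N u, dirDeriv v (dirDeriv w X) u⟫_ℝ = -⟪dirDeriv v N u, dirDeriv w X u⟫_ℝ :=
  inner_dirDeriv_eq_neg_of_inner_const h.isOpen hu (h.differentiableAt_N hu)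
    (h.differentiableAt_DX hu w) (fun _ hx => h.inner_N_DX hx w) v

lemma inner_X_DDX (v w : Euc m) :
    ⟪X u, dirDeriv v (dirDeriv w X) u⟫_ℝ = -⟪dirDeriv v X u, dirDeriv w X u⟫_ℝ :=
  inner_dirDeriv_eq_neg_of_inner_const h.isOpen hu (h.differentiableAt_X hu)
    (h.differentiableAt_DX hu w) (fun _ hx => h.inner_X_DX hx w) v

lemma inner_N_DDN (v w : Euc m) :
    ⟪N u, dirDeriv v (dirDeriv w N) u⟫_ℝ = -⟪dirDeriv v N u, dirDeriv w N u⟫_ℝ :=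
  inner_dirDeriv_eq_neg_of_inner_const h.isOpen hu (h.differentiableAt_N hu)
    (h.differentiableAt_DN hu w) (fun _ hx => h.inner_N_DN hx w) v

lemma inner_X_DDN (v w : Euc m) :
    ⟪X u, dirDeriv v (dirDeriv w N) u⟫_ℝ = -⟪dirDeriv v X u, dirDeriv w N u⟫_ℝ :=
  inner_dirDeriv_eq_neg_of_inner_const h.isOpen hu (h.differentiableAt_X hu)
    (h.differentiableAt_DN hu w) (fun _ hx => h.inner_X_DN hx w) v

lemma inner_DN_DX_comm (v w : Euc m) :
    ⟪dirDeriv v N u, dirDeriv w X u⟫_ℝ = ⟪dirDeriv w N u, dirDeriv v X u⟫_ℝ := by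
  rw [← neg_inj, ← h.inner_N_DDX hu, ← h.inner_N_DDX hu, dirDeriv_comm (h.smoothAt_X u hu)]

lemma codazzi (a v w : Euc m) :
    ⟪dirDeriv a (dirDeriv v N) u, dirDeriv w X u⟫_ℝ
        - ⟪dirDeriv a (dirDeriv v X) u, dirDeriv w N u⟫_ℝ
      = ⟪dirDeriv a (dirDeriv w N) u, dirDeriv v X u⟫_ℝ
        - ⟪dirDeriv a (dirDeriv w X) u, dirDeriv v N u⟫_ℝ := by
  have hderiv := dirDeriv_congr h.isOpen hu (fun x hx => h.inner_DN_DX_comm hx v w) a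
  rw [dirDeriv_inner (h.differentiableAt_DN hu v) (h.differentiableAt_DX hu w),
    dirDeriv_inner (h.differentiableAt_DN hu w) (h.differentiableAt_DX hu v)] at hderiv
  rw [real_inner_comm (dirDeriv w N u), real_inner_comm (dirDeriv v N u)]
  linarith

lemma exists_decomp (y : F) :
    ∃ (v : Euc m) (s t : ℝ), y = dirDeriv v X u + s • N u + t • X u := by
  have := h.finiteDimensional
  let Φ : Euc m × ℝ × ℝ →ₗ[ℝ] F :=
    (fderiv ℝ X u : Euc m →ₗ[ℝ] F).coprod
      ((LinearMap.toSpanSingleton ℝ F (N u)).coprod (LinearMap.toSpanSingleton ℝ F (X u)))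
  have hΦ : ∀ v s t, Φ (v, s, t) = dirDeriv v X u + (s • N u + t • X u) := fun v s t => rfl
  have hinj : Function.Injective Φ := by
    rw [← LinearMap.ker_eq_bot, LinearMap.ker_eq_bot']
    rintro ⟨v, s, t⟩ h0
    rw [hΦ] at h0
    have hN := congrArg (fun y => ⟪N u, y⟫_ℝ) h0
    have hX := congrArg (fun y => ⟪X u, y⟫_ℝ) h0
    simp only [inner_add_right, inner_smul_right, h.inner_N_DX hu, h.inner_X_DX hu,
      h.inner_N_N u hu, h.inner_X_X u hu, h.inner_X_N u hu, real_inner_comm (X u) (N u),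
      inner_zero_right] at hN hX
    obtain rfl : s = 0 := by linarith
    obtain rfl : t = 0 := by linarith
    have hDX : fderiv ℝ X u v = fderiv ℝ X u 0 := by
      simpa [dirDeriv] using h0
    rw [h.fderiv_injective u hu hDX]
    rfl
  have hsurj : Function.Surjective Φ := by
    refine (LinearMap.injective_iff_surjective_of_finrank_eq_finrank ?_).1 hinj
    simp [h.finrank_eq]
  obtain ⟨⟨v, s, t⟩, hy⟩ := hsurj y
  exact ⟨v, s, t, by rw [← hy, hΦ, add_assoc]⟩

lemma inner_dualFrame_DX (i : Fin m) (v : Euc m) :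
    ⟪dualFrame X i u, dirDeriv v X u⟫_ℝ = v i := by
  rw [dirDeriv_eq_sum_pd, inner_sum]
  simp [inner_smul_right, inner_dualFrame (h.fderiv_injective u hu)]

lemma inner_dualFrame_N (i : Fin m) : ⟪dualFrame X i u, N u⟫_ℝ = 0 := by
  simp only [dualFrame, sum_inner, inner_smul_left]
  exact Finset.sum_eq_zero fun j _ => by rw [pd_eq_dirDeriv, h.inner_DX_N u hu, mul_zero]

lemma inner_dualFrame_X (i : Fin m) : ⟪dualFrame X i u, X u⟫_ℝ = 0 := by
  simp only [dualFrame, sum_inner, inner_smul_left]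
  exact Finset.sum_eq_zero fun j _ => by
    rw [pd_eq_dirDeriv, real_inner_comm, h.inner_X_DX hu, mul_zero]

lemma eq_tangent_add_normal (y : F) :
    y = ∑ i, ⟪dualFrame X i u, y⟫_ℝ • pd i X u + ⟪N u, y⟫_ℝ • N u + ⟪X u, y⟫_ℝ • X u := by
  obtain ⟨v, s, t, hy⟩ := h.exists_decomp hu y
  have hN : ⟪N u, y⟫_ℝ = s := by
    rw [hy]
    simp only [inner_add_right, inner_smul_right, h.inner_N_DX hu, h.inner_N_N u hu,
      real_inner_comm (X u) (N u), h.inner_X_N u hu]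
    ring
  have hX : ⟪X u, y⟫_ℝ = t := by
    rw [hy]
    simp only [inner_add_right, inner_smul_right, h.inner_X_DX hu, h.inner_X_X u hu,
      h.inner_X_N u hu]
    ring
  have hframe : ∀ i, ⟪dualFrame X i u, y⟫_ℝ = v i := by
    intro i
    rw [hy]
    simp only [inner_add_right, inner_smul_right, h.inner_dualFrame_DX hu,
      h.inner_dualFrame_N hu, h.inner_dualFrame_X hu]
    ring
  rw [hN, hX]
  simp only [hframe]
  rw [← dirDeriv_eq_sum_pd]
  exact hy

lemma eq_sum_pd_of_tangent {y : F} (hN : ⟪N u, y⟫_ℝ = 0) (hX : ⟪X u, y⟫_ℝ = 0) :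
    y = ∑ i, ⟪dualFrame X i u, y⟫_ℝ • pd i X u := by
  conv_lhs => rw [h.eq_tangent_add_normal hu y, hN, hX]
  simp

lemma ext_inner {y z : F} (hN : ⟪N u, y⟫_ℝ = ⟪N u, z⟫_ℝ) (hX : ⟪X u, y⟫_ℝ = ⟪X u, z⟫_ℝ)
    (hDX : ∀ v, ⟪dirDeriv v X u, y⟫_ℝ = ⟪dirDeriv v X u, z⟫_ℝ) : y = z := by
  rw [h.eq_tangent_add_normal hu y, h.eq_tangent_add_normal hu z, hN, hX]
  congr 3
  funext i
  congr 1
  simp only [dualFrame, sum_inner, inner_smul_left, pd_eq_dirDeriv, hDX]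

lemma DX_injective {v w : Euc m} (hvw : dirDeriv v X u = dirDeriv w X u) : v = w :=
  h.fderiv_injective u hu hvw

lemma christoffel_eq (k i j : Fin m) :
    christoffel (inducedMetric X) k i j u = ⟪dualFrame X k u, pd i (pd j X) u⟫_ℝ := by
  have hX := h.smoothAt_X u hu
  have hmetric : ∀ a b c : Fin m, pd a (fun w => inducedMetric X w b c) u
      = ⟪pd a (pd b X) u, pd c X u⟫_ℝ + ⟪pd b X u, pd a (pd c X) u⟫_ℝ := fun a b c =>
    dirDeriv_inner (hX.dirDeriv _).differentiableAt (hX.dirDeriv _).differentiableAt _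
  have hcomm : ∀ a b : Fin m, pd a (pd b X) u = pd b (pd a X) u := fun a b => dirDeriv_comm hX _ _
  rw [christoffel, dualFrame, sum_inner, Finset.mul_sum]
  refine Finset.sum_congr rfl fun l _ => ?_
  rw [inner_smul_left, hmetric, hmetric, hmetric, hcomm l i, hcomm l j, hcomm j i,
    real_inner_comm (pd i (pd l X) u) (pd j X u), real_inner_comm (pd j (pd l X) u) (pd i X u),
    real_inner_comm (pd i (pd j X) u) (pd l X u)]
  simp only [conj_trivial]
  ring

lemma smoothAt_dualFrame (i : Fin m) : SmoothAt (dualFrame X i) u :=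
  smoothAt_dualFrame_of_injective (h.smoothAt_X u hu) (h.fderiv_injective u hu) i

lemma smoothAt_meanCurv : SmoothAt (meanCurv X N) u :=
  (ContDiffAt.sum fun i _ => (h.smoothAt_dualFrame hu i).inner ℝ
    ((h.smoothAt_N u hu).dirDeriv _)).neg

lemma smoothAt_gradMeanCurv : SmoothAt (gradMeanCurv X N) u :=
  ContDiffAt.sum fun i _ => ((h.smoothAt_meanCurv hu).dirDeriv _).smul (h.smoothAt_dualFrame hu i)

lemma shapeOperator_apply (i j : Fin m) :
    shapeOperator X u (N u) i j = -⟪dualFrame X i u, pd j N u⟫_ℝ := by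
  rw [shapeOperator, Matrix.mul_apply, dualFrame, sum_inner, ← Finset.sum_neg_distrib]
  refine Finset.sum_congr rfl fun k _ => ?_
  have hsff : secondFundamentalForm X u (N u) k j = -⟪pd k X u, pd j N u⟫_ℝ := by
    simp only [secondFundamentalForm, Matrix.of_apply, nabla, inner_sub_left, inner_smul_left,
      h.inner_X_N u hu, mul_zero, sub_zero]
    rw [real_inner_comm, pd_eq_dirDeriv, pd_eq_dirDeriv, h.inner_N_DDX hu, h.inner_DN_DX_comm hu,
      real_inner_comm]
    rfl
  rw [hsff, inner_smul_left]
  simp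

lemma shape_apply (v : Euc m) (i : Fin m) :
    shape X N u v i = -⟪dualFrame X i u, dirDeriv v N u⟫_ℝ := by
  simp only [shape, Matrix.toLpLin_apply, Matrix.mulVec, dotProduct,
    h.shapeOperator_apply hu]
  rw [dirDeriv_eq_sum_pd, inner_sum, ← Finset.sum_neg_distrib]
  refine Finset.sum_congr rfl fun j _ => ?_
  rw [inner_smul_right]; ring

lemma DX_shape (v : Euc m) : dirDeriv (shape X N u v) X u = -dirDeriv v N u := by
  rw [dirDeriv_eq_sum_pd, h.eq_sum_pd_of_tangent hu (h.inner_N_DN hu v) (h.inner_X_DN hu v)]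
  simp only [h.shape_apply hu, neg_smul, Finset.sum_neg_distrib]

lemma trace_eq_sum_inner_dualFrame {T : Euc m →ₗ[ℝ] Euc m} {P : Euc m → F}
    (hP : ∀ v w, ⟪P v, dirDeriv w X u⟫_ℝ = ⟪dirDeriv (T v) X u, dirDeriv w X u⟫_ℝ) :
    LinearMap.trace ℝ (Euc m) T
      = ∑ i, ⟪P (EuclideanSpace.single i 1), dualFrame X i u⟫_ℝ := by
  rw [LinearMap.trace_eq_sum_inner T (EuclideanSpace.basisFun (Fin m) ℝ)]
  refine Finset.sum_congr rfl fun i _ => ?_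
  rw [EuclideanSpace.basisFun_inner, EuclideanSpace.basisFun_apply, ← h.inner_dualFrame_DX hu i,
    real_inner_comm, dualFrame, inner_sum, inner_sum]
  refine Finset.sum_congr rfl fun j _ => ?_
  rw [inner_smul_right, inner_smul_right, pd_eq_dirDeriv, hP]

lemma trace_shape : LinearMap.trace ℝ (Euc m) (shape X N u) = meanCurv X N u := by
  rw [h.trace_eq_sum_inner_dualFrame hu (P := fun v => -dirDeriv v N u)
    (fun v w => by rw [h.DX_shape hu]), meanCurv, ← Finset.sum_neg_distrib]
  refine Finset.sum_congr rfl fun i _ => ?_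
  rw [inner_neg_left, real_inner_comm]; rfl

lemma trace_shape_sq : LinearMap.trace ℝ (Euc m) (shape X N u * shape X N u)
    = ∑ i, ∑ j, (inducedMetric X u)⁻¹ i j * ⟪pd i N u, pd j N u⟫_ℝ := by
  rw [h.trace_eq_sum_inner_dualFrame hu (P := fun v => -dirDeriv (shape X N u v) N u)
    (fun v w => by rw [Module.End.mul_apply, h.DX_shape hu])]
  refine Finset.sum_congr rfl fun i _ => ?_
  rw [dualFrame, inner_sum]
  refine Finset.sum_congr rfl fun j _ => ?_
  rw [inner_smul_right, inner_neg_left, pd_eq_dirDeriv, h.inner_DN_DX_comm hu, h.DX_shape hu,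
    inner_neg_right, neg_neg, real_inner_comm]
  rfl

lemma tension_eq : tension (inducedMetric X) X u = meanCurv X N u • N u := by
  have hhess : ∀ i j : Fin m, nabla X i (pd j X) u
      - ∑ k, christoffel (inducedMetric X) k i j u • pd k X u
        = -⟪pd i N u, pd j X u⟫_ℝ • N u := by
    intro i j
    have hdecomp := h.eq_tangent_add_normal hu (pd i (pd j X) u)
    have hnormal : ⟪N u, pd i (pd j X) u⟫_ℝ = -⟪pd i N u, pd j X u⟫_ℝ := h.inner_N_DDX hu _ _
    rw [hnormal] at hdecomp
    simp only [h.christoffel_eq hu, nabla]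
    rw [sub_sub, sub_eq_iff_eq_add]
    conv_lhs => rw [hdecomp]
    abel
  simp only [tension, metricTrace, hhess, smul_smul, ← Finset.sum_smul]
  congr 1
  simp only [mul_neg, Finset.sum_neg_distrib, sum_inv_inducedMetric_mul_inner, meanCurv]
  simp only [real_inner_comm]

lemma inner_gradMeanCurv (v : Euc m) :
    ⟪gradMeanCurv X N u, dirDeriv v X u⟫_ℝ = dirDeriv v (meanCurv X N) u := by
  simp only [gradMeanCurv, sum_inner, inner_smul_left, h.inner_dualFrame_DX hu]
  rw [dirDeriv_eq_sum_pd (meanCurv X N)]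
  simp [mul_comm]

lemma inner_N_gradMeanCurv : ⟪N u, gradMeanCurv X N u⟫_ℝ = 0 := by
  simp only [gradMeanCurv, inner_sum, inner_smul_right]
  exact Finset.sum_eq_zero fun i _ => by
    rw [real_inner_comm, h.inner_dualFrame_N hu, mul_zero]

lemma inner_X_gradMeanCurv : ⟪X u, gradMeanCurv X N u⟫_ℝ = 0 := by
  simp only [gradMeanCurv, inner_sum, inner_smul_right]
  exact Finset.sum_eq_zero fun i _ => by
    rw [real_inner_comm, h.inner_dualFrame_X hu, mul_zero]

lemma DX_gradMeanCurvCoord : dirDeriv (gradMeanCurvCoord X N u) X u = gradMeanCurv X N u := by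
  conv_rhs => rw [h.eq_sum_pd_of_tangent hu (h.inner_N_gradMeanCurv hu) (h.inner_X_gradMeanCurv hu)]
  simp only [gradMeanCurvCoord, dirDeriv, map_sum, map_smul]
  rfl

lemma inner_D_gradMeanCurv (v w : Euc m) : ⟪dirDeriv v (gradMeanCurv X N) u, dirDeriv w X u⟫_ℝ
    = dirDeriv v (dirDeriv w (meanCurv X N)) u
      - ⟪gradMeanCurv X N u, dirDeriv v (dirDeriv w X) u⟫_ℝ := by
  have hderiv := dirDeriv_congr h.isOpen hu (fun x hx => h.inner_gradMeanCurv hx w) v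
  rw [dirDeriv_inner (h.smoothAt_gradMeanCurv hu).differentiableAt
    (h.differentiableAt_DX hu w)] at hderiv
  linarith

lemma sum_inv_inducedMetric_mul_inner_pd_N (y : F) (i : Fin m) :
    ∑ j, (inducedMetric X u)⁻¹ i j * ⟪y, pd j N u⟫_ℝ
      = ∑ k, ⟪dualFrame X k u, y⟫_ℝ * ⟪dualFrame X i u, pd k N u⟫_ℝ := by
  have hexpand : ∀ j, ⟪y, pd j N u⟫_ℝ = ∑ k, ⟪dualFrame X k u, y⟫_ℝ * ⟪pd j X u, pd k N u⟫_ℝ := by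
    intro j
    conv_lhs => rw [h.eq_tangent_add_normal hu y]
    simp only [inner_add_left, sum_inner, inner_smul_left, conj_trivial, pd_eq_dirDeriv,
      h.inner_N_DN hu, h.inner_X_DN hu, mul_zero, add_zero]
    refine Finset.sum_congr rfl fun k _ => ?_
    congr 1
    rw [real_inner_comm, h.inner_DN_DX_comm hu, real_inner_comm]
  simp only [hexpand, Finset.mul_sum]
  rw [Finset.sum_comm]
  refine Finset.sum_congr rfl fun k _ => ?_
  rw [dualFrame.eq_1 X i, sum_inner, Finset.mul_sum]
  refine Finset.sum_congr rfl fun j _ => ?_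
  rw [inner_smul_left, conj_trivial]
  ring

lemma inner_pd_dualFrame (i k l : Fin m) :
    ⟪pd l (dualFrame X i) u, pd k X u⟫_ℝ = -⟪dualFrame X i u, pd l (pd k X) u⟫_ℝ := by
  have hskew : ⟪dualFrame X i u, pd l (pd k X) u⟫_ℝ = -⟪pd l (dualFrame X i) u, pd k X u⟫_ℝ :=
    inner_dirDeriv_eq_neg_of_inner_const h.isOpen hu
      (h.smoothAt_dualFrame hu i).differentiableAt (h.differentiableAt_DX hu _)
      (fun x hx => inner_dualFrame (h.fderiv_injective x hx) i k) _
  rw [hskew, neg_neg]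

lemma pd_meanCurv (l : Fin m) :
    pd l (meanCurv X N) u = ∑ i, ∑ k, ⟪dualFrame X k u, pd i N u⟫_ℝ
        * ⟪dualFrame X i u, pd l (pd k X) u⟫_ℝ
      - ∑ i, ⟪dualFrame X i u, pd l (pd i N) u⟫_ℝ := by
  have hpdN : ∀ i, DifferentiableAt ℝ (pd i N) u := fun i => h.differentiableAt_DN hu _
  have hXi := fun i => (h.smoothAt_dualFrame hu i).differentiableAt
  have hprod : pd l (meanCurv X N) u = -∑ i, (⟪pd l (dualFrame X i) u, pd i N u⟫_ℝ
      + ⟪dualFrame X i u, pd l (pd i N) u⟫_ℝ) := by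
    rw [pd_eq_dirDeriv]
    refine (dirDeriv_neg _ _ _).trans ?_
    rw [dirDeriv_sum _ fun i _ => (hXi i).inner ℝ (hpdN i)]
    congr 1
    exact Finset.sum_congr rfl fun i _ => dirDeriv_inner (hXi i) (hpdN i) _
  have hframe : ∀ i : Fin m, ⟪pd l (dualFrame X i) u, pd i N u⟫_ℝ
      = -∑ k, ⟪dualFrame X k u, pd i N u⟫_ℝ * ⟪dualFrame X i u, pd l (pd k X) u⟫_ℝ := by
    intro i
    conv_lhs =>
      rw [h.eq_sum_pd_of_tangent hu (y := pd i N u) (h.inner_N_DN hu _) (h.inner_X_DN hu _)]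
    simp only [inner_sum, inner_smul_right, h.inner_pd_dualFrame hu, ← Finset.sum_neg_distrib,
      mul_neg]
  rw [hprod, Finset.sum_add_distrib]
  simp only [hframe, Finset.sum_neg_distrib]
  ring

lemma trace_codazzi (l : Fin m) :
    ∑ i, ∑ j, (inducedMetric X u)⁻¹ i j *
      (⟪pd i (pd j N) u, pd l X u⟫_ℝ - ⟪pd i (pd j X) u, pd l N u⟫_ℝ)
      = -pd l (meanCurv X N) u := by
  have hX := h.smoothAt_X u hu
  have hN := h.smoothAt_N u hu
  have hcodazzi : ∀ i j : Fin m,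
      ⟪pd i (pd j N) u, pd l X u⟫_ℝ - ⟪pd i (pd j X) u, pd l N u⟫_ℝ
        = ⟪pd l (pd i N) u, pd j X u⟫_ℝ - ⟪pd l (pd i X) u, pd j N u⟫_ℝ := by
    intro i j
    simp only [pd_eq_dirDeriv]
    rw [dirDeriv_comm hN (EuclideanSpace.single l 1), dirDeriv_comm hX (EuclideanSpace.single l 1)]
    exact h.codazzi hu _ _ _
  simp only [hcodazzi, mul_sub, Finset.sum_sub_distrib, sum_inv_inducedMetric_mul_inner,
    h.sum_inv_inducedMetric_mul_inner_pd_N hu]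
  rw [h.pd_meanCurv hu, Finset.sum_comm (f := fun i k => ⟪dualFrame X k u, pd i N u⟫_ℝ
    * ⟪dualFrame X i u, pd l (pd k X) u⟫_ℝ)]
  simp only [mul_comm, real_inner_comm]
  ring

end Patch

end Patches

/-! ### The two components of the biharmonic equation -/

section BiharmonicEquation

variable {m : ℕ} {F : Type*} [NormedAddCommGroup F] [InnerProductSpace ℝ F]

/-- The second covariant derivative `(∇²V)(∂ᵢ, ∂ⱼ) = ∇ᵢ∇ⱼV - Γᵏᵢⱼ ∇ₖV` of a section `V` of `X⁻¹T𝕊`,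
with respect to the induced metric. The rough Laplacian is minus its trace. -/
def secondCovariantDeriv (X V : Euc m → F) (i j : Fin m) (u : Euc m) : F :=
  nabla X i (nabla X j V) u - ∑ k, christoffel (inducedMetric X) k i j u • nabla X k V u

lemma inner_gradMeanCurv_eq_sum (X N : Euc m → F) (u : Euc m) (y : F) :
    ⟪gradMeanCurv X N u, y⟫_ℝ
      = ∑ i, ∑ j, (inducedMetric X u)⁻¹ i j * (pd i (meanCurv X N) u * ⟪y, pd j X u⟫_ℝ) := by
  simp only [gradMeanCurv, sum_inner, inner_smul_left, conj_trivial, dualFrame, Finset.mul_sum]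
  refine Finset.sum_congr rfl fun k _ => Finset.sum_congr rfl fun j _ => ?_
  rw [real_inner_comm]
  ring

lemma inner_gradMeanCurv_eq_sum_swap (X N : Euc m → F) (u : Euc m) (y : F) :
    ⟪gradMeanCurv X N u, y⟫_ℝ
      = ∑ i, ∑ j, (inducedMetric X u)⁻¹ i j * (pd j (meanCurv X N) u * ⟪y, pd i X u⟫_ℝ) := by
  rw [inner_gradMeanCurv_eq_sum, Finset.sum_comm]
  refine Finset.sum_congr rfl fun k _ => Finset.sum_congr rfl fun j _ => ?_
  rw [inv_inducedMetric_apply_comm]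

namespace Patch

variable {X N : Euc m → F} {U : Set (Euc m)} (h : Patch X N U) {u : Euc m} (hu : u ∈ U)
include h hu

lemma nabla_tension (j : Fin m) :
    nabla X j (tension (inducedMetric X) X) u
      = pd j (meanCurv X N) u • N u + meanCurv X N u • pd j N u := by
  have hpd : pd j (tension (inducedMetric X) X) u
      = pd j (meanCurv X N) u • N u + meanCurv X N u • pd j N u :=
    (dirDeriv_congr h.isOpen hu (fun x hx => h.tension_eq hx) _).trans
      (dirDeriv_smul (h.smoothAt_meanCurv hu).differentiableAt (h.differentiableAt_N hu) _)
  have hX : ⟪X u, pd j N u⟫_ℝ = 0 := h.inner_X_DN hu _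
  rw [nabla, hpd]
  simp [inner_add_right, inner_smul_right, h.inner_X_N u hu, hX]

lemma exists_nabla_nabla_tension_eq (i j : Fin m) : ∃ r : ℝ,
    nabla X i (nabla X j (tension (inducedMetric X) X)) u
      = pd i (pd j (meanCurv X N)) u • N u + pd j (meanCurv X N) u • pd i N u
        + (pd i (meanCurv X N) u • pd j N u + meanCurv X N u • pd i (pd j N) u) + r • X u := by
  have hf := h.smoothAt_meanCurv hu
  have hN := h.smoothAt_N u hu
  have hDN : SmoothAt (pd j N) u := hN.dirDeriv _
  have hDf : SmoothAt (pd j (meanCurv X N)) u := hf.dirDeriv _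
  have hpd : pd i (nabla X j (tension (inducedMetric X) X)) u
      = pd i (pd j (meanCurv X N)) u • N u + pd j (meanCurv X N) u • pd i N u
        + (pd i (meanCurv X N) u • pd j N u + meanCurv X N u • pd i (pd j N) u) := by
    rw [pd_eq_dirDeriv i (nabla X j (tension (inducedMetric X) X)),
      dirDeriv_congr h.isOpen hu (fun x hx => h.nabla_tension hx j),
      dirDeriv_add (hDf.differentiableAt.fun_smul hN.differentiableAt)
        (hf.differentiableAt.fun_smul hDN.differentiableAt),
      dirDeriv_smul hDf.differentiableAt hN.differentiableAt,
      dirDeriv_smul hf.differentiableAt hDN.differentiableAt]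
    rfl
  refine ⟨-⟪X u, pd i (nabla X j (tension (inducedMetric X) X)) u⟫_ℝ, ?_⟩
  rw [nabla, ← hpd]
  module

lemma trace_sphereCurvature :
    (metricTrace (inducedMetric X) u fun i j =>
      sphereCurvature (pd i X u) (tension (inducedMetric X) X u) (pd j X u))
      = -((m : ℝ) * meanCurv X N u) • N u := by
  have hcurv : ∀ i j : Fin m, sphereCurvature (pd i X u) (tension (inducedMetric X) X u) (pd j X u)
      = -⟪pd i X u, pd j X u⟫_ℝ • (meanCurv X N u • N u) := by
    intro i j
    have hN : ⟪N u, pd j X u⟫_ℝ = 0 := h.inner_N_DX hu _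
    rw [sphereCurvature, h.tension_eq hu, inner_smul_left, hN]
    simp
  have hframe : ∀ i, ⟪pd i X u, dualFrame X i u⟫_ℝ = 1 := fun i => by
    rw [real_inner_comm, inner_dualFrame (h.fderiv_injective u hu), if_pos rfl]
  have htrace : ∑ i, ∑ j, (inducedMetric X u)⁻¹ i j * ⟪pd i X u, pd j X u⟫_ℝ = m := by
    simp [sum_inv_inducedMetric_mul_inner, hframe]
  simp only [metricTrace, hcurv, smul_smul, ← Finset.sum_smul]
  simp only [mul_neg, neg_mul, Finset.sum_neg_distrib, ← mul_assoc, ← Finset.sum_mul, htrace]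

lemma inner_bitension (y : F) :
    ⟪bitension (inducedMetric X) X u, y⟫_ℝ
      = ∑ i, ∑ j, (inducedMetric X u)⁻¹ i j
          * ⟪secondCovariantDeriv X (tension (inducedMetric X) X) i j u, y⟫_ℝ
        + m * meanCurv X N u * ⟪N u, y⟫_ℝ := by
  rw [bitension, inner_sub_left, h.trace_sphereCurvature hu, roughLaplacian, neg_neg, metricTrace]
  simp only [sum_inner, inner_smul_left, conj_trivial, secondCovariantDeriv]
  ring

lemma inner_secondCovariantDeriv_tension_N (i j : Fin m) :
    ⟪secondCovariantDeriv X (tension (inducedMetric X) X) i j u, N u⟫_ℝ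
      = ⟪pd i (gradMeanCurv X N) u, pd j X u⟫_ℝ - meanCurv X N u * ⟪pd i N u, pd j N u⟫_ℝ := by
  obtain ⟨r, hr⟩ := h.exists_nabla_nabla_tension_eq hu i j
  have hDN : ∀ i, ⟪pd i N u, N u⟫_ℝ = 0 := fun i => by
    rw [real_inner_comm]; exact h.inner_N_DN hu _
  have hDDN : ⟪pd i (pd j N) u, N u⟫_ℝ = -⟪pd i N u, pd j N u⟫_ℝ := by
    rw [real_inner_comm]; exact h.inner_N_DDN hu _ _
  have hgrad : ⟪pd i (gradMeanCurv X N) u, pd j X u⟫_ℝ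
      = pd i (pd j (meanCurv X N)) u - ⟪gradMeanCurv X N u, pd i (pd j X) u⟫_ℝ :=
    h.inner_D_gradMeanCurv hu _ _
  have hchristoffel : ⟪gradMeanCurv X N u, pd i (pd j X) u⟫_ℝ
      = ∑ k, ⟪dualFrame X k u, pd i (pd j X) u⟫_ℝ * pd k (meanCurv X N) u := by
    simp only [gradMeanCurv, sum_inner, inner_smul_left, conj_trivial, mul_comm]
  rw [secondCovariantDeriv, inner_sub_left, hr, sum_inner, hgrad, hchristoffel]
  simp only [h.nabla_tension hu, inner_add_left, inner_smul_left, hDN, hDDN, h.inner_X_N u hu,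
    h.inner_N_N u hu, conj_trivial, h.christoffel_eq hu, mul_one, mul_zero, add_zero]
  ring

lemma inner_bitension_N :
    ⟪bitension (inducedMetric X) X u, N u⟫_ℝ
      = ∑ i, ⟪pd i (gradMeanCurv X N) u, dualFrame X i u⟫_ℝ
        - meanCurv X N u * LinearMap.trace ℝ (Euc m) (shape X N u * shape X N u)
        + m * meanCurv X N u := by
  simp only [h.inner_bitension hu, h.inner_secondCovariantDeriv_tension_N hu, mul_sub,
    Finset.sum_sub_distrib, h.inner_N_N u hu, h.trace_shape_sq hu, Finset.mul_sum]
  rw [sum_inv_inducedMetric_mul_inner]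
  simp only [mul_left_comm, mul_one]

lemma inner_secondCovariantDeriv_tension_pd (i j l : Fin m) :
    ⟪secondCovariantDeriv X (tension (inducedMetric X) X) i j u, pd l X u⟫_ℝ
      = pd j (meanCurv X N) u * ⟪pd l N u, pd i X u⟫_ℝ
        + pd i (meanCurv X N) u * ⟪pd l N u, pd j X u⟫_ℝ
        + meanCurv X N u
          * (⟪pd i (pd j N) u, pd l X u⟫_ℝ - ⟪pd i (pd j X) u, pd l N u⟫_ℝ) := by
  obtain ⟨r, hr⟩ := h.exists_nabla_nabla_tension_eq hu i j
  have hsymm : ∀ i, ⟪pd i N u, pd l X u⟫_ℝ = ⟪pd l N u, pd i X u⟫_ℝ :=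
    fun i => h.inner_DN_DX_comm hu _ _
  have hN_DX : ⟪N u, pd l X u⟫_ℝ = 0 := h.inner_N_DX hu _
  have hX_DX : ⟪X u, pd l X u⟫_ℝ = 0 := h.inner_X_DX hu _
  have hN_DN : ⟪N u, pd l N u⟫_ℝ = 0 := h.inner_N_DN hu _
  have hX_DN : ⟪X u, pd l N u⟫_ℝ = 0 := h.inner_X_DN hu _
  have hchristoffel : ⟪pd i (pd j X) u, pd l N u⟫_ℝ
      = ∑ k, ⟪dualFrame X k u, pd i (pd j X) u⟫_ℝ * ⟪pd l N u, pd k X u⟫_ℝ := by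
    conv_lhs => rw [h.eq_tangent_add_normal hu (pd i (pd j X) u)]
    simp only [inner_add_left, sum_inner, inner_smul_left, conj_trivial, hN_DN, hX_DN, mul_zero,
      add_zero, real_inner_comm]
  rw [secondCovariantDeriv, inner_sub_left, hr, sum_inner, hchristoffel]
  simp only [h.nabla_tension hu, inner_add_left, inner_smul_left, hN_DX, hX_DX, hsymm,
    conj_trivial, h.christoffel_eq hu, mul_zero, zero_add, add_zero, mul_sub, Finset.mul_sum,
    mul_left_comm]
  ring

lemma inner_bitension_pd (l : Fin m) :
    ⟪bitension (inducedMetric X) X u, pd l X u⟫_ℝ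
      = 2 * ⟪gradMeanCurv X N u, pd l N u⟫_ℝ - meanCurv X N u * pd l (meanCurv X N) u := by
  have hN : ⟪N u, pd l X u⟫_ℝ = 0 := h.inner_N_DX hu _
  have hcodazzi : ∑ i, ∑ j, (inducedMetric X u)⁻¹ i j * (meanCurv X N u *
      (⟪pd i (pd j N) u, pd l X u⟫_ℝ - ⟪pd i (pd j X) u, pd l N u⟫_ℝ))
      = meanCurv X N u * -pd l (meanCurv X N) u := by
    simp only [← h.trace_codazzi hu l, Finset.mul_sum, mul_left_comm]
  rw [h.inner_bitension hu, hN]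
  simp only [h.inner_secondCovariantDeriv_tension_pd hu, mul_add, Finset.sum_add_distrib]
  rw [← inner_gradMeanCurv_eq_sum, ← inner_gradMeanCurv_eq_sum_swap, hcodazzi]
  ring

lemma shape_gradMeanCurvCoord (hb : bitension (inducedMetric X) X u = 0) :
    shape X N u (gradMeanCurvCoord X N u)
      = (-(meanCurv X N u) / 2) • gradMeanCurvCoord X N u := by
  have htangent : ∀ v, 2 * ⟪gradMeanCurv X N u, dirDeriv v N u⟫_ℝ
      = meanCurv X N u * dirDeriv v (meanCurv X N) u := by
    intro v
    simp only [dirDeriv_eq_sum_pd N, dirDeriv_eq_sum_pd (meanCurv X N), inner_sum,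
      inner_smul_right, Finset.mul_sum, smul_eq_mul]
    refine Finset.sum_congr rfl fun l _ => ?_
    have hl := h.inner_bitension_pd hu l
    rw [hb, inner_zero_left] at hl
    linear_combination -(v l) * hl
  refine h.DX_injective hu ?_
  rw [h.DX_shape hu, dirDeriv_smul_dir, h.DX_gradMeanCurvCoord hu]
  refine h.ext_inner hu ?_ ?_ fun v => ?_
  · simp [h.inner_N_DN hu, inner_smul_right, h.inner_N_gradMeanCurv hu]
  · simp [h.inner_X_DN hu, inner_smul_right, h.inner_X_gradMeanCurv hu]
  · rw [inner_neg_right, inner_smul_right, real_inner_comm, h.inner_DN_DX_comm hu,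
      h.DX_gradMeanCurvCoord hu, real_inner_comm (gradMeanCurv X N u),
      real_inner_comm (gradMeanCurv X N u), h.inner_gradMeanCurv hu]
    linear_combination -(1 / 2) * htangent v

lemma laplacian_meanCurv (hb : bitension (inducedMetric X) X u = 0) :
    ∑ i, ⟪pd i (gradMeanCurv X N) u, dualFrame X i u⟫_ℝ
      = (LinearMap.trace ℝ (Euc m) (shape X N u * shape X N u) - m) * meanCurv X N u := by
  have hnormal := h.inner_bitension_N hu
  rw [hb, inner_zero_left] at hnormal
  linarith

end Patch

end BiharmonicEquation

/-! ### Endomorphisms with at most two eigenvalues -/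

section LinearAlgebra

/-- The relation `(A - a)(A - b) = 0`, satisfied by a diagonalizable endomorphism with eigenvalues
in `{a, b}`; written in expanded form, in which it is applied to vectors. -/
def SatisfiesQuadratic {E : Type*} [AddCommGroup E] [Module ℝ E] (A : E →ₗ[ℝ] E) (a b : ℝ) : Prop :=
  ∀ v, A (A v) = (a + b) • A v - (a * b) • v

/-- `A` is diagonalizable, with `a ≠ b` as its only eigenvalues, both of them attained. The last
condition is encoded by saying that `A` is not scalar. -/
structure HasExactlyTwoEigenvalues {E : Type*} [AddCommGroup E] [Module ℝ E] (A : E →ₗ[ℝ] E)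
    (a b : ℝ) : Prop where
  ne : a ≠ b
  quadratic : SatisfiesQuadratic A a b
  not_left : ¬∀ v, A v = a • v
  not_right : ¬∀ v, A v = b • v

lemma exists_subset_pair_of_encard_le_two {α : Type*} [Nonempty α] {s : Set α}
    (hs : s.encard ≤ 2) : ∃ a b : α, s ⊆ {a, b} := by
  rcases hs.lt_or_eq with hlt | htwo
  · have hle : s.encard ≤ 1 := by
      rwa [← one_add_one_eq_two, ENat.lt_add_one_iff ENat.one_ne_top] at hlt
    rcases Set.encard_le_one_iff_eq.1 hle with rfl | ⟨a, rfl⟩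
    · exact ⟨Classical.arbitrary α, Classical.arbitrary α, Set.empty_subset _⟩
    · exact ⟨a, a, by simp⟩
  · obtain ⟨a, b, -, rfl⟩ := Set.encard_eq_two.1 htwo
    exact ⟨a, b, subset_rfl⟩

lemma scalar_or_hasExactlyTwoEigenvalues_of_isSymmetric {R : Type*} [NormedAddCommGroup R]
    [InnerProductSpace ℝ R] [FiniteDimensional ℝ R] {T : R →ₗ[ℝ] R} (hT : T.IsSymmetric)
    (hs : (spectrum ℝ T).encard ≤ 2) :
    (∃ a : ℝ, ∀ v, T v = a • v) ∨ ∃ a b : ℝ, HasExactlyTwoEigenvalues T a b := by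
  obtain ⟨a, b, hab⟩ := exists_subset_pair_of_encard_le_two hs
  let B := hT.eigenvectorBasis (n := Module.finrank ℝ R) rfl
  have hB : ∀ i, T (B i) = a • B i ∨ T (B i) = b • B i := by
    intro i
    rw [show T (B i) = _ from hT.apply_eigenvectorBasis rfl i]
    exact (hab (hT.hasEigenvalue_eigenvalues rfl i).mem_spectrum).imp
      (congrArg (· • B i)) (congrArg (· • B i))
  by_cases ha : ∀ v, T v = a • v
  · exact Or.inl ⟨a, ha⟩
  by_cases hb : ∀ v, T v = b • v
  · exact Or.inl ⟨b, hb⟩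
  refine Or.inr ⟨a, b, ?_, fun v => ?_, ha, hb⟩
  · rintro rfl
    have hscalar : T = a • LinearMap.id := B.toBasis.ext fun i => by simpa using hB i
    exact ha fun v => LinearMap.congr_fun hscalar v
  · have hquad : T ∘ₗ T = (a + b) • T - (a * b) • LinearMap.id := B.toBasis.ext fun i => by
      simp only [OrthonormalBasis.coe_toBasis, LinearMap.comp_apply, LinearMap.sub_apply,
        LinearMap.smul_apply, LinearMap.id_apply]
      rcases hB i with hi | hi <;> simp only [hi, map_smul] <;> module
    exact LinearMap.congr_fun hquad v

variable {E : Type*} [AddCommGroup E] [Module ℝ E]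

lemma SatisfiesQuadratic.symm {A : E →ₗ[ℝ] E} {a b : ℝ} (hA : SatisfiesQuadratic A a b) :
    SatisfiesQuadratic A b a := fun v => by rw [hA, add_comm, mul_comm]

lemma SatisfiesQuadratic.of_scalar {A : E →ₗ[ℝ] E} {a : ℝ} (hA : ∀ v, A v = a • v) :
    SatisfiesQuadratic A a a := fun v => by simp only [hA]; module

lemma SatisfiesQuadratic.eq_or_eq {A : E →ₗ[ℝ] E} {a b c : ℝ} (hA : SatisfiesQuadratic A a b)
    {v : E} (hv : v ≠ 0) (hc : A v = c • v) : c = a ∨ c = b := by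
  have hquad := hA v
  rw [hc, map_smul, hc, smul_smul, smul_smul, ← sub_smul] at hquad
  have hroot : (c - a) * (c - b) = 0 := by
    linear_combination smul_left_injective ℝ hv hquad
  exact (mul_eq_zero.1 hroot).imp sub_eq_zero.1 sub_eq_zero.1

lemma HasExactlyTwoEigenvalues.symm {A : E →ₗ[ℝ] E} {a b : ℝ}
    (hA : HasExactlyTwoEigenvalues A a b) : HasExactlyTwoEigenvalues A b a :=
  ⟨hA.ne.symm, hA.quadratic.symm, hA.not_right, hA.not_left⟩

/-- The pull-back of the inner product along `B` makes `A` symmetric. -/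
lemma scalar_or_hasExactlyTwoEigenvalues [FiniteDimensional ℝ E] {F : Type*}
    [NormedAddCommGroup F] [InnerProductSpace ℝ F] {B : E →ₗ[ℝ] F} (hB : Function.Injective B)
    {A : E →ₗ[ℝ] E} (hA : ∀ v w, ⟪B (A v), B w⟫_ℝ = ⟪B v, B (A w)⟫_ℝ)
    (hs : (spectrum ℝ A).encard ≤ 2) :
    (∃ a : ℝ, ∀ v, A v = a • v) ∨ ∃ a b : ℝ, HasExactlyTwoEigenvalues A a b := by
  let e : E ≃ₗ[ℝ] LinearMap.range B := LinearEquiv.ofInjective B hB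
  let T : LinearMap.range B →ₗ[ℝ] LinearMap.range B := e.conjAlgEquiv ℝ A
  have hTe : ∀ v, T (e v) = e (A v) := fun v => by simp [T]
  have hT : T.IsSymmetric := by
    intro x y
    obtain ⟨v, rfl⟩ := e.surjective x
    obtain ⟨w, rfl⟩ := e.surjective y
    rw [hTe, hTe]
    exact hA v w
  have hscalar : ∀ a : ℝ, (∀ x, T x = a • x) ↔ ∀ v, A v = a • v := fun a => by
    simp only [e.surjective.forall, hTe, ← map_smul, e.injective.eq_iff]
  have hspec : (spectrum ℝ T).encard ≤ 2 := by rwa [AlgEquiv.spectrum_eq (e.conjAlgEquiv ℝ) A]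
  rcases scalar_or_hasExactlyTwoEigenvalues_of_isSymmetric hT hspec with ⟨a, ha⟩ | ⟨a, b, hab⟩
  · exact Or.inl ⟨a, (hscalar a).1 ha⟩
  · refine Or.inr ⟨a, b, hab.ne, fun v => e.injective ?_, mt (hscalar a).2 hab.not_left,
      mt (hscalar b).2 hab.not_right⟩
    simpa only [hTe, map_sub, map_smul] using hab.quadratic (e v)

lemma SatisfiesQuadratic.exists_eq_add {A : E →ₗ[ℝ] E} {a b : ℝ} (hA : SatisfiesQuadratic A a b)
    (hab : a ≠ b) (v : E) : ∃ y z, v = y + z ∧ A y = a • y ∧ A z = b • z := by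
  have hab' : a - b ≠ 0 := sub_ne_zero.2 hab
  refine ⟨(a - b)⁻¹ • (A v - b • v), (a - b)⁻¹ • (a • v - A v), ?_, ?_, ?_⟩
  · rw [← smul_add, eq_inv_smul_iff₀ hab']
    module
  · rw [map_smul, map_sub, map_smul, hA, smul_comm a]
    congr 1
    module
  · rw [map_smul, map_sub, map_smul, hA, smul_comm b]
    congr 1
    module

lemma HasExactlyTwoEigenvalues.exists_eigenvector {A : E →ₗ[ℝ] E} {a b : ℝ}
    (hA : HasExactlyTwoEigenvalues A a b) : ∃ v, v ≠ 0 ∧ A v = a • v := by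
  by_contra! hall
  refine hA.not_right fun v => ?_
  obtain ⟨y, z, rfl, hy, hz⟩ := hA.quadratic.exists_eq_add hA.ne v
  have hy0 : y = 0 := by
    by_contra hne
    exact hall y hne hy
  rw [hy0, zero_add, hz]

/-- The multiplicity `k` of `a` is the rank of the spectral projection `(A - b) / (a - b)`. -/
lemma HasExactlyTwoEigenvalues.exists_trace_eq [FiniteDimensional ℝ E] {A : E →ₗ[ℝ] E} {a b : ℝ}
    (hA : HasExactlyTwoEigenvalues A a b) :
    ∃ k : ℕ, 1 ≤ k ∧ k < Module.finrank ℝ E ∧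
      LinearMap.trace ℝ E A = k * a + (Module.finrank ℝ E - k) * b := by
  have hab : a - b ≠ 0 := sub_ne_zero.2 hA.ne
  let P : E →ₗ[ℝ] E := (a - b)⁻¹ • (A - b • LinearMap.id)
  have hAP : A = (a - b) • P + b • LinearMap.id := by
    simp only [P, smul_inv_smul₀ hab, sub_add_cancel]
  have hidem : IsIdempotentElem P := by
    have hcomm : ∀ v, A (A v - b • v) - b • (A v - b • v) = (a - b) • (A v - b • v) := fun v => by
      rw [map_sub, map_smul, hA.quadratic]; module
    ext v
    change (a - b)⁻¹ • (A ((a - b)⁻¹ • (A v - b • v)) - b • (a - b)⁻¹ • (A v - b • v))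
      = (a - b)⁻¹ • (A v - b • v)
    rw [map_smul, smul_comm b, ← smul_sub, hcomm, inv_smul_smul₀ hab]
  have hproj := LinearMap.IsIdempotentElem.isProj_range _ hidem
  refine ⟨Module.finrank ℝ (LinearMap.range P), ?_, ?_, ?_⟩
  · rw [Nat.one_le_iff_ne_zero, Ne, Submodule.finrank_eq_zero, LinearMap.range_eq_bot]
    intro hP
    exact hA.not_right fun v => by rw [hAP, hP]; simp
  · refine lt_of_le_of_ne (Submodule.finrank_le _) fun hrank => hA.not_left fun v => ?_
    have hv : P v = v := hproj.2 v (by rw [Submodule.eq_top_of_finrank_eq hrank]; trivial)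
    rw [hAP]
    simp only [LinearMap.add_apply, LinearMap.smul_apply, hv, LinearMap.id_apply]
    module
  · conv_lhs => rw [hAP]
    rw [map_add, map_smul (LinearMap.trace ℝ E) (a - b) P, hproj.trace, map_smul,
      LinearMap.trace_id]
    simp only [smul_eq_mul]
    ring

lemma SatisfiesQuadratic.trace_sq [FiniteDimensional ℝ E] {A : E →ₗ[ℝ] E} {a b : ℝ}
    (hA : SatisfiesQuadratic A a b) :
    LinearMap.trace ℝ E (A * A)
      = (a + b) * LinearMap.trace ℝ E A - a * b * Module.finrank ℝ E := by
  have hsq : A * A = (a + b) • A - (a * b) • LinearMap.id := LinearMap.ext hA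
  rw [hsq, map_sub, map_smul, map_smul, LinearMap.trace_id]
  rfl

lemma SatisfiesQuadratic.trace_cube {A : E →ₗ[ℝ] E} {a b : ℝ} (hA : SatisfiesQuadratic A a b) :
    LinearMap.trace ℝ E (A * A * A)
      = (a + b) * LinearMap.trace ℝ E (A * A) - a * b * LinearMap.trace ℝ E A := by
  have hcube : A * A * A = (a + b) • (A * A) - (a * b) • A := LinearMap.ext fun v => hA (A v)
  rw [hcube, map_sub, map_smul, map_smul]
  rfl

lemma SatisfiesQuadratic.add_mul_eq [FiniteDimensional ℝ E] {A : E →ₗ[ℝ] E} {a b : ℝ}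
    (hA : SatisfiesQuadratic A a b) :
    (a + b) * (Module.finrank ℝ E * LinearMap.trace ℝ E (A * A) - LinearMap.trace ℝ E A ^ 2)
      = Module.finrank ℝ E * LinearMap.trace ℝ E (A * A * A)
        - LinearMap.trace ℝ E A * LinearMap.trace ℝ E (A * A) := by
  rw [hA.trace_cube]
  linear_combination LinearMap.trace ℝ E A * hA.trace_sq

lemma finrank_mul_trace_sq_of_scalar [FiniteDimensional ℝ E] {A : E →ₗ[ℝ] E} {a : ℝ}
    (hA : ∀ v, A v = a • v) :
    Module.finrank ℝ E * LinearMap.trace ℝ E (A * A) = LinearMap.trace ℝ E A ^ 2 := by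
  have htrace : LinearMap.trace ℝ E A = a * Module.finrank ℝ E := by
    rw [show A = a • LinearMap.id from LinearMap.ext hA, map_smul, LinearMap.trace_id, smul_eq_mul]
  rw [(SatisfiesQuadratic.of_scalar hA).trace_sq, htrace]
  ring

lemma HasExactlyTwoEigenvalues.exists_discriminant_eq [FiniteDimensional ℝ E] {A : E →ₗ[ℝ] E}
    {a b : ℝ} (hA : HasExactlyTwoEigenvalues A a b) :
    ∃ k : ℕ, 1 ≤ k ∧ k < Module.finrank ℝ E ∧
      Module.finrank ℝ E * LinearMap.trace ℝ E (A * A) - LinearMap.trace ℝ E A ^ 2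
        = k * (Module.finrank ℝ E - k) * (a - b) ^ 2 ∧
      Module.finrank ℝ E * (a + b) - 2 * LinearMap.trace ℝ E A
        = (Module.finrank ℝ E - 2 * k) * (a - b) := by
  obtain ⟨k, hk, hkn, htrace⟩ := hA.exists_trace_eq
  refine ⟨k, hk, hkn, ?_, ?_⟩
  · rw [hA.quadratic.trace_sq, htrace]
    ring
  · rw [htrace]
    ring

lemma HasExactlyTwoEigenvalues.trace_sq_lt [FiniteDimensional ℝ E] {A : E →ₗ[ℝ] E} {a b : ℝ}
    (hA : HasExactlyTwoEigenvalues A a b) :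
    LinearMap.trace ℝ E A ^ 2 < Module.finrank ℝ E * LinearMap.trace ℝ E (A * A) := by
  obtain ⟨k, hk, hkn, hdisc, -⟩ := hA.exists_discriminant_eq
  have hk' : (0 : ℝ) < k := by exact_mod_cast hk
  have hkn' : (0 : ℝ) < Module.finrank ℝ E - k := sub_pos.2 (by exact_mod_cast hkn)
  have hab : 0 < (a - b) ^ 2 := sq_pos_of_ne_zero (sub_ne_zero.2 hA.ne)
  rw [← sub_pos, hdisc]
  exact mul_pos (mul_pos hk' hkn') hab

lemma HasExactlyTwoEigenvalues.not_scalar [FiniteDimensional ℝ E] {A : E →ₗ[ℝ] E} {a b : ℝ}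
    (hA : HasExactlyTwoEigenvalues A a b) (c : ℝ) : ¬∀ v, A v = c • v := fun hc =>
  hA.trace_sq_lt.ne' (finrank_mul_trace_sq_of_scalar hc)

lemma HasExactlyTwoEigenvalues.exists_sq_sum_sub_eq [FiniteDimensional ℝ E] {A : E →ₗ[ℝ] E}
    {a b : ℝ} (hA : HasExactlyTwoEigenvalues A a b) :
    ∃ k < Module.finrank ℝ E,
      (Module.finrank ℝ E * (a + b) - 2 * LinearMap.trace ℝ E A) ^ 2
        = (Module.finrank ℝ E - 2 * k) ^ 2
          * ((Module.finrank ℝ E * LinearMap.trace ℝ E (A * A) - LinearMap.trace ℝ E A ^ 2)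
            / (k * (Module.finrank ℝ E - k))) := by
  obtain ⟨k, hk, hkn, hdisc, hsum⟩ := hA.exists_discriminant_eq
  have hk' : (k : ℝ) ≠ 0 := Nat.cast_ne_zero.2 (by omega)
  have hkn' : (Module.finrank ℝ E : ℝ) - k ≠ 0 := sub_ne_zero.2 (by exact_mod_cast hkn.ne')
  refine ⟨k, hkn, ?_⟩
  rw [hsum, hdisc, mul_div_cancel_left₀ _ (mul_ne_zero hk' hkn'), mul_pow]

end LinearAlgebra

/-! ### Patches with two principal curvatures -/

section TwoPrincipalCurvatures

variable {m : ℕ} {F : Type*} [NormedAddCommGroup F] [InnerProductSpace ℝ F]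

namespace Patch

variable {X N : Euc m → F} {U : Set (Euc m)} (h : Patch X N U) {u : Euc m} (hu : u ∈ U)
include h hu

lemma isUnitNormal : IsUnitNormal X u (N u) := by
  refine ⟨?_, h.inner_X_N u hu, fun i => h.inner_DX_N u hu _⟩
  rw [norm_eq_sqrt_real_inner, h.inner_N_N u hu, Real.sqrt_one]

lemma inner_shape_comm (v w : Euc m) :
    ⟪dirDeriv (shape X N u v) X u, dirDeriv w X u⟫_ℝ
      = ⟪dirDeriv v X u, dirDeriv (shape X N u w) X u⟫_ℝ := by
  rw [h.DX_shape hu, h.DX_shape hu, inner_neg_left, inner_neg_right, h.inner_DN_DX_comm hu,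
    real_inner_comm]

lemma shape_scalar_or_hasExactlyTwoEigenvalues (hs : (principalCurvatures X u (N u)).encard ≤ 2) :
    (∃ a : ℝ, ∀ v, shape X N u v = a • v) ∨
      ∃ a b : ℝ, HasExactlyTwoEigenvalues (shape X N u) a b := by
  have hspec : spectrum ℝ (shape X N u) = principalCurvatures X u (N u) := by
    ext k
    rw [shape, Matrix.spectrum_toLpLin, ← Matrix.spectrum_toLin',
      ← Module.End.hasEigenvalue_iff_mem_spectrum]
    rfl
  exact scalar_or_hasExactlyTwoEigenvalues (B := (fderiv ℝ X u : Euc m →ₗ[ℝ] F))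
    (h.fderiv_injective u hu) (h.inner_shape_comm hu) (hspec ▸ hs)

lemma inner_DN_DN {a b : ℝ} (hq : SatisfiesQuadratic (shape X N u) a b) (v w : Euc m) :
    ⟪dirDeriv v N u, dirDeriv w N u⟫_ℝ
      = -(a + b) * ⟪dirDeriv v N u, dirDeriv w X u⟫_ℝ
        - a * b * ⟪dirDeriv v X u, dirDeriv w X u⟫_ℝ := by
  have hDN : ∀ z, dirDeriv z N u = -dirDeriv (shape X N u z) X u := fun z => by
    rw [h.DX_shape hu, neg_neg]
  rw [hDN w, inner_neg_right, h.inner_DN_DX_comm hu, hDN (shape X N u w), hq, dirDeriv_sub_dir,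
    dirDeriv_smul_dir, dirDeriv_smul_dir, h.DX_shape hu, inner_neg_left, inner_sub_left,
    inner_smul_left, inner_smul_left, inner_neg_left, h.inner_DN_DX_comm hu w v,
    real_inner_comm (dirDeriv v X u) (dirDeriv w X u)]
  simp only [conj_trivial]
  ring

lemma dirDeriv_N_of_shape_eq_smul {v : Euc m} {a : ℝ} (hv : shape X N u v = a • v) :
    dirDeriv v N u = -(a • dirDeriv v X u) := by
  rw [← dirDeriv_smul_dir, ← hv, h.DX_shape hu, neg_neg]

/-- Differentiate `⟪(A - l) v, (A - n) w⟫ = 0`, where `A` is the shape operator. -/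
lemma inner_DDN_sub_of_mem_eigenspace {l n : Euc m → ℝ} (hl : DifferentiableAt ℝ l u)
    (hn : DifferentiableAt ℝ n u) (hq : ∀ x ∈ U, SatisfiesQuadratic (shape X N x) (l x) (n x))
    (hne : l u ≠ n u) {v w : Euc m} (hv : shape X N u v = l u • v)
    (hw : shape X N u w = l u • w) (a : Euc m) :
    ⟪dirDeriv a (dirDeriv v N) u, dirDeriv w X u⟫_ℝ
        - ⟪dirDeriv a (dirDeriv v X) u, dirDeriv w N u⟫_ℝ
      = -(dirDeriv a l u * ⟪dirDeriv v X u, dirDeriv w X u⟫_ℝ) := by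
  have horth : ∀ x ∈ U,
      ⟪dirDeriv v N x + l x • dirDeriv v X x, dirDeriv w N x + n x • dirDeriv w X x⟫_ℝ = 0 := by
    intro x hx
    simp only [inner_add_left, inner_add_right, inner_smul_left, inner_smul_right, conj_trivial]
    rw [h.inner_DN_DN hx (hq x hx), real_inner_comm (dirDeriv w N x) (dirDeriv v X x),
      h.inner_DN_DX_comm hx w v]
    ring
  have hlv : DifferentiableAt ℝ (fun x => l x • dirDeriv v X x) u :=
    hl.smul (h.differentiableAt_DX hu v)
  have hnw : DifferentiableAt ℝ (fun x => n x • dirDeriv w X x) u :=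
    hn.smul (h.differentiableAt_DX hu w)
  have hDN_v := h.dirDeriv_N_of_shape_eq_smul hu hv
  have hDN_w := h.dirDeriv_N_of_shape_eq_smul hu hw
  have hderiv := dirDeriv_eq_zero_of_const h.isOpen hu horth a
  rw [dirDeriv_inner ((h.differentiableAt_DN hu v).fun_add hlv)
      ((h.differentiableAt_DN hu w).fun_add hnw), hDN_v, neg_add_cancel, inner_zero_left, add_zero,
    dirDeriv_add (h.differentiableAt_DN hu v) hlv, dirDeriv_smul hl (h.differentiableAt_DX hu v),
    hDN_w] at hderiv
  rw [hDN_w]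
  simp only [inner_add_left, inner_add_right, inner_smul_left, inner_smul_right, conj_trivial,
    inner_neg_right] at hderiv ⊢
  apply mul_left_cancel₀ (sub_ne_zero.2 hne.symm)
  linear_combination hderiv

end Patch

end TwoPrincipalCurvatures

/-! ### Constancy of the mean curvature -/

section Integrability

variable {E F : Type*} [NormedAddCommGroup E] [NormedSpace ℝ E] [NormedAddCommGroup F]
  [NormedSpace ℝ F] {u : E}

lemma dirDeriv_pow {f : E → ℝ} (hf : DifferentiableAt ℝ f u) (n : ℕ) (a : E) :
    dirDeriv a (fun x => f x ^ n) u = n * f u ^ (n - 1) * dirDeriv a f u := by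
  rw [dirDeriv, fderiv_fun_pow n hf]
  simp [dirDeriv]

lemma dirDeriv_neg_div_two {f : E → ℝ} (hf : DifferentiableAt ℝ f u) (a : E) :
    dirDeriv a (fun x => -f x / 2) u = -(1 / 2) * dirDeriv a f u := by
  rw [← dirDeriv_const_mul _ hf]
  congr 1
  funext x
  ring

/-- Compare the mixed second derivatives of `V`. -/
lemma integrability_of_dirDeriv_eq {U : Set E} (hU : IsOpen U) (hu : u ∈ U) {V X R : E → F}
    {f r : E → ℝ} (hV : SmoothAt V u) (hX : SmoothAt X u) (hf : SmoothAt f u)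
    (hr : DifferentiableAt ℝ r u) (hR : DifferentiableAt ℝ R u)
    (hDV : ∀ x ∈ U, ∀ v, dirDeriv v V x = r x • dirDeriv v X x + dirDeriv v f x • R x) (a b : E) :
    dirDeriv a r u • dirDeriv b X u + dirDeriv b f u • dirDeriv a R u
      = dirDeriv b r u • dirDeriv a X u + dirDeriv a f u • dirDeriv b R u := by
  have hDDV : ∀ a b, dirDeriv a (dirDeriv b V) u
      = dirDeriv a r u • dirDeriv b X u + r u • dirDeriv a (dirDeriv b X) u
        + (dirDeriv a (dirDeriv b f) u • R u + dirDeriv b f u • dirDeriv a R u) := by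
    intro a b
    have hDX := (hX.dirDeriv b).differentiableAt
    have hDf := (hf.dirDeriv b).differentiableAt
    rw [dirDeriv_congr hU hu (fun x hx => hDV x hx b) a,
      dirDeriv_add (hr.fun_smul hDX) (hDf.fun_smul hR), dirDeriv_smul hr hDX, dirDeriv_smul hDf hR]
  have hcomm := dirDeriv_comm hV a b
  rw [hDDV, hDDV, dirDeriv_comm hX b, dirDeriv_comm hf b] at hcomm
  rw [← sub_eq_zero] at hcomm ⊢
  rw [← hcomm]
  abel

end Integrability

section MeanCurvatureGradient

variable {m : ℕ} {F : Type*} [NormedAddCommGroup F] [InnerProductSpace ℝ F]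

/-- The squared length of the gradient of `meanCurv`. -/
def gradMeanCurvSq (X N : Euc m → F) (u : Euc m) : ℝ := ⟪gradMeanCurv X N u, gradMeanCurv X N u⟫_ℝ

lemma trace_scalar_add_rankOne {f : Euc m → ℝ} {u ξ : Euc m} {r s : ℝ}
    {T : Euc m →ₗ[ℝ] Euc m} (hT : ∀ v, T v = r • v + (s * dirDeriv v f u) • ξ) :
    LinearMap.trace ℝ (Euc m) T = m * r + s * dirDeriv ξ f u := by
  have hT' : T = r • LinearMap.id
      + s • (fderiv ℝ f u : Euc m →ₗ[ℝ] ℝ).smulRight ξ := LinearMap.ext fun v => by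
    rw [hT, mul_smul]; rfl
  rw [hT', map_add, map_smul, map_smul, LinearMap.trace_id, LinearMap.trace_smulRight,
    finrank_euclideanSpace_fin, smul_eq_mul, mul_comm r]
  rfl

namespace Patch

variable {X N : Euc m → F} {U : Set (Euc m)} (h : Patch X N U)
include h

lemma continuousOn_trace_shape_sq : ContinuousOn
    (fun u => LinearMap.trace ℝ (Euc m) (shape X N u * shape X N u)) U := by
  intro u hu
  have hsmooth : SmoothAt (fun u => ∑ i, ∑ j, (inducedMetric X u)⁻¹ i j *
      ⟪pd i N u, pd j N u⟫_ℝ) u :=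
    ContDiffAt.sum fun i _ => ContDiffAt.sum fun j _ =>
      (smoothAt_inv_apply (smoothAt_inducedMetric (h.smoothAt_X u hu))
        (det_inducedMetric_ne_zero (h.fderiv_injective u hu)) i j).mul
        (((h.smoothAt_N u hu).dirDeriv _).inner ℝ ((h.smoothAt_N u hu).dirDeriv _))
  exact hsmooth.continuousAt.continuousWithinAt.congr (fun x hx => h.trace_shape_sq hx)
    (h.trace_shape_sq hu)

variable {u : Euc m} (hu : u ∈ U)
include hu

lemma smoothAt_gradMeanCurvSq : SmoothAt (gradMeanCurvSq X N) u :=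
  (h.smoothAt_gradMeanCurv hu).inner ℝ (h.smoothAt_gradMeanCurv hu)

lemma dirDeriv_gradMeanCurvSq (v : Euc m) :
    dirDeriv v (gradMeanCurvSq X N) u
      = 2 * ⟪dirDeriv v (gradMeanCurv X N) u, gradMeanCurv X N u⟫_ℝ := by
  have hG := (h.smoothAt_gradMeanCurv hu).differentiableAt
  have hinner := dirDeriv_inner hG hG v
  rw [real_inner_comm (dirDeriv v (gradMeanCurv X N) u), ← two_mul] at hinner
  exact hinner

lemma dirDeriv_gradMeanCurvCoord_meanCurv :
    dirDeriv (gradMeanCurvCoord X N u) (meanCurv X N) u = gradMeanCurvSq X N u := by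
  rw [← h.inner_gradMeanCurv hu, h.DX_gradMeanCurvCoord hu]; rfl

lemma gradMeanCurvCoord_ne_zero (hw : gradMeanCurvSq X N u ≠ 0) : gradMeanCurvCoord X N u ≠ 0 :=
  fun hzero => hw <| by
    rw [← h.dirDeriv_gradMeanCurvCoord_meanCurv hu, hzero, dirDeriv_zero_dir]

lemma exists_eq_orth_add_gradMeanCurvCoord (hw : gradMeanCurvSq X N u ≠ 0) (v : Euc m) :
    ∃ z, dirDeriv z (meanCurv X N) u = 0 ∧
      v = z + (dirDeriv v (meanCurv X N) u / gradMeanCurvSq X N u) • gradMeanCurvCoord X N u := by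
  refine ⟨v - (dirDeriv v (meanCurv X N) u / gradMeanCurvSq X N u) • gradMeanCurvCoord X N u, ?_,
    (sub_add_cancel _ _).symm⟩
  rw [dirDeriv_sub_dir, dirDeriv_smul_dir, h.dirDeriv_gradMeanCurvCoord_meanCurv hu, smul_eq_mul,
    div_mul_cancel₀ _ hw, sub_self]

/-- One principal curvature is `-f / 2`, and the other one follows from the trace, given the
multiplicity `k` of the first. -/
lemma exists_quadratic_at (hb : bitension (inducedMetric X) X u = 0)
    (hs : (principalCurvatures X u (N u)).encard ≤ 2)
    (hf : meanCurv X N u ≠ 0) (hw : gradMeanCurvSq X N u ≠ 0) :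
    ∃ k < m, SatisfiesQuadratic (shape X N u) (-(meanCurv X N u) / 2)
      ((1 + k / 2) / (m - k) * meanCurv X N u) := by
  have hξ := h.shape_gradMeanCurvCoord hu hb
  have hξ0 := h.gradMeanCurvCoord_ne_zero hu hw
  have htwo : ∀ b, HasExactlyTwoEigenvalues (shape X N u) (-(meanCurv X N u) / 2) b →
      ∃ k < m, SatisfiesQuadratic (shape X N u) (-(meanCurv X N u) / 2)
        ((1 + k / 2) / (m - k) * meanCurv X N u) := by
    intro b hA
    obtain ⟨k, -, hkm, htrace⟩ := hA.exists_trace_eq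
    rw [h.trace_shape hu, finrank_euclideanSpace_fin] at htrace
    rw [finrank_euclideanSpace_fin] at hkm
    have hmk : (m : ℝ) - k ≠ 0 := sub_ne_zero.2 (by exact_mod_cast hkm.ne')
    have hb : b = (1 + k / 2) / (m - k) * meanCurv X N u := by
      field_simp
      linarith
    exact ⟨k, hkm, hb ▸ hA.quadratic⟩
  rcases h.shape_scalar_or_hasExactlyTwoEigenvalues hu hs with ⟨a, ha⟩ | ⟨a, b, hA⟩
  · have haf : a = -(meanCurv X N u) / 2 := smul_left_injective ℝ hξ0 ((ha _).symm.trans hξ)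
    have htrace := h.trace_shape hu
    rw [show shape X N u = a • LinearMap.id from LinearMap.ext ha, map_smul, LinearMap.trace_id,
      finrank_euclideanSpace_fin, smul_eq_mul, haf] at htrace
    have hprod : meanCurv X N u * (1 + m / 2) = 0 := by linarith
    exact absurd hprod (mul_ne_zero hf (by positivity))
  · rcases hA.quadratic.eq_or_eq hξ0 hξ with rfl | rfl
    · exact htwo b hA
    · exact htwo a hA.symm

lemma trace_ratio_eq {c : ℝ} (hf : meanCurv X N u ≠ 0)
    (hA : SatisfiesQuadratic (shape X N u) (-(meanCurv X N u) / 2) (c * meanCurv X N u)) :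
    (LinearMap.trace ℝ (Euc m) (shape X N u * shape X N u) / meanCurv X N u ^ 2 + 1 / 2)
      / (1 + m / 2) = c := by
  rw [hA.trace_sq, h.trace_shape hu, finrank_euclideanSpace_fin]
  field_simp
  ring

omit hu

/-- The multiplicity of `-f / 2`, hence also `c`, is locally constant. -/
lemma exists_quadratic (hU : IsPreconnected U) (hne : U.Nonempty)
    (hb : ∀ u ∈ U, bitension (inducedMetric X) X u = 0)
    (hs : ∀ u ∈ U, (principalCurvatures X u (N u)).encard ≤ 2)
    (hf : ∀ u ∈ U, meanCurv X N u ≠ 0) (hw : ∀ u ∈ U, gradMeanCurvSq X N u ≠ 0) :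
    ∃ c : ℝ, 0 < c ∧ ∀ u ∈ U,
      SatisfiesQuadratic (shape X N u) (-(meanCurv X N u) / 2) (c * meanCurv X N u) := by
  obtain ⟨u₀, hu₀⟩ := hne
  let ratio : Euc m → ℝ := fun u =>
    (LinearMap.trace ℝ (Euc m) (shape X N u * shape X N u) / meanCurv X N u ^ 2 + 1 / 2)
      / (1 + m / 2)
  have hcont : ContinuousOn ratio U :=
    ((h.continuousOn_trace_shape_sq.div (fun u hu =>
      ((h.smoothAt_meanCurv hu).continuousAt.pow 2).continuousWithinAt)
      fun u hu => pow_ne_zero 2 (hf u hu)).add continuousOn_const).div_const _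
  let values : Set ℝ := (fun k : ℕ => (1 + (k : ℝ) / 2) / (m - k)) '' Set.Iio m
  have hquad : ∀ u ∈ U, ratio u ∈ values ∧
      SatisfiesQuadratic (shape X N u) (-(meanCurv X N u) / 2) (ratio u * meanCurv X N u) := by
    intro u hu
    obtain ⟨k, hkm, hA⟩ := h.exists_quadratic_at hu (hb u hu) (hs u hu) (hf u hu) (hw u hu)
    have hratio : ratio u = (1 + k / 2) / (m - k) := h.trace_ratio_eq hu (hf u hu) hA
    exact ⟨⟨k, hkm, hratio.symm⟩, hratio ▸ hA⟩
  have hvalues : IsDiscrete values := ((Set.finite_Iio m).image _).isDiscrete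
  refine ⟨ratio u₀, ?_, fun u hu => ?_⟩
  · obtain ⟨k, hkm, hk⟩ := (hquad u₀ hu₀).1
    have hmk : (0 : ℝ) < m - k := sub_pos.2 (by exact_mod_cast hkm)
    rw [← hk]
    positivity
  · rw [hU.constant_of_mapsTo hvalues hcont (fun u hu => (hquad u hu).1) hu₀ hu]
    exact (hquad u hu).2

end Patch

/-- A biharmonic patch on which the mean curvature `f` and its gradient vanish nowhere, and whose
shape operator has eigenvalue `-f / 2` along the gradient and `c f` on its orthogonal complement.
This is the situation that has to be excluded in order to show that `f` is constant. -/
structure GradientPatch (X N : Euc m → F) (U : Set (Euc m)) (c : ℝ) : Prop extends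
    Patch X N U where
  bitension_eq_zero : ∀ u ∈ U, bitension (inducedMetric X) X u = 0
  pos : 0 < c
  meanCurv_ne_zero : ∀ u ∈ U, meanCurv X N u ≠ 0
  gradMeanCurvSq_ne_zero : ∀ u ∈ U, gradMeanCurvSq X N u ≠ 0
  shape_eq : ∀ u ∈ U, ∀ v, shape X N u v = (c * meanCurv X N u) • v
    + (-(c + 1 / 2) * meanCurv X N u / gradMeanCurvSq X N u * dirDeriv v (meanCurv X N) u)
      • gradMeanCurvCoord X N u

namespace Patch

variable {X N : Euc m → F} {U : Set (Euc m)} (h : Patch X N U)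
include h

section EigenspaceOfGradient

variable {u : Euc m} (hu : u ∈ U)
include hu

lemma dirDeriv_shape_meanCurv (hb : bitension (inducedMetric X) X u = 0) (v : Euc m) :
    dirDeriv (shape X N u v) (meanCurv X N) u
      = -(meanCurv X N u) / 2 * dirDeriv v (meanCurv X N) u := by
  have hsymm := h.inner_shape_comm hu v (gradMeanCurvCoord X N u)
  rwa [h.shape_gradMeanCurvCoord hu hb, dirDeriv_smul_dir, h.DX_gradMeanCurvCoord hu,
    inner_smul_right, real_inner_comm, h.inner_gradMeanCurv hu, real_inner_comm,
    h.inner_gradMeanCurv hu] at hsymm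

/-- By the Codazzi equation a second eigenvector of `-f / 2` would make `f` constant along the
gradient of `f`. -/
lemma eq_zero_of_mem_eigenspace_of_orth {c : ℝ} (hc : 0 < c)
    (hb : bitension (inducedMetric X) X u = 0) (hf : meanCurv X N u ≠ 0)
    (hw : gradMeanCurvSq X N u ≠ 0) (hq : ∀ x ∈ U,
      SatisfiesQuadratic (shape X N x) (-(meanCurv X N x) / 2) (c * meanCurv X N x))
    {z : Euc m} (hz : shape X N u z = (-(meanCurv X N u) / 2) • z)
    (horth : dirDeriv z (meanCurv X N) u = 0) : z = 0 := by
  have hfd := (h.smoothAt_meanCurv hu).differentiableAt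
  have hne : -(meanCurv X N u) / 2 ≠ c * meanCurv X N u := by
    intro heq
    have hprod : meanCurv X N u * (c + 1 / 2) = 0 := by linarith
    exact absurd hprod (mul_ne_zero hf (by positivity))
  have hhalf : DifferentiableAt ℝ (fun x => -(meanCurv X N x) / 2) u := by fun_prop
  have hcodazzi : ∀ {v w : Euc m}, shape X N u v = (-(meanCurv X N u) / 2) • v →
      shape X N u w = (-(meanCurv X N u) / 2) • w → ∀ a, _ := fun hv hw a =>
    h.inner_DDN_sub_of_mem_eigenspace hu hhalf (hfd.const_mul c) hq hne hv hw a
  have hξ := h.shape_gradMeanCurvCoord hu hb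
  have hzz := hcodazzi hz hz (gradMeanCurvCoord X N u)
  have hξz := hcodazzi hξ hz z
  rw [dirDeriv_comm (h.smoothAt_X u hu) z, dirDeriv_comm (h.smoothAt_N u hu) z, hzz,
    dirDeriv_neg_div_two hfd, dirDeriv_neg_div_two hfd, horth,
      h.dirDeriv_gradMeanCurvCoord_meanCurv hu] at hξz
  have hnorm : gradMeanCurvSq X N u * ⟪dirDeriv z X u, dirDeriv z X u⟫_ℝ = 0 := by linarith
  have hDX := inner_self_eq_zero.1 ((mul_eq_zero.1 hnorm).resolve_left hw)
  exact h.DX_injective hu (hDX.trans (dirDeriv_zero_dir X u).symm)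

end EigenspaceOfGradient

lemma gradientPatch_of_quadratic {c : ℝ} (hc : 0 < c)
    (hb : ∀ u ∈ U, bitension (inducedMetric X) X u = 0)
    (hf : ∀ u ∈ U, meanCurv X N u ≠ 0) (hw : ∀ u ∈ U, gradMeanCurvSq X N u ≠ 0)
    (hq : ∀ u ∈ U,
      SatisfiesQuadratic (shape X N u) (-(meanCurv X N u) / 2) (c * meanCurv X N u)) :
    GradientPatch X N U c := by
  refine ⟨h, hb, hc, hf, hw, fun u hu v => ?_⟩
  have hξ := h.shape_gradMeanCurvCoord hu (hb u hu)
  set y := shape X N u v - (c * meanCurv X N u) • v with hy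
  have hAy : shape X N u y = (-(meanCurv X N u) / 2) • y := by
    rw [hy, map_sub, map_smul, hq u hu]
    module
  have hdy : dirDeriv y (meanCurv X N) u
      = -(c + 1 / 2) * meanCurv X N u * dirDeriv v (meanCurv X N) u := by
    rw [hy, dirDeriv_sub_dir, dirDeriv_smul_dir, h.dirDeriv_shape_meanCurv hu (hb u hu),
      smul_eq_mul]
    ring
  obtain ⟨z, hz0, hz⟩ := h.exists_eq_orth_add_gradMeanCurvCoord hu (hw u hu) y
  have hAz : shape X N u z = (-(meanCurv X N u) / 2) • z := by
    rw [eq_sub_of_add_eq hz.symm, map_sub, map_smul, hξ, hAy]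
    module
  rw [h.eq_zero_of_mem_eigenspace_of_orth hu hc (hb u hu) (hf u hu) (hw u hu) hq hAz hz0,
    zero_add, hdy] at hz
  rw [← sub_eq_iff_eq_add', ← hy, hz]
  congr 1
  ring

end Patch

/-- The derivative of `gradMeanCurvSq` as a function of the mean curvature, on the set where the
former is a function of the latter and does not vanish. -/
def gradMeanCurvSqSlope (X N : Euc m → F) (u : Euc m) : ℝ :=
  dirDeriv (gradMeanCurvCoord X N u) (gradMeanCurvSq X N) u / gradMeanCurvSq X N u

/-- The eigenvalue of the Hessian of the mean curvature on the orthogonal complement of its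
gradient, for a `GradientPatch` of constant `c`. -/
def orthHessEigenvalue (X N : Euc m → F) (c : ℝ) (u : Euc m) : ℝ :=
  -(c / (c + 1 / 2)) * gradMeanCurvSq X N u / meanCurv X N u

/-- The component of the derivative of the gradient in the direction of the gradient; see
`GradientPatch.dirDeriv_gradMeanCurv`. -/
def gradMeanCurvRadial (X N : Euc m → F) (c : ℝ) (u : Euc m) : F :=
  ((gradMeanCurvSqSlope X N u / 2 - orthHessEigenvalue X N c u) / gradMeanCurvSq X N u) •
    gradMeanCurv X N u + (-(meanCurv X N u) / 2) • N u - X u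

namespace GradientPatch

variable {X N : Euc m → F} {U : Set (Euc m)} {c : ℝ} (h : GradientPatch X N U c) {u : Euc m}
  (hu : u ∈ U)
include h

lemma coeff_ne_zero : c + 1 / 2 ≠ 0 := by linarith [h.pos]

include hu

lemma shape_gradMeanCurvCoord :
    shape X N u (gradMeanCurvCoord X N u) = (-(meanCurv X N u) / 2) • gradMeanCurvCoord X N u := by
  rw [h.shape_eq u hu, h.dirDeriv_gradMeanCurvCoord_meanCurv hu,
    div_mul_cancel₀ _ (h.gradMeanCurvSq_ne_zero u hu), ← add_smul]
  congr 1
  ring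

lemma satisfiesQuadratic :
    SatisfiesQuadratic (shape X N u) (-(meanCurv X N u) / 2) (c * meanCurv X N u) := fun v => by
  have hAA := congrArg (shape X N u) (h.shape_eq u hu v)
  rw [map_add, map_smul, map_smul, h.shape_gradMeanCurvCoord hu] at hAA
  rw [hAA, h.shape_eq u hu v]
  module

lemma dirDeriv_N (v : Euc m) :
    dirDeriv v N u = -(c * meanCurv X N u) • dirDeriv v X u + dirDeriv v (meanCurv X N) u •
      (((c + 1 / 2) * meanCurv X N u / gradMeanCurvSq X N u) • gradMeanCurv X N u) := by
  rw [← neg_inj, ← h.DX_shape hu, h.shape_eq u hu, dirDeriv_add_dir, dirDeriv_smul_dir,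
    dirDeriv_smul_dir, h.DX_gradMeanCurvCoord hu]
  module

lemma dirDeriv_N_of_orth {v : Euc m} (hv : dirDeriv v (meanCurv X N) u = 0) :
    dirDeriv v N u = -(c * meanCurv X N u) • dirDeriv v X u := by
  rw [h.dirDeriv_N hu, hv, zero_smul, add_zero]

/-- The integrability condition of the equation `dirDeriv_N`. -/
lemma dirDeriv_smul_gradMeanCurv_of_orth {v : Euc m} (hv : dirDeriv v (meanCurv X N) u = 0) :
    dirDeriv v (fun x => ((c + 1 / 2) * meanCurv X N x / gradMeanCurvSq X N x) •
      gradMeanCurv X N x) u = -c • dirDeriv v X u := by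
  have hf := h.smoothAt_meanCurv hu
  have hcoeff : SmoothAt (fun x => (c + 1 / 2) * meanCurv X N x / gradMeanCurvSq X N x) u :=
    (contDiffAt_const.mul hf).fun_div (h.smoothAt_gradMeanCurvSq hu) (h.gradMeanCurvSq_ne_zero u hu)
  have hcommute := integrability_of_dirDeriv_eq h.isOpen hu (h.smoothAt_N u hu)
    (h.smoothAt_X u hu) hf (hf.differentiableAt.const_mul c).fun_neg
    (hcoeff.differentiableAt.fun_smul (h.smoothAt_gradMeanCurv hu).differentiableAt)
    (fun x hx v => h.dirDeriv_N hx v) v (gradMeanCurvCoord X N u)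
  rw [dirDeriv_neg, dirDeriv_neg, dirDeriv_const_mul _ hf.differentiableAt,
    dirDeriv_const_mul _ hf.differentiableAt, hv, h.dirDeriv_gradMeanCurvCoord_meanCurv hu,
    mul_zero, neg_zero, zero_smul, zero_smul, zero_add, add_zero] at hcommute
  refine smul_right_injective F (h.gradMeanCurvSq_ne_zero u hu) ?_
  simp only [hcommute]
  module

lemma smul_dirDeriv_gradMeanCurv_of_orth {v : Euc m} (hv : dirDeriv v (meanCurv X N) u = 0) :
    (gradMeanCurvSq X N u) • dirDeriv v (gradMeanCurv X N) u
      = (orthHessEigenvalue X N c u * gradMeanCurvSq X N u) • dirDeriv v X u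
        + dirDeriv v (gradMeanCurvSq X N) u • gradMeanCurv X N u := by
  have hf := (h.smoothAt_meanCurv hu).differentiableAt
  have hf0 := h.meanCurv_ne_zero u hu
  have hw := (h.smoothAt_gradMeanCurvSq hu).differentiableAt
  have hw0 := h.gradMeanCurvSq_ne_zero u hu
  have hc := h.coeff_ne_zero
  have hcoeff : DifferentiableAt ℝ
      (fun x => (c + 1 / 2) * meanCurv X N x / gradMeanCurvSq X N x) u :=
    by fun_prop (disch := exact hw0)
  have hproduct := h.dirDeriv_smul_gradMeanCurv_of_orth hu hv
  rw [dirDeriv_smul hcoeff (h.smoothAt_gradMeanCurv hu).differentiableAt,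
    dirDeriv_div (hf.const_mul _) hw hw0, dirDeriv_const_mul _ hf, hv] at hproduct
  rw [orthHessEigenvalue]
  generalize c + 1 / 2 = b at hc hproduct ⊢
  linear_combination (norm := (match_scalars <;> field_simp <;> ring))
    (gradMeanCurvSq X N u ^ 2 / (b * meanCurv X N u)) • hproduct

lemma dirDeriv_gradMeanCurvSq_of_orth {v : Euc m} (hv : dirDeriv v (meanCurv X N) u = 0) :
    dirDeriv v (gradMeanCurvSq X N) u = 0 := by
  have hradial := congrArg (fun y => ⟪y, gradMeanCurv X N u⟫_ℝ)
    (h.smul_dirDeriv_gradMeanCurv_of_orth hu hv)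
  have hDw := h.dirDeriv_gradMeanCurvSq hu v
  have hG : ⟪gradMeanCurv X N u, gradMeanCurv X N u⟫_ℝ = gradMeanCurvSq X N u := rfl
  simp only [inner_add_left, inner_smul_left, conj_trivial] at hradial
  rw [real_inner_comm (gradMeanCurv X N u) (dirDeriv v X u), h.inner_gradMeanCurv hu, hv,
    hG] at hradial
  apply mul_left_cancel₀ (h.gradMeanCurvSq_ne_zero u hu)
  linear_combination -2 * hradial - gradMeanCurvSq X N u * hDw

lemma dirDeriv_gradMeanCurv_of_orth {v : Euc m} (hv : dirDeriv v (meanCurv X N) u = 0) :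
    dirDeriv v (gradMeanCurv X N) u = orthHessEigenvalue X N c u • dirDeriv v X u := by
  have hsmul := h.smul_dirDeriv_gradMeanCurv_of_orth hu hv
  rw [h.dirDeriv_gradMeanCurvSq_of_orth hu hv, zero_smul, add_zero, mul_comm, mul_smul] at hsmul
  exact smul_right_injective F (h.gradMeanCurvSq_ne_zero u hu) hsmul

lemma dirDeriv_gradMeanCurvSq_eq_slope_mul (v : Euc m) :
    dirDeriv v (gradMeanCurvSq X N) u
      = gradMeanCurvSqSlope X N u * dirDeriv v (meanCurv X N) u := by
  obtain ⟨z, hz0, hz⟩ := h.exists_eq_orth_add_gradMeanCurvCoord hu (h.gradMeanCurvSq_ne_zero u hu) v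
  conv_lhs => rw [hz]
  rw [dirDeriv_add_dir, dirDeriv_smul_dir, h.dirDeriv_gradMeanCurvSq_of_orth hu hz0, smul_eq_mul,
    gradMeanCurvSqSlope]
  ring

lemma dirDeriv_gradMeanCurvCoord_N :
    dirDeriv (gradMeanCurvCoord X N u) N u = (meanCurv X N u / 2) • gradMeanCurv X N u := by
  rw [h.dirDeriv_N_of_shape_eq_smul hu (h.shape_gradMeanCurvCoord hu), h.DX_gradMeanCurvCoord hu]
  module

lemma dirDeriv_gradMeanCurvCoord_gradMeanCurv :
    dirDeriv (gradMeanCurvCoord X N u) (gradMeanCurv X N) u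
      = (gradMeanCurvSqSlope X N u / 2) • gradMeanCurv X N u
        + gradMeanCurvSq X N u • ((-(meanCurv X N u) / 2) • N u - X u) := by
  have hG := (h.smoothAt_gradMeanCurv hu).differentiableAt
  have hGG : ⟪gradMeanCurv X N u, gradMeanCurv X N u⟫_ℝ = gradMeanCurvSq X N u := rfl
  refine h.ext_inner hu ?_ ?_ fun v => ?_
  · rw [inner_dirDeriv_eq_neg_of_inner_const h.isOpen hu (h.differentiableAt_N hu) hG
      (fun x hx => h.inner_N_gradMeanCurv hx), h.dirDeriv_gradMeanCurvCoord_N hu, inner_smul_left,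
      hGG]
    simp only [inner_add_right, inner_sub_right, inner_smul_right, h.inner_N_gradMeanCurv hu,
      h.inner_N_N u hu, real_inner_comm (X u) (N u), h.inner_X_N u hu, conj_trivial]
    ring
  · rw [inner_dirDeriv_eq_neg_of_inner_const h.isOpen hu (h.differentiableAt_X hu) hG
      (fun x hx => h.inner_X_gradMeanCurv hx), h.DX_gradMeanCurvCoord hu, hGG]
    simp only [inner_add_right, inner_sub_right, inner_smul_right, h.inner_X_gradMeanCurv hu,
      h.inner_X_X u hu, h.inner_X_N u hu]
    ring
  · have hsymm : ⟪dirDeriv (gradMeanCurvCoord X N u) (gradMeanCurv X N) u, dirDeriv v X u⟫_ℝ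
        = ⟪dirDeriv v (gradMeanCurv X N) u, gradMeanCurv X N u⟫_ℝ := by
      conv_rhs => rw [← h.DX_gradMeanCurvCoord hu]
      rw [h.inner_D_gradMeanCurv hu, h.inner_D_gradMeanCurv hu, dirDeriv_comm (h.smoothAt_X u hu),
        dirDeriv_comm (h.smoothAt_meanCurv hu)]
    have hDw := h.dirDeriv_gradMeanCurvSq hu v
    rw [h.dirDeriv_gradMeanCurvSq_eq_slope_mul hu] at hDw
    rw [real_inner_comm, hsymm]
    simp only [inner_add_right, inner_sub_right, inner_smul_right, h.inner_DX_N u hu]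
    rw [real_inner_comm (gradMeanCurv X N u) (dirDeriv v X u), h.inner_gradMeanCurv hu,
      real_inner_comm (X u) (dirDeriv v X u), h.inner_X_DX hu]
    linarith

lemma dirDeriv_gradMeanCurv (v : Euc m) :
    dirDeriv v (gradMeanCurv X N) u = orthHessEigenvalue X N c u • dirDeriv v X u
      + dirDeriv v (meanCurv X N) u • gradMeanCurvRadial X N c u := by
  have hw0 := h.gradMeanCurvSq_ne_zero u hu
  obtain ⟨z, hz0, hz⟩ := h.exists_eq_orth_add_gradMeanCurvCoord hu hw0 v
  have hDG : dirDeriv v (gradMeanCurv X N) u = _ := congrArg (dirDeriv · (gradMeanCurv X N) u) hz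
  have hDX : dirDeriv v X u = _ := congrArg (dirDeriv · X u) hz
  rw [dirDeriv_add_dir, dirDeriv_smul_dir] at hDG hDX
  rw [hDG, hDX, h.dirDeriv_gradMeanCurv_of_orth hu hz0,
    h.dirDeriv_gradMeanCurvCoord_gradMeanCurv hu, h.DX_gradMeanCurvCoord hu, gradMeanCurvRadial]
  match_scalars <;> field_simp
  ring

lemma mul_dim_sub_one : c * (m - 1) = 3 / 2 := by
  have htrace := trace_scalar_add_rankOne (h.shape_eq u hu)
  rw [h.trace_shape hu, h.dirDeriv_gradMeanCurvCoord_meanCurv hu,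
    div_mul_cancel₀ _ (h.gradMeanCurvSq_ne_zero u hu)] at htrace
  apply mul_right_cancel₀ (h.meanCurv_ne_zero u hu)
  linarith

lemma one_lt_dim : 1 < m := by
  by_contra! hm
  have hm' : (m : ℝ) ≤ 1 := by exact_mod_cast hm
  have hc := h.mul_dim_sub_one hu
  linarith [mul_nonpos_of_nonneg_of_nonpos h.pos.le (sub_nonpos.2 hm')]

lemma exists_ne_zero_dirDeriv_meanCurv_eq_zero :
    ∃ v : Euc m, v ≠ 0 ∧ dirDeriv v (meanCurv X N) u = 0 := by
  have hker : LinearMap.ker (fderiv ℝ (meanCurv X N) u : Euc m →ₗ[ℝ] ℝ) ≠ ⊥ :=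
    LinearMap.ker_ne_bot_of_finrank_lt (by simpa using h.one_lt_dim hu)
  obtain ⟨v, hv, hv0⟩ := Submodule.exists_mem_ne_zero_of_ne_bot hker
  exact ⟨v, hv0, hv⟩

lemma gradMeanCurvSqSlope_eq : gradMeanCurvSqSlope X N u
    = 2 * (((c - 1 / 2 + m * c / 2) * meanCurv X N u ^ 2 - m) * meanCurv X N u
      - (m - 1) * orthHessEigenvalue X N c u) := by
  let σ := (gradMeanCurvSqSlope X N u / 2 - orthHessEigenvalue X N c u) / gradMeanCurvSq X N u
  let hessian : Euc m →ₗ[ℝ] Euc m := orthHessEigenvalue X N c u • LinearMap.id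
    + σ • (fderiv ℝ (meanCurv X N) u : Euc m →ₗ[ℝ] ℝ).smulRight (gradMeanCurvCoord X N u)
  have hhessian : ∀ v, hessian v = orthHessEigenvalue X N c u • v
      + (σ * dirDeriv v (meanCurv X N) u) • gradMeanCurvCoord X N u := fun v => by
    rw [mul_smul]; rfl
  have htrace := h.trace_eq_sum_inner_dualFrame hu (T := hessian)
    (P := fun v => dirDeriv v (gradMeanCurv X N) u) fun v w => by
      rw [h.dirDeriv_gradMeanCurv hu, hhessian, dirDeriv_add_dir, dirDeriv_smul_dir,
        dirDeriv_smul_dir, h.DX_gradMeanCurvCoord hu, gradMeanCurvRadial]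
      simp only [inner_add_left, inner_sub_left, inner_smul_left, conj_trivial, h.inner_N_DX hu,
        h.inner_X_DX hu, σ]
      ring
  have hlaplacian := h.laplacian_meanCurv hu (h.bitension_eq_zero u hu)
  rw [(h.satisfiesQuadratic hu).trace_sq, h.trace_shape hu, finrank_euclideanSpace_fin]
    at hlaplacian
  rw [trace_scalar_add_rankOne hhessian, h.dirDeriv_gradMeanCurvCoord_meanCurv hu,
    div_mul_cancel₀ _ (h.gradMeanCurvSq_ne_zero u hu)] at htrace
  linear_combination 2 * htrace.trans hlaplacian

lemma smoothAt_orthHessEigenvalue : SmoothAt (orthHessEigenvalue X N c) u :=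
  (contDiffAt_const.mul (h.smoothAt_gradMeanCurvSq hu)).div (h.smoothAt_meanCurv hu)
    (h.meanCurv_ne_zero u hu)

lemma differentiableAt_gradMeanCurvSqSlope : DifferentiableAt ℝ (gradMeanCurvSqSlope X N) u := by
  have hf := (h.smoothAt_meanCurv hu).differentiableAt
  have hρ := (h.smoothAt_orthHessEigenvalue hu).differentiableAt
  refine DifferentiableAt.congr_of_eventuallyEq ?_
    (Filter.eventually_of_mem (h.isOpen.mem_nhds hu) fun x hx => h.gradMeanCurvSqSlope_eq hx)
  fun_prop

lemma differentiableAt_gradMeanCurvRadial : DifferentiableAt ℝ (gradMeanCurvRadial X N c) u := by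
  have hf := (h.smoothAt_meanCurv hu).differentiableAt
  have hw := (h.smoothAt_gradMeanCurvSq hu).differentiableAt
  have hG := (h.smoothAt_gradMeanCurv hu).differentiableAt
  have hρ := (h.smoothAt_orthHessEigenvalue hu).differentiableAt
  have hslope := h.differentiableAt_gradMeanCurvSqSlope hu
  have hX := h.differentiableAt_X hu
  have hN := h.differentiableAt_N hu
  unfold gradMeanCurvRadial
  fun_prop (disch := exact h.gradMeanCurvSq_ne_zero u hu)

lemma dirDeriv_orthHessEigenvalue (v : Euc m) : dirDeriv v (orthHessEigenvalue X N c) u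
    = -(c / (c + 1 / 2)) * ((gradMeanCurvSqSlope X N u * meanCurv X N u - gradMeanCurvSq X N u)
      / meanCurv X N u ^ 2) * dirDeriv v (meanCurv X N) u := by
  have hf := (h.smoothAt_meanCurv hu).differentiableAt
  have hw := (h.smoothAt_gradMeanCurvSq hu).differentiableAt
  have hquotient := dirDeriv_div (hw.const_mul (-(c / (c + 1 / 2)))) hf (h.meanCurv_ne_zero u hu) v
  rw [dirDeriv_const_mul _ hw, h.dirDeriv_gradMeanCurvSq_eq_slope_mul hu] at hquotient
  exact hquotient.trans (by ring)

lemma dirDeriv_gradMeanCurvSqSlope_of_orth {v : Euc m} (hv : dirDeriv v (meanCurv X N) u = 0) :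
    dirDeriv v (gradMeanCurvSqSlope X N) u = 0 := by
  have hcommute := integrability_of_dirDeriv_eq h.isOpen hu (h.smoothAt_gradMeanCurvSq hu)
    (contDiffAt_const (c := (0 : ℝ))) (h.smoothAt_meanCurv hu)
    (differentiableAt_const (c := (0 : ℝ))) (h.differentiableAt_gradMeanCurvSqSlope hu)
    (fun x hx v => by
      rw [h.dirDeriv_gradMeanCurvSq_eq_slope_mul hx, zero_smul, zero_add, smul_eq_mul, mul_comm])
    v (gradMeanCurvCoord X N u)
  simp only [dirDeriv_const, zero_smul, zero_add, hv,
    h.dirDeriv_gradMeanCurvCoord_meanCurv hu] at hcommute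
  exact (smul_eq_zero.1 hcommute).resolve_left (h.gradMeanCurvSq_ne_zero u hu)

lemma dirDeriv_gradMeanCurvRadial_of_orth {v : Euc m} (hv : dirDeriv v (meanCurv X N) u = 0) :
    dirDeriv v (gradMeanCurvRadial X N c) u
      = ((gradMeanCurvSqSlope X N u / 2 - orthHessEigenvalue X N c u) / gradMeanCurvSq X N u
          * orthHessEigenvalue X N c u + c * meanCurv X N u ^ 2 / 2 - 1) • dirDeriv v X u := by
  have hf := (h.smoothAt_meanCurv hu).differentiableAt
  have hw := (h.smoothAt_gradMeanCurvSq hu).differentiableAt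
  have hw0 := h.gradMeanCurvSq_ne_zero u hu
  have hG := (h.smoothAt_gradMeanCurv hu).differentiableAt
  have hρ := (h.smoothAt_orthHessEigenvalue hu).differentiableAt
  have hslope := h.differentiableAt_gradMeanCurvSqSlope hu
  have hX := h.differentiableAt_X hu
  have hN := h.differentiableAt_N hu
  have hhalf : DifferentiableAt ℝ (fun x => gradMeanCurvSqSlope X N x / 2) u := by fun_prop
  have hnum : DifferentiableAt ℝ
      (fun x => gradMeanCurvSqSlope X N x / 2 - orthHessEigenvalue X N c x) u := by fun_prop
  have hcoeff : DifferentiableAt ℝ (fun x => (gradMeanCurvSqSlope X N x / 2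
      - orthHessEigenvalue X N c x) / gradMeanCurvSq X N x) u := by
    fun_prop (disch := exact hw0)
  have hneg : DifferentiableAt ℝ (fun x => -(meanCurv X N x) / 2) u := by fun_prop
  have hhalf_const : dirDeriv v (fun x => gradMeanCurvSqSlope X N x / 2) u = 0 := by
    rw [dirDeriv_div hslope (differentiableAt_const _) two_ne_zero, dirDeriv_const,
      h.dirDeriv_gradMeanCurvSqSlope_of_orth hu hv]
    ring
  have hcoeff_const : dirDeriv v (fun x => (gradMeanCurvSqSlope X N x / 2
      - orthHessEigenvalue X N c x) / gradMeanCurvSq X N x) u = 0 := by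
    rw [dirDeriv_div hnum hw hw0, dirDeriv_sub hhalf hρ, hhalf_const,
      h.dirDeriv_orthHessEigenvalue hu, h.dirDeriv_gradMeanCurvSq_of_orth hu hv, hv]
    ring
  unfold gradMeanCurvRadial
  rw [dirDeriv_sub ((hcoeff.fun_smul hG).fun_add (hneg.fun_smul hN)) hX,
    dirDeriv_add (hcoeff.fun_smul hG) (hneg.fun_smul hN), dirDeriv_smul hcoeff hG,
    dirDeriv_smul hneg hN, hcoeff_const, dirDeriv_neg_div_two hf, hv,
    h.dirDeriv_gradMeanCurv_of_orth hu hv, h.dirDeriv_N_of_orth hu hv]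
  module

/-- The component of the Gauss equation in the plane spanned by the gradient of the mean curvature
and a vector orthogonal to it. -/
lemma gauss_equation :
    -(c / (c + 1 / 2)) * ((gradMeanCurvSqSlope X N u * meanCurv X N u - gradMeanCurvSq X N u)
        / meanCurv X N u ^ 2)
      = (gradMeanCurvSqSlope X N u / 2 - orthHessEigenvalue X N c u) / gradMeanCurvSq X N u
        * orthHessEigenvalue X N c u + c * meanCurv X N u ^ 2 / 2 - 1 := by
  obtain ⟨v, hv0, hv⟩ := h.exists_ne_zero_dirDeriv_meanCurv_eq_zero hu
  have hDX : dirDeriv v X u ≠ 0 := fun hzero =>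
    hv0 (h.DX_injective hu (hzero.trans (dirDeriv_zero_dir X u).symm))
  have hcommute := integrability_of_dirDeriv_eq h.isOpen hu (h.smoothAt_gradMeanCurv hu)
    (h.smoothAt_X u hu) (h.smoothAt_meanCurv hu)
    (h.smoothAt_orthHessEigenvalue hu).differentiableAt
    (h.differentiableAt_gradMeanCurvRadial hu) (fun x hx v => h.dirDeriv_gradMeanCurv hx v)
    (gradMeanCurvCoord X N u) v
  rw [h.dirDeriv_orthHessEigenvalue hu, h.dirDeriv_orthHessEigenvalue hu, hv,
    h.dirDeriv_gradMeanCurvCoord_meanCurv hu, mul_zero, zero_smul, zero_smul, add_zero, zero_add,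
    h.dirDeriv_gradMeanCurvRadial_of_orth hu hv, smul_smul] at hcommute
  apply mul_right_cancel₀ (h.gradMeanCurvSq_ne_zero u hu)
  rw [smul_left_injective ℝ hDX hcommute, mul_comm]

lemma neg_div_coeff_eq : -(c / (c + 1 / 2)) = -3 / (m + 2) := by
  have hc := h.coeff_ne_zero
  have hm : (m : ℝ) + 2 ≠ 0 := by positivity
  rw [← neg_div, div_eq_div_iff hc hm]
  linear_combination -h.mul_dim_sub_one hu

end GradientPatch

section Elimination

/-! In the application `f`, `w` and `w₁` are the mean curvature, `gradMeanCurvSq` and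
`gradMeanCurvSqSlope`, `μ` is the dimension, `k = -(c / (c + 1 / 2))` and
`c₂ = c - 1 / 2 + μ * c / 2`. -/

variable {α β γ k c c₂ μ f w w₁ : ℝ}

lemma linear_relation_of_gauss (hf : f ≠ 0) (hw : w ≠ 0)
    (hslope : w₁ = 2 * ((c₂ * f ^ 2 - μ) * f - (μ - 1) * (k * w / f)))
    (hgauss : k * ((w₁ * f - w) / f ^ 2)
      = (w₁ / 2 - k * w / f) / w * (k * w / f) + c * f ^ 2 / 2 - 1) :
    (-(μ - 2) * k ^ 2 - k) * w + ((k * c₂ - c / 2) * f ^ 4 + (1 - k * μ) * f ^ 2) = 0 := by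
  subst hslope
  field_simp at hgauss
  linear_combination (1 / 2) * hgauss

lemma quadratic_relation_of_linear (hf : f ≠ 0)
    (hslope : w₁ = 2 * ((c₂ * f ^ 2 - μ) * f - (μ - 1) * (k * w / f)))
    (hw : α * w + (γ * f ^ 4 + β * f ^ 2) = 0)
    (hdw : α * w₁ + 4 * γ * f ^ 3 + 2 * β * f = 0) :
    (α * c₂ + (μ - 1) * k * γ + 2 * γ) * f ^ 2 + (-α * μ + (μ - 1) * k * β + β) = 0 := by
  subst hslope
  field_simp at hdw
  apply mul_left_cancel₀ (pow_ne_zero 2 hf)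
  linear_combination (1 / 2) * hdw + (μ - 1) * k * hw

end Elimination

namespace GradientPatch

variable {X N : Euc m → F} {U : Set (Euc m)} {c : ℝ} (h : GradientPatch X N U c)
include h

lemma gradMeanCurvSq_relation {u : Euc m} (hu : u ∈ U) :
    let k := -(c / (c + 1 / 2))
    (-(m - 2) * k ^ 2 - k) * gradMeanCurvSq X N u
      + ((k * (c - 1 / 2 + m * c / 2) - c / 2) * meanCurv X N u ^ 4
        + (1 - k * m) * meanCurv X N u ^ 2) = 0 :=
  linear_relation_of_gauss (h.meanCurv_ne_zero u hu) (h.gradMeanCurvSq_ne_zero u hu)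
    (h.gradMeanCurvSqSlope_eq hu) (h.gauss_equation hu)

/-- Differentiate `gradMeanCurvSq_relation` along the gradient and eliminate `gradMeanCurvSq`. -/
lemma meanCurv_relation {u : Euc m} (hu : u ∈ U) :
    let k := -(c / (c + 1 / 2))
    let c₂ := c - 1 / 2 + m * c / 2
    let α := -(m - 2) * k ^ 2 - k
    let β := 1 - k * m
    let γ := k * c₂ - c / 2
    (α * c₂ + (m - 1) * k * γ + 2 * γ) * meanCurv X N u ^ 2
      + (-α * m + (m - 1) * k * β + β) = 0 := by
  intro k c₂ α β γ
  have hf := (h.smoothAt_meanCurv hu).differentiableAt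
  have hw := (h.smoothAt_gradMeanCurvSq hu).differentiableAt
  have hw0 := h.gradMeanCurvSq_ne_zero u hu
  have hf4 : DifferentiableAt ℝ (fun x => meanCurv X N x ^ 4) u := by fun_prop
  have hf2 : DifferentiableAt ℝ (fun x => meanCurv X N x ^ 2) u := by fun_prop
  have hderiv := dirDeriv_eq_zero_of_const h.isOpen hu
    (fun x hx => h.gradMeanCurvSq_relation hx) (gradMeanCurvCoord X N u)
  rw [dirDeriv_add (hw.const_mul _) ((hf4.const_mul _).fun_add (hf2.const_mul _)),
    dirDeriv_add (hf4.const_mul _) (hf2.const_mul _), dirDeriv_const_mul _ hw,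
    dirDeriv_const_mul _ hf4, dirDeriv_const_mul _ hf2, dirDeriv_pow hf, dirDeriv_pow hf,
    h.dirDeriv_gradMeanCurvSq_eq_slope_mul hu, h.dirDeriv_gradMeanCurvCoord_meanCurv hu] at hderiv
  refine quadratic_relation_of_linear (h.meanCurv_ne_zero u hu) (h.gradMeanCurvSqSlope_eq hu)
    (h.gradMeanCurvSq_relation hu) (mul_right_cancel₀ hw0 ?_)
  push_cast at hderiv
  linear_combination hderiv

lemma not_mem (u : Euc m) : u ∉ U := by
  intro hu
  have hf := (h.smoothAt_meanCurv hu).differentiableAt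
  have hf2 : DifferentiableAt ℝ (fun x => meanCurv X N x ^ 2) u := by fun_prop
  have hderiv := dirDeriv_eq_zero_of_const h.isOpen hu
    (fun x hx => eq_neg_of_add_eq_zero_left (h.meanCurv_relation hx)) (gradMeanCurvCoord X N u)
  have hrelation := h.meanCurv_relation hu
  rw [dirDeriv_const_mul _ hf2, dirDeriv_pow hf, h.dirDeriv_gradMeanCurvCoord_meanCurv hu] at hderiv
  have hleading := (mul_eq_zero.1 hderiv).resolve_right (mul_ne_zero
    (mul_ne_zero two_ne_zero (pow_ne_zero _ (h.meanCurv_ne_zero u hu)))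
    (h.gradMeanCurvSq_ne_zero u hu))
  dsimp only at hrelation
  rw [hleading, zero_mul, zero_add, h.neg_div_coeff_eq hu] at hrelation
  have hm : (1 : ℝ) < m := by exact_mod_cast h.one_lt_dim hu
  have hpos : 0 < ((m : ℝ) - 1) * (m + 5) := mul_pos (by linarith) (by linarith)
  field_simp at hrelation
  nlinarith

end GradientPatch

namespace Patch

variable {X N : Euc m → F} {U : Set (Euc m)} (h : Patch X N U)
include h

lemma exists_gradMeanCurvSq_eq_zero (hU : IsPreconnected U) (hne : U.Nonempty)
    (hb : ∀ u ∈ U, bitension (inducedMetric X) X u = 0)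
    (hs : ∀ u ∈ U, (principalCurvatures X u (N u)).encard ≤ 2)
    (hf : ∀ u ∈ U, meanCurv X N u ≠ 0) : ∃ u ∈ U, gradMeanCurvSq X N u = 0 := by
  by_contra! hw
  obtain ⟨c, hc, hq⟩ := h.exists_quadratic hU hne hb hs hf hw
  obtain ⟨u, hu⟩ := hne
  exact (h.gradientPatch_of_quadratic hc hb hf hw hq).not_mem u hu

lemma dirDeriv_meanCurv_eq_zero (hb : ∀ u ∈ U, bitension (inducedMetric X) X u = 0)
    (hs : ∀ u ∈ U, (principalCurvatures X u (N u)).encard ≤ 2) {u : Euc m} (hu : u ∈ U)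
    (v : Euc m) : dirDeriv v (meanCurv X N) u = 0 := by
  by_contra hne
  obtain ⟨r, hr, hball⟩ := Metric.eventually_nhds_iff_ball.1 ((h.isOpen.eventually_mem hu).and
    (((h.smoothAt_meanCurv hu).dirDeriv v).continuousAt.eventually_ne hne))
  obtain ⟨y, hy, hfy⟩ : ∃ y ∈ Metric.ball u r, meanCurv X N y ≠ 0 := by
    by_contra! hzero
    exact hne (dirDeriv_eq_zero_of_const Metric.isOpen_ball (Metric.mem_ball_self hr) hzero v)
  obtain ⟨s, hs0, hball'⟩ := Metric.eventually_nhds_iff_ball.1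
    ((Metric.isOpen_ball.eventually_mem hy).and
      ((h.smoothAt_meanCurv (hball y hy).1).continuousAt.eventually_ne hfy))
  have hsub : Metric.ball y s ⊆ U := fun x hx => (hball x (hball' x hx).1).1
  have h' := h.mono Metric.isOpen_ball hsub
  obtain ⟨x, hx, hwx⟩ := h'.exists_gradMeanCurvSq_eq_zero (convex_ball y s).isPreconnected
    ⟨y, Metric.mem_ball_self hs0⟩ (fun x hx => hb x (hsub hx)) (fun x hx => hs x (hsub hx))
    fun x hx => (hball' x hx).2
  apply (hball x (hball' x hx).1).2
  rw [← h'.inner_gradMeanCurv hx, inner_self_eq_zero.1 hwx, inner_zero_left]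

end Patch

end MeanCurvatureGradient

/-! ### Patches of constant mean curvature -/

section ConstantMeanCurvature

variable {m : ℕ} {F : Type*} [NormedAddCommGroup F] [InnerProductSpace ℝ F]

namespace Patch

variable {X N : Euc m → F} {U : Set (Euc m)} (h : Patch X N U)
include h

lemma trace_shape_sq_of_meanCurv_const {f : ℝ} (hf₀ : f ≠ 0) (hf : ∀ u ∈ U, meanCurv X N u = f)
    {u : Euc m} (hu : u ∈ U) (hb : bitension (inducedMetric X) X u = 0) :
    LinearMap.trace ℝ (Euc m) (shape X N u * shape X N u) = m := by
  have hgrad : ∀ x ∈ U, gradMeanCurv X N x = 0 := fun x hx =>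
    Finset.sum_eq_zero fun k _ => by
      rw [pd_eq_dirDeriv, dirDeriv_eq_zero_of_const h.isOpen hx hf, zero_smul]
  have hlaplacian := h.laplacian_meanCurv hu hb
  simp only [pd_eq_dirDeriv, dirDeriv_eq_zero_of_const h.isOpen hu hgrad, inner_zero_left,
    Finset.sum_const_zero, hf u hu] at hlaplacian
  exact sub_eq_zero.1 ((mul_eq_zero.1 hlaplacian.symm).resolve_right hf₀)

lemma shape_eq_smul_of_meanCurv_sq_eq (hm : m ≠ 0) {u : Euc m} (hu : u ∈ U)
    (hf : meanCurv X N u ^ 2 = m ^ 2)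
    (htrace : LinearMap.trace ℝ (Euc m) (shape X N u * shape X N u) = m)
    (hs : (principalCurvatures X u (N u)).encard ≤ 2) (v : Euc m) :
    shape X N u v = (meanCurv X N u / m) • v := by
  rcases h.shape_scalar_or_hasExactlyTwoEigenvalues hu hs with ⟨a, ha⟩ | ⟨a, b, hab⟩
  · have hA : shape X N u = a • LinearMap.id := LinearMap.ext ha
    have hmean : meanCurv X N u = a * m := by
      rw [← h.trace_shape hu, hA, map_smul, LinearMap.trace_id, finrank_euclideanSpace_fin,
        smul_eq_mul]
    rw [ha, hmean, mul_div_cancel_right₀ _ (Nat.cast_ne_zero.2 hm)]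
  · have hlt := hab.trace_sq_lt
    rw [h.trace_shape hu, htrace, hf, finrank_euclideanSpace_fin, ← sq] at hlt
    exact absurd hlt (lt_irrefl _)

lemma hasExactlyTwoEigenvalues_of_meanCurv_sq_ne {u : Euc m} (hu : u ∈ U)
    (hf : meanCurv X N u ^ 2 ≠ m ^ 2)
    (htrace : LinearMap.trace ℝ (Euc m) (shape X N u * shape X N u) = m)
    (hs : (principalCurvatures X u (N u)).encard ≤ 2) :
    ∃ a b, HasExactlyTwoEigenvalues (shape X N u) a b := by
  refine (h.shape_scalar_or_hasExactlyTwoEigenvalues hu hs).resolve_left ?_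
  rintro ⟨a, ha⟩
  refine hf ?_
  rw [← h.trace_shape hu, ← finrank_mul_trace_sq_of_scalar ha, htrace, finrank_euclideanSpace_fin,
    sq]

lemma dirDeriv_add_smul_N_of_shape_eq_smul {a : ℝ} (ha : a ^ 2 = 1) {u : Euc m} (hu : u ∈ U)
    (hA : ∀ v, shape X N u v = a • v) (v : Euc m) :
    dirDeriv v (fun x => X x + a • N x) u = 0 := by
  rw [dirDeriv_add (h.differentiableAt_X hu) ((h.differentiableAt_N hu).fun_const_smul a),
    dirDeriv_const_smul _ (h.differentiableAt_N hu), h.dirDeriv_N_of_shape_eq_smul hu (hA v),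
    smul_neg, smul_smul, ← sq, ha, one_smul, add_neg_cancel]

lemma continuousOn_trace_shape_cube : ContinuousOn
    (fun u => LinearMap.trace ℝ (Euc m) (shape X N u * shape X N u * shape X N u)) U := by
  have htrace : ∀ u, LinearMap.trace ℝ (Euc m) (shape X N u * shape X N u * shape X N u)
      = ∑ i, ∑ j, ∑ k, shapeOperator X u (N u) i k * shapeOperator X u (N u) k j *
        shapeOperator X u (N u) j i := by
    intro u
    have hcube : shape X N u * shape X N u * shape X N u = Matrix.toLpLin 2 2
        (shapeOperator X u (N u) * shapeOperator X u (N u) * shapeOperator X u (N u)) := by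
      rw [Matrix.toLpLin_mul_same, Matrix.toLpLin_mul_same]
      rfl
    rw [hcube, Matrix.toLpLin_eq_toLin, Matrix.trace_toLin_eq]
    simp only [Matrix.trace, Matrix.diag_apply, Matrix.mul_apply, Finset.sum_mul]
  have hentry : ∀ i j, ContinuousOn (fun u => shapeOperator X u (N u) i j) U := by
    intro i j u hu
    have hsmooth : SmoothAt (fun u => -⟪dualFrame X i u, pd j N u⟫_ℝ) u :=
      ((h.smoothAt_dualFrame hu i).inner ℝ ((h.smoothAt_N u hu).dirDeriv _)).neg
    exact hsmooth.continuousAt.continuousWithinAt.congr (fun x hx => h.shapeOperator_apply hx i j)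
      (h.shapeOperator_apply hu i j)
  simp only [htrace]
  exact continuousOn_finsetSum _ fun i _ => continuousOn_finsetSum _ fun j _ =>
    continuousOn_finsetSum _ fun k _ => ((hentry i k).mul (hentry k j)).mul (hentry j i)

/-- The sum of the two principal curvatures depends continuously on the point, being a rational
function of the traces of the powers of the shape operator, and it takes only finitely many values,
one pair for each multiplicity. -/
lemma exists_sum_principalCurvatures_eq (hU : IsPreconnected U) {f : ℝ} (hf₀ : f ^ 2 ≠ m ^ 2)
    (hf : ∀ u ∈ U, meanCurv X N u = f)
    (htrace : ∀ u ∈ U, LinearMap.trace ℝ (Euc m) (shape X N u * shape X N u) = m)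
    (hs : ∀ u ∈ U, (principalCurvatures X u (N u)).encard ≤ 2) :
    ∃ s : ℝ, ∀ u ∈ U, ∃ a b, HasExactlyTwoEigenvalues (shape X N u) a b ∧ a + b = s := by
  have hdisc : (m : ℝ) ^ 2 - f ^ 2 ≠ 0 := sub_ne_zero.2 hf₀.symm
  let sum : Euc m → ℝ := fun u => (m * LinearMap.trace ℝ (Euc m)
    (shape X N u * shape X N u * shape X N u) - f * m) / (m ^ 2 - f ^ 2)
  have hcont : ContinuousOn (fun u => m * sum u - 2 * f) U :=
    (((((h.continuousOn_trace_shape_cube.const_mul _).sub continuousOn_const).div_const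
      _).const_mul _).sub continuousOn_const)
  let q : ℕ → ℝ := fun k => (m - 2 * k) ^ 2 * ((m ^ 2 - f ^ 2) / (k * (m - k)))
  have hpair : ∀ u ∈ U, ∃ a b, HasExactlyTwoEigenvalues (shape X N u) a b ∧ a + b = sum u ∧
      ∃ k < m, (m * sum u - 2 * f) ^ 2 = q k := by
    intro u hu
    obtain ⟨a, b, hab⟩ := h.hasExactlyTwoEigenvalues_of_meanCurv_sq_ne hu (hf u hu ▸ hf₀)
      (htrace u hu) (hs u hu)
    obtain ⟨k, hkm, hk⟩ := hab.exists_sq_sum_sub_eq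
    have hsum := hab.quadratic.add_mul_eq
    rw [htrace u hu, h.trace_shape hu, hf u hu, finrank_euclideanSpace_fin, ← sq] at hsum hk
    rw [finrank_euclideanSpace_fin] at hkm
    have hab_sum : a + b = sum u := eq_div_of_mul_eq hdisc hsum
    exact ⟨a, b, hab, hab_sum, k, hkm, hab_sum ▸ hk⟩
  let values : Set ℝ := ⋃ k ∈ Set.Iio m, {√(q k), -√(q k)}
  have hvalues : values.Finite := (Set.finite_Iio m).biUnion fun k _ => Set.toFinite _
  have hmaps : Set.MapsTo (fun u => m * sum u - 2 * f) U values := by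
    intro u hu
    obtain ⟨-, -, -, -, k, hkm, hk⟩ := hpair u hu
    refine Set.mem_biUnion hkm ((abs_eq (Real.sqrt_nonneg _)).1 ?_)
    rw [← hk, Real.sqrt_sq_eq_abs]
  rcases U.eq_empty_or_nonempty with rfl | ⟨u₀, hu₀⟩
  · exact ⟨0, by simp⟩
  refine ⟨sum u₀, fun u hu => ?_⟩
  obtain ⟨a, b, hab, hsum, k, hkm, -⟩ := hpair u hu
  have hm : (m : ℝ) ≠ 0 := Nat.cast_ne_zero.2 (by omega)
  have hconst := hU.constant_of_mapsTo hvalues.isDiscrete hcont hmaps hu hu₀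
  exact ⟨a, b, hab, hsum.trans (mul_left_cancel₀ hm (sub_left_injective hconst))⟩

lemma exists_const_principalCurvatures (hU : IsPreconnected U) {f : ℝ} (hf₀ : f ^ 2 ≠ m ^ 2)
    (hf : ∀ u ∈ U, meanCurv X N u = f)
    (htrace : ∀ u ∈ U, LinearMap.trace ℝ (Euc m) (shape X N u * shape X N u) = m)
    (hs : ∀ u ∈ U, (principalCurvatures X u (N u)).encard ≤ 2) :
    ∃ a b : ℝ, ∀ u ∈ U, HasExactlyTwoEigenvalues (shape X N u) a b := by
  obtain ⟨s, hsum⟩ := h.exists_sum_principalCurvatures_eq hU hf₀ hf htrace hs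
  rcases U.eq_empty_or_nonempty with rfl | ⟨u₀, hu₀⟩
  · exact ⟨0, 0, by simp⟩
  have hprod : ∀ u ∈ U, ∀ a b, HasExactlyTwoEigenvalues (shape X N u) a b → a + b = s →
      m * (a * b) = s * f - m := by
    rintro u hu a b hab rfl
    have hsq := hab.quadratic.trace_sq
    rw [htrace u hu, h.trace_shape hu, hf u hu, finrank_euclideanSpace_fin] at hsq
    linarith
  obtain ⟨a, b, hab, hab_sum⟩ := hsum u₀ hu₀
  have hm : (m : ℝ) ≠ 0 := by
    obtain ⟨k, hkm, -⟩ := hab.exists_sq_sum_sub_eq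
    rw [finrank_euclideanSpace_fin] at hkm
    exact Nat.cast_ne_zero.2 (by omega)
  refine ⟨a, b, fun u hu => ?_⟩
  obtain ⟨a', b', hab', hab_sum'⟩ := hsum u hu
  have hquad : SatisfiesQuadratic (shape X N u) a b := by
    have heq_sum : a' + b' = a + b := hab_sum'.trans hab_sum.symm
    have heq_prod : a' * b' = a * b := mul_left_cancel₀ hm
      ((hprod u hu a' b' hab' hab_sum').trans (hprod u₀ hu₀ a b hab hab_sum).symm)
    intro v
    rw [hab'.quadratic, heq_sum, heq_prod]
  exact ⟨hab.ne, hquad, hab'.not_scalar a, hab'.not_scalar b⟩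

end Patch

end ConstantMeanCurvature

/-! ### Constant principal curvatures -/

section ConstantPrincipalCurvatures

variable {m : ℕ} {F : Type*} [NormedAddCommGroup F] [InnerProductSpace ℝ F]

/-- The Codazzi tensor of a patch: minus the covariant derivative of the second fundamental form
`(v, w) ↦ -⟪dirDeriv v N u, dirDeriv w X u⟫` in the direction `a`, written with derivatives in the
ambient space so that no connection on the patch is needed. -/
def codazziForm (X N : Euc m → F) (u a v w : Euc m) : ℝ :=
  ⟪dirDeriv a (dirDeriv v N) u, dirDeriv w X u⟫_ℝ
    - ⟪dirDeriv a (dirDeriv v X) u, dirDeriv w N u⟫_ℝ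

lemma codazziForm_add_left (X N : Euc m → F) (u a a' v w : Euc m) :
    codazziForm X N u (a + a') v w = codazziForm X N u a v w + codazziForm X N u a' v w := by
  simp only [codazziForm, dirDeriv_add_dir, inner_add_left]
  ring

lemma codazziForm_add_right (X N : Euc m → F) (u a v w w' : Euc m) :
    codazziForm X N u a v (w + w') = codazziForm X N u a v w + codazziForm X N u a v w' := by
  simp only [codazziForm, dirDeriv_add_dir, inner_add_right]
  ring

/-- The focal map of the principal curvature `a`, up to a constant factor: its derivative vanishes
on the eigenspace of `a`. -/
def focalMap (X N : Euc m → F) (a : ℝ) (u : Euc m) : F := N u + a • X u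

namespace Patch

variable {X N : Euc m → F} {U : Set (Euc m)} (h : Patch X N U) {u : Euc m} (hu : u ∈ U)
include h hu

lemma inner_DX_eq_zero_of_shape_eq_smul {a b : ℝ} (hab : a ≠ b) {y z : Euc m}
    (hy : shape X N u y = a • y) (hz : shape X N u z = b • z) :
    ⟪dirDeriv y X u, dirDeriv z X u⟫_ℝ = 0 := by
  have hsymm := h.inner_shape_comm hu y z
  rw [hy, hz, dirDeriv_smul_dir, dirDeriv_smul_dir, inner_smul_left, inner_smul_right,
    conj_trivial] at hsymm
  have hzero : (a - b) * ⟪dirDeriv y X u, dirDeriv z X u⟫_ℝ = 0 := by linarith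
  exact (mul_eq_zero.1 hzero).resolve_left (sub_ne_zero.2 hab)

/-- The hypotheses put the tangential parts of `y` and `z` in different eigenspaces. -/
lemma inner_eq_of_inner_DX_eq_zero {a b : ℝ} (hA : HasExactlyTwoEigenvalues (shape X N u) a b)
    {y z : F} (hy : ∀ v, shape X N u v = a • v → ⟪y, dirDeriv v X u⟫_ℝ = 0)
    (hz : ∀ v, shape X N u v = b • v → ⟪z, dirDeriv v X u⟫_ℝ = 0) :
    ⟪y, z⟫_ℝ = ⟪N u, y⟫_ℝ * ⟪N u, z⟫_ℝ + ⟪X u, y⟫_ℝ * ⟪X u, z⟫_ℝ := by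
  obtain ⟨p, s, t, rfl⟩ := h.exists_decomp hu y
  obtain ⟨p₁, p₂, rfl, hp₁, hp₂⟩ := hA.quadratic.exists_eq_add hA.ne p
  have horth := h.inner_DX_eq_zero_of_shape_eq_smul hu hA.ne hp₁ hp₂
  have hp₁_zero : dirDeriv p₁ X u = 0 := by
    have hyp₁ := hy p₁ hp₁
    simp only [dirDeriv_add_dir, inner_add_left, inner_smul_left, h.inner_N_DX hu,
      h.inner_X_DX hu, real_inner_comm (dirDeriv p₁ X u) (dirDeriv p₂ X u), horth, mul_zero,
      add_zero] at hyp₁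
    exact inner_self_eq_zero.1 hyp₁
  have hzp₂ := hz p₂ hp₂
  rw [real_inner_comm] at hzp₂
  simp only [dirDeriv_add_dir, hp₁_zero, zero_add, inner_add_left, inner_add_right,
    inner_smul_left, inner_smul_right, conj_trivial, h.inner_N_DX hu, h.inner_X_DX hu, hzp₂,
    h.inner_N_N u hu, h.inner_X_X u hu, h.inner_X_N u hu, real_inner_comm (X u) (N u)]
  ring

lemma codazziForm_comm_left (a v w : Euc m) :
    codazziForm X N u a v w = codazziForm X N u v a w := by
  rw [codazziForm, codazziForm, dirDeriv_comm (h.smoothAt_X u hu),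
    dirDeriv_comm (h.smoothAt_N u hu)]

lemma codazziForm_comm_right (a v w : Euc m) :
    codazziForm X N u a v w = codazziForm X N u a w v :=
  h.codazzi hu a v w

lemma codazziForm_add_mid (a v v' w : Euc m) :
    codazziForm X N u a (v + v') w = codazziForm X N u a v w + codazziForm X N u a v' w := by
  simp only [h.codazziForm_comm_left hu a, codazziForm_add_left]

lemma dirDeriv_focalMap (a : ℝ) (v : Euc m) :
    dirDeriv v (focalMap X N a) u = dirDeriv v N u + a • dirDeriv v X u :=
  (dirDeriv_add (h.differentiableAt_N hu) ((h.differentiableAt_X hu).fun_const_smul a) v).trans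
    (by rw [dirDeriv_const_smul a (h.differentiableAt_X hu)])

lemma smoothAt_focalMap (a : ℝ) : SmoothAt (focalMap X N a) u :=
  (h.smoothAt_N u hu).add (contDiffAt_const.smul (h.smoothAt_X u hu))

lemma dirDeriv_dirDeriv_focalMap (a : ℝ) (v w : Euc m) :
    dirDeriv v (dirDeriv w (focalMap X N a)) u
      = dirDeriv v (dirDeriv w N) u + a • dirDeriv v (dirDeriv w X) u := by
  rw [dirDeriv_congr h.isOpen hu (fun x hx => h.dirDeriv_focalMap hx a w),
    dirDeriv_add (h.differentiableAt_DN hu w) ((h.differentiableAt_DX hu w).fun_const_smul a),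
    dirDeriv_const_smul a (h.differentiableAt_DX hu w)]

lemma inner_N_dirDeriv_dirDeriv_focalMap (a : ℝ) (v w : Euc m) :
    ⟪N u, dirDeriv v (dirDeriv w (focalMap X N a)) u⟫_ℝ
      = -⟪dirDeriv v N u, dirDeriv w (focalMap X N a) u⟫_ℝ := by
  rw [h.dirDeriv_dirDeriv_focalMap hu, h.dirDeriv_focalMap hu, inner_add_right, inner_add_right,
    inner_smul_right, inner_smul_right, h.inner_N_DDN hu, h.inner_N_DDX hu]
  ring

lemma inner_X_dirDeriv_dirDeriv_focalMap (a : ℝ) (v w : Euc m) :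
    ⟪X u, dirDeriv v (dirDeriv w (focalMap X N a)) u⟫_ℝ
      = -⟪dirDeriv v X u, dirDeriv w (focalMap X N a) u⟫_ℝ := by
  rw [h.dirDeriv_dirDeriv_focalMap hu, h.dirDeriv_focalMap hu, inner_add_right, inner_add_right,
    inner_smul_right, inner_smul_right, h.inner_X_DDN hu, h.inner_X_DDX hu]
  ring

lemma dirDeriv_focalMap_of_shape_eq_smul {a b : ℝ} {v : Euc m} (hv : shape X N u v = b • v) :
    dirDeriv v (focalMap X N a) u = (a - b) • dirDeriv v X u := by
  rw [h.dirDeriv_focalMap hu, h.dirDeriv_N_of_shape_eq_smul hu hv]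
  module

section

variable {a b : ℝ} (hA : ∀ u ∈ U, HasExactlyTwoEigenvalues (shape X N u) a b)
include hA

lemma codazziForm_eq_zero_of_shape_eq_smul {v w : Euc m} (hv : shape X N u v = a • v)
    (hw : shape X N u w = a • w) (d : Euc m) : codazziForm X N u d v w = 0 := by
  refine (h.inner_DDN_sub_of_mem_eigenspace hu (differentiableAt_const a)
    (differentiableAt_const b) (fun x hx => (hA x hx).quadratic) (hA u hu).ne hv hw d).trans ?_
  rw [dirDeriv_const, zero_mul, neg_zero]

/-- Among three eigenvectors two belong to the same eigenvalue. -/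
lemma codazziForm_eq_zero (d v w : Euc m) : codazziForm X N u d v w = 0 := by
  have hpair₂₃ : ∀ {c d v w}, c = a ∨ c = b → shape X N u v = c • v → shape X N u w = c • w →
      codazziForm X N u d v w = 0 := by
    rintro c d v w (rfl | rfl) hv hw
    · exact h.codazziForm_eq_zero_of_shape_eq_smul hu hA hv hw d
    · exact h.codazziForm_eq_zero_of_shape_eq_smul hu (fun x hx => (hA x hx).symm) hv hw d
  have hpair₁₃ : ∀ {c d v w}, c = a ∨ c = b → shape X N u d = c • d → shape X N u w = c • w →
      codazziForm X N u d v w = 0 := fun hc hd hw =>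
    (h.codazziForm_comm_left hu _ _ _).trans (hpair₂₃ hc hd hw)
  have hpair₁₂ : ∀ {c d v w}, c = a ∨ c = b → shape X N u d = c • d → shape X N u v = c • v →
      codazziForm X N u d v w = 0 := fun hc hd hv =>
    (h.codazziForm_comm_right hu _ _ _).trans (hpair₁₃ hc hd hv)
  have ha : a = a ∨ a = b := .inl rfl
  have hb : b = a ∨ b = b := .inr rfl
  obtain ⟨d₁, d₂, rfl, hd₁, hd₂⟩ := (hA u hu).quadratic.exists_eq_add (hA u hu).ne d
  obtain ⟨v₁, v₂, rfl, hv₁, hv₂⟩ := (hA u hu).quadratic.exists_eq_add (hA u hu).ne v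
  obtain ⟨w₁, w₂, rfl, hw₁, hw₂⟩ := (hA u hu).quadratic.exists_eq_add (hA u hu).ne w
  simp only [codazziForm_add_left, h.codazziForm_add_mid hu, codazziForm_add_right,
    hpair₂₃ ha hv₁ hw₁, hpair₂₃ hb hv₂ hw₂, hpair₁₃ ha hd₁ hw₁, hpair₁₃ hb hd₂ hw₂,
    hpair₁₂ ha hd₁ hv₁, hpair₁₂ hb hd₂ hv₂, add_zero]

lemma inner_dirDeriv_dirDeriv_focalMap_DX {w : Euc m} (hw : shape X N u w = a • w) (d v : Euc m) :
    ⟪dirDeriv d (dirDeriv v (focalMap X N a)) u, dirDeriv w X u⟫_ℝ = 0 := by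
  have hcodazzi := h.codazziForm_eq_zero hu hA d v w
  rw [codazziForm, h.dirDeriv_N_of_shape_eq_smul hu hw, inner_neg_right,
    inner_smul_right] at hcodazzi
  rw [h.dirDeriv_dirDeriv_focalMap hu, inner_add_left, inner_smul_left, conj_trivial]
  linarith

lemma inner_dirDeriv_dirDeriv_focalMap_dirDeriv_focalMap (d v w : Euc m) :
    ⟪dirDeriv d (dirDeriv v (focalMap X N a)) u, dirDeriv w (focalMap X N b) u⟫_ℝ = 0 := by
  obtain ⟨w₁, w₂, rfl, hw₁, hw₂⟩ := (hA u hu).quadratic.exists_eq_add (hA u hu).ne w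
  rw [dirDeriv_add_dir, h.dirDeriv_focalMap_of_shape_eq_smul hu hw₁,
    h.dirDeriv_focalMap_of_shape_eq_smul hu hw₂, sub_self, zero_smul, add_zero, inner_smul_right,
    h.inner_dirDeriv_dirDeriv_focalMap_DX hu hA hw₁, mul_zero]

/-- Differentiate `inner_dirDeriv_dirDeriv_focalMap_dirDeriv_focalMap` and use the symmetry of the
third derivatives of the first focal map. -/
lemma inner_dirDeriv_dirDeriv_focalMap_swap (d e v w : Euc m) :
    ⟪dirDeriv e (dirDeriv v (focalMap X N a)) u, dirDeriv d (dirDeriv w (focalMap X N b)) u⟫_ℝ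
      = ⟪dirDeriv d (dirDeriv v (focalMap X N a)) u,
          dirDeriv e (dirDeriv w (focalMap X N b)) u⟫_ℝ := by
  have hY := (h.smoothAt_focalMap hu a).dirDeriv v
  have hZ := ((h.smoothAt_focalMap hu b).dirDeriv w).differentiableAt
  have hderiv : ∀ d e, ⟪dirDeriv d (dirDeriv e (dirDeriv v (focalMap X N a))) u,
        dirDeriv w (focalMap X N b) u⟫_ℝ
      + ⟪dirDeriv e (dirDeriv v (focalMap X N a)) u,
        dirDeriv d (dirDeriv w (focalMap X N b)) u⟫_ℝ = 0 := fun d e => by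
    rw [← dirDeriv_inner (hY.dirDeriv e).differentiableAt hZ]
    exact dirDeriv_eq_zero_of_const h.isOpen hu
      (fun x hx => h.inner_dirDeriv_dirDeriv_focalMap_dirDeriv_focalMap hx hA e v w) d
  have hde := hderiv d e
  rw [dirDeriv_comm hY] at hde
  exact add_left_cancel (hde.trans (hderiv e d).symm)

lemma inner_dirDeriv_dirDeriv_focalMap (d e v w : Euc m) :
    ⟪dirDeriv d (dirDeriv v (focalMap X N a)) u, dirDeriv e (dirDeriv w (focalMap X N b)) u⟫_ℝ
      = ⟪dirDeriv d N u, dirDeriv v (focalMap X N a) u⟫_ℝ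
          * ⟪dirDeriv e N u, dirDeriv w (focalMap X N b) u⟫_ℝ
        + ⟪dirDeriv d X u, dirDeriv v (focalMap X N a) u⟫_ℝ
          * ⟪dirDeriv e X u, dirDeriv w (focalMap X N b) u⟫_ℝ := by
  rw [h.inner_eq_of_inner_DX_eq_zero hu (hA u hu)
    (fun y hy => h.inner_dirDeriv_dirDeriv_focalMap_DX hu hA hy d v)
    (fun z hz => h.inner_dirDeriv_dirDeriv_focalMap_DX hu (fun x hx => (hA x hx).symm) hz e w)]
  simp only [h.inner_N_dirDeriv_dirDeriv_focalMap hu, h.inner_X_dirDeriv_dirDeriv_focalMap hu]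
  ring

/-- For constant principal curvatures `a ≠ b` the Gauss equation says that the sectional curvature
`1 + a * b` of a plane spanned by eigenvectors of `a` and `b` vanishes. -/
lemma principalCurvatures_mul_eq_neg_one : a * b = -1 := by
  obtain ⟨z, hz₀, hz⟩ := (hA u hu).exists_eigenvector
  obtain ⟨y, hy₀, hy⟩ := (hA u hu).symm.exists_eigenvector
  have hnorm : ∀ {v : Euc m}, v ≠ 0 → ⟪dirDeriv v X u, dirDeriv v X u⟫_ℝ ≠ 0 := fun hv hzero =>
    hv (h.DX_injective hu ((inner_self_eq_zero.1 hzero).trans (dirDeriv_zero_dir X u).symm))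
  have horth := h.inner_DX_eq_zero_of_shape_eq_smul hu (hA u hu).ne hz hy
  have hgauss := h.inner_dirDeriv_dirDeriv_focalMap_swap hu hA z y y z
  rw [h.inner_dirDeriv_dirDeriv_focalMap hu hA, h.inner_dirDeriv_dirDeriv_focalMap hu hA] at hgauss
  simp only [h.dirDeriv_focalMap_of_shape_eq_smul hu hz,
    h.dirDeriv_focalMap_of_shape_eq_smul hu hy, h.dirDeriv_N_of_shape_eq_smul hu hz,
    h.dirDeriv_N_of_shape_eq_smul hu hy, inner_neg_left, inner_smul_left, inner_smul_right,
    conj_trivial, horth, mul_zero, neg_zero] at hgauss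
  have hproduct : (a * b + 1) * ((a - b) ^ 2 * ⟪dirDeriv y X u, dirDeriv y X u⟫_ℝ
      * ⟪dirDeriv z X u, dirDeriv z X u⟫_ℝ) = 0 := by
    linear_combination -hgauss
  have hfactor := (mul_eq_zero.1 hproduct).resolve_right (mul_ne_zero (mul_ne_zero
    (pow_ne_zero 2 (sub_ne_zero.2 (hA u hu).ne)) (hnorm hy₀)) (hnorm hz₀))
  linarith

lemma shape_shape_of_trace_sq_eq (hf : meanCurv X N u ≠ 0)
    (htrace : LinearMap.trace ℝ (Euc m) (shape X N u * shape X N u) = m) (v : Euc m) :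
    shape X N u (shape X N u v) = v := by
  have hprod := h.principalCurvatures_mul_eq_neg_one hu hA
  have hsq := (hA u hu).quadratic.trace_sq
  rw [htrace, hprod, h.trace_shape hu, finrank_euclideanSpace_fin] at hsq
  have hsum : a + b = 0 :=
    (mul_eq_zero.1 (by linarith : (a + b) * meanCurv X N u = 0)).resolve_right hf
  rw [(hA u hu).quadratic, hprod, hsum]
  module

end

end Patch

end ConstantPrincipalCurvatures

/-! ### The exchange of the position and the normal vector -/

section Exchange

variable {m : ℕ} {F : Type*} [NormedAddCommGroup F] [InnerProductSpace ℝ F]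

/-- The endomorphism of the ambient space which exchanges `X u` and `N u`, and maps `dirDeriv v X u`
to `dirDeriv v N u`. When the shape operator is a parallel involution it is an involution which
does not depend on `u`, and its eigenspaces contain the two factors of the Clifford torus. -/
def exchange (X N : Euc m → F) (u : Euc m) : F →ₗ[ℝ] F :=
  (innerₗ F (X u)).smulRight (N u) + (innerₗ F (N u)).smulRight (X u)
    + ∑ i, (innerₗ F (dualFrame X i u)).smulRight (pd i N u)

lemma exchange_apply (X N : Euc m → F) (u : Euc m) (y : F) : exchange X N u y
    = ⟪X u, y⟫_ℝ • N u + ⟪N u, y⟫_ℝ • X u + ∑ i, ⟪dualFrame X i u, y⟫_ℝ • pd i N u := by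
  simp [exchange, LinearMap.sum_apply]

namespace Patch

variable {X N : Euc m → F} {U : Set (Euc m)} (h : Patch X N U) {u : Euc m} (hu : u ∈ U)
include h hu

lemma exchange_X : exchange X N u (X u) = N u := by
  rw [exchange_apply, h.inner_X_X u hu, real_inner_comm, h.inner_X_N u hu]
  simp [h.inner_dualFrame_X hu]

lemma exchange_N : exchange X N u (N u) = X u := by
  rw [exchange_apply, h.inner_N_N u hu, h.inner_X_N u hu]
  simp [h.inner_dualFrame_N hu]

lemma exchange_DX (v : Euc m) : exchange X N u (dirDeriv v X u) = dirDeriv v N u := by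
  rw [exchange_apply, h.inner_X_DX hu, h.inner_N_DX hu, dirDeriv_eq_sum_pd N]
  simp [h.inner_dualFrame_DX hu]

lemma inner_exchange_comm (y z : F) : ⟪exchange X N u y, z⟫_ℝ = ⟪y, exchange X N u z⟫_ℝ := by
  obtain ⟨p, s, t, rfl⟩ := h.exists_decomp hu y
  obtain ⟨p', s', t', rfl⟩ := h.exists_decomp hu z
  simp only [map_add, map_smul, h.exchange_X hu, h.exchange_N hu, h.exchange_DX hu, inner_add_left,
    inner_add_right, inner_smul_left, inner_smul_right, conj_trivial, h.inner_X_DX hu,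
    h.inner_N_DX hu, h.inner_X_N u hu, h.inner_X_X u hu, h.inner_N_N u hu,
    real_inner_comm (X u) (N u), h.inner_X_DN hu, h.inner_N_DN hu, real_inner_comm (X u),
    real_inner_comm (N u)]
  rw [h.inner_DN_DX_comm hu p p', real_inner_comm (dirDeriv p X u) (dirDeriv p' N u)]

lemma trace_exchange : LinearMap.trace ℝ F (exchange X N u) = -meanCurv X N u := by
  have := h.finiteDimensional
  simp only [exchange, map_add, map_sum, LinearMap.trace_smulRight, innerₗ_apply_apply,
    real_inner_comm (X u) (N u), h.inner_X_N u hu, zero_add, meanCurv, neg_neg]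

lemma smoothAt_exchange (y : F) : SmoothAt (fun x => exchange X N x y) u := by
  have hX := h.smoothAt_X u hu
  have hN := h.smoothAt_N u hu
  simp only [exchange_apply]
  exact (((hX.inner ℝ contDiffAt_const).smul hN).add
    ((hN.inner ℝ contDiffAt_const).smul hX)).add (ContDiffAt.sum fun i _ =>
      ((h.smoothAt_dualFrame hu i).inner ℝ contDiffAt_const).smul (hN.dirDeriv _))

/-- Differentiate `⟪W x, y⟫ = ⟪V x, exchange X N x y⟫`. -/
lemma inner_dirDeriv_exchange_eq_zero {V W : Euc m → F} (hV : DifferentiableAt ℝ V u)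
    (hW : DifferentiableAt ℝ W u) (hVW : ∀ x ∈ U, exchange X N x (V x) = W x) {v : Euc m}
    (hDVW : exchange X N u (dirDeriv v V u) = dirDeriv v W u) (y : F) :
    ⟪V u, dirDeriv v (fun x => exchange X N x y) u⟫_ℝ = 0 := by
  have hderiv := dirDeriv_congr h.isOpen hu (V := fun x => ⟪W x, y⟫_ℝ)
    (W := fun x => ⟪V x, exchange X N x y⟫_ℝ)
    (fun x hx => by rw [← hVW x hx, h.inner_exchange_comm hx]) v
  rw [dirDeriv_inner hW (differentiableAt_const y),
    dirDeriv_inner hV (h.smoothAt_exchange hu y).differentiableAt, dirDeriv_const,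
    inner_zero_right, add_zero, ← hDVW, h.inner_exchange_comm hu] at hderiv
  linarith

section

variable (hA : ∀ v, shape X N u (shape X N u v) = v)
include hA

lemma exchange_DN (v : Euc m) : exchange X N u (dirDeriv v N u) = dirDeriv v X u := by
  rw [← neg_eq_iff_eq_neg.2 (h.DX_shape hu v), map_neg, h.exchange_DX hu, ← h.DX_shape hu, hA]

lemma exchange_exchange (y : F) : exchange X N u (exchange X N u y) = y := by
  obtain ⟨p, s, t, rfl⟩ := h.exists_decomp hu y
  simp only [map_add, map_smul, h.exchange_X hu, h.exchange_N hu, h.exchange_DX hu,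
    h.exchange_DN hu hA]

variable (hT : ∀ d v w, codazziForm X N u d v w = 0)
include hT

lemma exchange_DDX (v w : Euc m) :
    exchange X N u (dirDeriv v (dirDeriv w X) u) = dirDeriv v (dirDeriv w N) u := by
  refine h.ext_inner hu ?_ ?_ fun d => ?_
  · have hquad : SatisfiesQuadratic (shape X N u) 1 (-1) := by simpa [SatisfiesQuadratic] using hA
    rw [← h.inner_exchange_comm hu, h.exchange_N hu, h.inner_X_DDX hu, h.inner_N_DDN hu,
      h.inner_DN_DN hu hquad]
    ring
  · rw [← h.inner_exchange_comm hu, h.exchange_X hu, h.inner_N_DDX hu, h.inner_X_DDN hu,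
      h.inner_DN_DX_comm hu, real_inner_comm]
  · rw [← h.inner_exchange_comm hu, h.exchange_DX hu, real_inner_comm,
      real_inner_comm _ (dirDeriv d X u)]
    exact (sub_eq_zero.1 (hT v w d)).symm

lemma dirDeriv_exchange (y : F) (v : Euc m) : dirDeriv v (fun x => exchange X N x y) u = 0 := by
  refine h.ext_inner hu ?_ ?_ fun w => ?_ <;> rw [inner_zero_right]
  · exact h.inner_dirDeriv_exchange_eq_zero hu (h.differentiableAt_N hu) (h.differentiableAt_X hu)
      (fun x hx => h.exchange_N hx) (h.exchange_DN hu hA v) y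
  · exact h.inner_dirDeriv_exchange_eq_zero hu (h.differentiableAt_X hu) (h.differentiableAt_N hu)
      (fun x hx => h.exchange_X hx) (h.exchange_DX hu v) y
  · exact h.inner_dirDeriv_exchange_eq_zero hu (h.differentiableAt_DX hu w)
      (h.differentiableAt_DN hu w) (fun x hx => h.exchange_DX hx w) (h.exchange_DDX hu hA hT v w) y

end

end Patch

end Exchange

/-! ### Local unit normals -/

section Normals

variable {m : ℕ} {F : Type*} [NormedAddCommGroup F] [InnerProductSpace ℝ F] {X : Euc m → F}

/-- The projection of the fixed vector `n` to the line of the sphere at `X u` normal to the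
hypersurface: the components along `X u` and along the tangent space are removed. It is used to
extend a normal vector at one point to a smooth normal field nearby. -/
def normalProjection (X : Euc m → F) (n : F) (u : Euc m) : F :=
  n - ⟪X u, n⟫_ℝ • X u - ∑ i, ⟪pd i X u, n⟫_ℝ • dualFrame X i u

lemma smoothAt_normalProjection {u : Euc m} (hX : SmoothAt X u)
    (hinj : Function.Injective (fderiv ℝ X u)) (n : F) : SmoothAt (normalProjection X n) u :=
  (contDiffAt_const.sub ((hX.inner ℝ contDiffAt_const).smul hX)).sub
    (ContDiffAt.sum fun i _ => ((hX.dirDeriv _).inner ℝ contDiffAt_const).smul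
      (smoothAt_dualFrame_of_injective hX hinj i))

lemma inner_X_normalProjection {u : Euc m} (hX : ⟪X u, X u⟫_ℝ = 1)
    (hDX : ∀ v, ⟪X u, dirDeriv v X u⟫_ℝ = 0) (n : F) : ⟪X u, normalProjection X n u⟫_ℝ = 0 := by
  have hdual : ∀ i, ⟪X u, dualFrame X i u⟫_ℝ = 0 := fun i => by
    simp only [dualFrame, inner_sum, inner_smul_right, pd_eq_dirDeriv, hDX, mul_zero,
      Finset.sum_const_zero]
  simp only [normalProjection, inner_sub_right, inner_sum, inner_smul_right, hdual, hX, mul_one,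
    mul_zero, sub_self, Finset.sum_const_zero]

lemma inner_DX_normalProjection {u : Euc m} (hinj : Function.Injective (fderiv ℝ X u))
    (hDX : ∀ v, ⟪X u, dirDeriv v X u⟫_ℝ = 0) (n : F) (v : Euc m) :
    ⟪dirDeriv v X u, normalProjection X n u⟫_ℝ = 0 := by
  have hpd : ∀ j, ⟪pd j X u, normalProjection X n u⟫_ℝ = 0 := fun j => by
    have hdual : ∀ i, ⟪pd j X u, dualFrame X i u⟫_ℝ = if i = j then 1 else 0 := fun i => by
      rw [real_inner_comm, inner_dualFrame hinj]
    have hX : ⟪pd j X u, X u⟫_ℝ = 0 := by rw [real_inner_comm]; exact hDX _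
    simp [normalProjection, inner_sub_right, inner_sum, inner_smul_right, hdual, hX]
  simp [dirDeriv_eq_sum_pd, sum_inner, inner_smul_left, hpd]

lemma normalProjection_eq_self {n : F} {u : Euc m} (hX : ⟪X u, n⟫_ℝ = 0)
    (hDX : ∀ v, ⟪dirDeriv v X u, n⟫_ℝ = 0) : normalProjection X n u = n := by
  simp [normalProjection, hX, pd_eq_dirDeriv, hDX]

lemma exists_ne_zero_normal (hF : Module.finrank ℝ F = m + 2) (X : Euc m → F) (u : Euc m) :
    ∃ n : F, n ≠ 0 ∧ ⟪X u, n⟫_ℝ = 0 ∧ ∀ v, ⟪dirDeriv v X u, n⟫_ℝ = 0 := by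
  have : FiniteDimensional ℝ F := Module.finite_of_finrank_pos (by omega)
  let W : Submodule ℝ F := LinearMap.range
    ((fderiv ℝ X u : Euc m →ₗ[ℝ] F).coprod (LinearMap.toSpanSingleton ℝ F (X u)))
  have hW : Wᗮ ≠ ⊥ := by
    have hlt : Module.finrank ℝ W < Module.finrank ℝ F :=
      (LinearMap.finrank_range_le _).trans_lt (by simp [hF])
    intro hbot
    rw [Submodule.orthogonal_eq_bot_iff.1 hbot, finrank_top] at hlt
    exact lt_irrefl _ hlt
  obtain ⟨n, hn, hn₀⟩ := Submodule.exists_mem_ne_zero_of_ne_bot hW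
  exact ⟨n, hn₀, hn _ ⟨(0, 1), by simp⟩, fun v => hn _ ⟨(v, 0), by simp [dirDeriv]⟩⟩

lemma patch_normalize (hF : Module.finrank ℝ F = m + 2) {P : Euc m → F} {U : Set (Euc m)}
    (hU : IsOpen U) (hX : ∀ u ∈ U, SmoothAt X u)
    (hinj : ∀ u ∈ U, Function.Injective (fderiv ℝ X u)) (hXX : ∀ u ∈ U, ⟪X u, X u⟫_ℝ = 1)
    (hP : ∀ u ∈ U, SmoothAt P u) (hP₀ : ∀ u ∈ U, P u ≠ 0) (hXP : ∀ u ∈ U, ⟪X u, P u⟫_ℝ = 0)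
    (hDXP : ∀ u ∈ U, ∀ v, ⟪dirDeriv v X u, P u⟫_ℝ = 0) :
    Patch X (fun u => ‖P u‖⁻¹ • P u) U where
  finrank_eq := hF
  isOpen := hU
  smoothAt_X := hX
  smoothAt_N u hu :=
    (((hP u hu).norm ℝ (hP₀ u hu)).inv (norm_ne_zero_iff.2 (hP₀ u hu))).smul (hP u hu)
  fderiv_injective := hinj
  inner_X_X := hXX
  inner_N_N u hu := by
    have := norm_ne_zero_iff.2 (hP₀ u hu)
    rw [inner_smul_left, inner_smul_right, real_inner_self_eq_norm_sq, conj_trivial]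
    field_simp
  inner_X_N u hu := by rw [inner_smul_right, hXP u hu, mul_zero]
  inner_DX_N u hu v := by rw [inner_smul_right, hDXP u hu, mul_zero]

lemma exists_patch (hF : Module.finrank ℝ F = m + 2) {U : Set (Euc m)}
    (hU : IsOpen U) (hX : ∀ u ∈ U, SmoothAt X u)
    (hinj : ∀ u ∈ U, Function.Injective (fderiv ℝ X u)) (hXX : ∀ u ∈ U, ⟪X u, X u⟫_ℝ = 1)
    {u₀ : Euc m} (hu₀ : u₀ ∈ U) :
    ∃ N : Euc m → F, ∃ r > 0, Metric.ball u₀ r ⊆ U ∧ Patch X N (Metric.ball u₀ r) := by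
  have hXD : ∀ u ∈ U, ∀ v, ⟪X u, dirDeriv v X u⟫_ℝ = 0 := by
    intro u hu v
    have hd := dirDeriv_eq_zero_of_const hU hu hXX v
    rw [dirDeriv_inner (hX u hu).differentiableAt (hX u hu).differentiableAt,
      real_inner_comm] at hd
    linarith
  obtain ⟨n, hn₀, hXn, hDXn⟩ := exists_ne_zero_normal hF X u₀
  have hsmooth : ∀ u ∈ U, SmoothAt (normalProjection X n) u := fun u hu =>
    smoothAt_normalProjection (hX u hu) (hinj u hu) n
  have hnear : ∀ᶠ u in nhds u₀, u ∈ U ∧ normalProjection X n u ≠ 0 :=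
    (hU.eventually_mem hu₀).and ((hsmooth u₀ hu₀).continuousAt.eventually_ne
      (by rwa [normalProjection_eq_self hXn hDXn]))
  obtain ⟨r, hr, hball⟩ := Metric.eventually_nhds_iff_ball.1 hnear
  have hball' : Metric.ball u₀ r ⊆ U := fun u hu => (hball u hu).1
  exact ⟨_, r, hr, hball', patch_normalize hF Metric.isOpen_ball (fun u hu => hX u (hball' hu))
    (fun u hu => hinj u (hball' hu)) (fun u hu => hXX u (hball' hu))
    (fun u hu => hsmooth u (hball' hu)) (fun u hu => (hball u hu).2)
    (fun u hu => inner_X_normalProjection (hXX u (hball' hu)) (hXD u (hball' hu)) n)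
    fun u hu => inner_DX_normalProjection (hinj u (hball' hu)) (hXD u (hball' hu)) n⟩

end Normals

/-! ### Changes of coordinates -/

section ChangeOfCoordinates

variable {m : ℕ} {F : Type*} [NormedAddCommGroup F] [InnerProductSpace ℝ F]

lemma dirDeriv_comp {E E' G : Type*} [NormedAddCommGroup E] [NormedSpace ℝ E]
    [NormedAddCommGroup E'] [NormedSpace ℝ E'] [NormedAddCommGroup G] [NormedSpace ℝ G]
    {V : E' → G} {ψ : E → E'} {u : E} (hV : DifferentiableAt ℝ V (ψ u))
    (hψ : DifferentiableAt ℝ ψ u) (v : E) :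
    dirDeriv v (V ∘ ψ) u = dirDeriv (fderiv ℝ ψ u v) V (ψ u) :=
  congrArg (fun L => L v) (fderiv_comp u hV hψ)

namespace Patch

variable {X N X' N' : Euc m → F} {U V : Set (Euc m)} {ψ : Euc m → Euc m} (h : Patch X N U)
include h

lemma of_eqOn_smul {a : Euc m → ℝ} (ha : ∀ u ∈ U, SmoothAt a u) (ha' : ∀ u ∈ U, a u ^ 2 = 1)
    (hN' : ∀ u ∈ U, N' u = a u • N u) : Patch X N' U where
  finrank_eq := h.finrank_eq
  isOpen := h.isOpen
  smoothAt_X := h.smoothAt_X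
  smoothAt_N u hu := ((ha u hu).smul (h.smoothAt_N u hu)).congr_of_eventuallyEq
    (Filter.eventually_of_mem (h.isOpen.mem_nhds hu) hN')
  fderiv_injective := h.fderiv_injective
  inner_X_X := h.inner_X_X
  inner_N_N u hu := by
    rw [hN' u hu, real_inner_smul_left, real_inner_smul_right, h.inner_N_N u hu, mul_one, ← sq,
      ha' u hu]
  inner_X_N u hu := by rw [hN' u hu, inner_smul_right, h.inner_X_N u hu, mul_zero]
  inner_DX_N u hu v := by rw [hN' u hu, inner_smul_right, h.inner_DX_N u hu, mul_zero]

lemma dirDeriv_of_eqOn_comp (hV : IsOpen V) (hψ : ∀ u ∈ V, SmoothAt ψ u) (hψU : Set.MapsTo ψ V U)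
    (hX' : Set.EqOn X' (X ∘ ψ) V) {u : Euc m} (hu : u ∈ V) (v : Euc m) :
    dirDeriv v X' u = dirDeriv (fderiv ℝ ψ u v) X (ψ u) := by
  rw [dirDeriv_congr hV hu hX',
    dirDeriv_comp (h.differentiableAt_X (hψU hu)) (hψ u hu).differentiableAt]

lemma of_eqOn_comp (hV : IsOpen V) (hψ : ∀ u ∈ V, SmoothAt ψ u) (hψU : Set.MapsTo ψ V U)
    (hX' : Set.EqOn X' (X ∘ ψ) V) (hinj : ∀ u ∈ V, Function.Injective (fderiv ℝ X' u)) :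
    Patch X' (N ∘ ψ) V where
  finrank_eq := h.finrank_eq
  isOpen := hV
  smoothAt_X u hu := ((h.smoothAt_X _ (hψU hu)).comp u (hψ u hu)).congr_of_eventuallyEq
    (Filter.eventually_of_mem (hV.mem_nhds hu) hX')
  smoothAt_N u hu := (h.smoothAt_N _ (hψU hu)).comp u (hψ u hu)
  fderiv_injective := hinj
  inner_X_X u hu := by rw [hX' hu]; exact h.inner_X_X _ (hψU hu)
  inner_N_N u hu := h.inner_N_N _ (hψU hu)
  inner_X_N u hu := by rw [hX' hu]; exact h.inner_X_N _ (hψU hu)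
  inner_DX_N u hu v := by
    rw [h.dirDeriv_of_eqOn_comp hV hψ hψU hX' hu]
    exact h.inner_DX_N _ (hψU hu) _

/-- The shape operators in the two coordinate systems are conjugate by the derivative of `ψ`. -/
lemma tension_of_eqOn_comp (h' : Patch X' (N ∘ ψ) V) (hψ : ∀ u ∈ V, SmoothAt ψ u)
    (hψU : Set.MapsTo ψ V U) (hX' : Set.EqOn X' (X ∘ ψ) V) {u : Euc m} (hu : u ∈ V) :
    tension (inducedMetric X') X' u = tension (inducedMetric X) X (ψ u) := by
  have hDX := h.dirDeriv_of_eqOn_comp h'.isOpen hψ hψU hX' hu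
  have hinj : Function.Injective (fderiv ℝ ψ u) := fun a b hab =>
    h'.DX_injective hu (by rw [hDX a, hDX b, hab])
  let L : Euc m ≃ₗ[ℝ] Euc m :=
    LinearEquiv.ofInjectiveEndo (fderiv ℝ ψ u : Euc m →ₗ[ℝ] Euc m) hinj
  have hL : ∀ v, L v = fderiv ℝ ψ u v := fun v => rfl
  have hconj : shape X N (ψ u) = L.conj (shape X' (N ∘ ψ) u) := by
    ext1 y
    obtain ⟨v, rfl⟩ := L.surjective y
    rw [LinearEquiv.conj_apply_apply, L.symm_apply_apply]
    apply h.DX_injective (hψU hu)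
    rw [h.DX_shape (hψU hu), hL, hL, ← hDX, h'.DX_shape hu,
      dirDeriv_comp (h.differentiableAt_N (hψU hu)) (hψ u hu).differentiableAt]
  rw [h'.tension_eq hu, h.tension_eq (hψU hu), ← h'.trace_shape hu, ← h.trace_shape (hψU hu),
    hconj, LinearMap.trace_conj', Function.comp_apply]

end Patch

end ChangeOfCoordinates

/-! ### The tension field as a map on the manifold -/

section TensionField

variable {m : ℕ} {M : Type*} [TopologicalSpace M] [ChartedSpace (Euc m) M]
  {φ : M → UnitSphere (m + 1)} {e e' : OpenPartialHomeomorph M (Euc m)}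

lemma mfderiv_symm_injective_of_mem_maximalAtlas (he : e ∈ IsManifold.maximalAtlas (𝓡 m) ∞ M)
    {u : Euc m} (hu : u ∈ e.target) : Function.Injective (mfderiv (𝓡 m) (𝓡 m) e.symm u) := by
  have he' : e.MDifferentiable (𝓡 m) (𝓡 m) :=
    ⟨(contMDiffOn_of_mem_maximalAtlas he).mdifferentiableOn (by simp),
      (contMDiffOn_symm_of_mem_maximalAtlas he).mdifferentiableOn (by simp)⟩
  exact he'.symm.mfderiv_injective hu

lemma smoothAt_localRep (hφ : IsImmersedHypersurface φ)
    (he : e ∈ IsManifold.maximalAtlas (𝓡 m) ∞ M) {u : Euc m} (hu : u ∈ e.target) :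
    SmoothAt (localRep φ e) u := by
  have : Fact (Module.finrank ℝ (Euc (m + 1 + 1)) = m + 1 + 1) := ⟨finrank_euclideanSpace_fin⟩
  have hcoord : ContMDiffAt (𝓡 m) 𝓘(ℝ, Euc (m + 2)) ∞ (localRep φ e) u :=
    (contMDiff_coe_sphere (E := Euc (m + 1 + 1)) (n := m + 1)).contMDiffAt.comp u
      (hφ.1.contMDiffAt.comp u (contMDiffAt_symm_of_mem_maximalAtlas he hu))
  exact hcoord.contDiffAt

lemma fderiv_localRep_injective (hφ : IsImmersedHypersurface φ)
    (he : e ∈ IsManifold.maximalAtlas (𝓡 m) ∞ M) {u : Euc m} (hu : u ∈ e.target) :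
    Function.Injective (fderiv ℝ (localRep φ e) u) := by
  have : Fact (Module.finrank ℝ (Euc (m + 1 + 1)) = m + 1 + 1) := ⟨finrank_euclideanSpace_fin⟩
  have hsymm : MDifferentiableAt (𝓡 m) (𝓡 m) e.symm u :=
    (contMDiffAt_symm_of_mem_maximalAtlas he hu).mdifferentiableAt (by simp)
  have hφe : MDifferentiableAt (𝓡 m) (𝓡 (m + 1)) φ (e.symm u) :=
    hφ.1.mdifferentiableAt (by simp)
  have hcoe : MDifferentiableAt (𝓡 (m + 1)) 𝓘(ℝ, Euc (m + 1 + 1))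
      ((↑) : UnitSphere (m + 1) → Euc (m + 1 + 1)) (φ (e.symm u)) :=
    (contMDiff_coe_sphere (m := ∞)).mdifferentiableAt (by simp)
  have hchain := mfderiv_comp u hcoe (hφe.comp u hsymm)
  rw [mfderiv_comp u hφe hsymm] at hchain
  have hinj : Function.Injective (mfderiv (𝓡 m) 𝓘(ℝ, Euc (m + 1 + 1))
      (((↑) : UnitSphere (m + 1) → Euc (m + 1 + 1)) ∘ φ ∘ e.symm) u) := by
    rw [hchain]
    exact (injective_mvfderiv_subtypeVal_sphere (φ (e.symm u))).comp
      ((hφ.2 _).comp (mfderiv_symm_injective_of_mem_maximalAtlas he hu))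
  rw [mfderiv_eq_fderiv] at hinj
  exact hinj

omit [ChartedSpace (Euc m) M] in
lemma inner_localRep_self (u : Euc m) : ⟪localRep φ e u, localRep φ e u⟫_ℝ = 1 := by
  rw [real_inner_self_eq_norm_sq, localRep, norm_eq_of_mem_sphere, one_pow]

lemma exists_patch_localRep (hφ : IsImmersedHypersurface φ)
    (he : e ∈ IsManifold.maximalAtlas (𝓡 m) ∞ M) {u : Euc m} (hu : u ∈ e.target) :
    ∃ N : Euc m → Euc (m + 2), ∃ r > 0, Metric.ball u r ⊆ e.target ∧
      Patch (localRep φ e) N (Metric.ball u r) :=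
  exists_patch (by simp) e.open_target (fun _ hx => smoothAt_localRep hφ he hx)
    (fun _ hx => fderiv_localRep_injective hφ he hx) (fun x _ => inner_localRep_self x) hu

lemma tension_localRep_eq (hφ : IsImmersedHypersurface φ)
    (he : e ∈ IsManifold.maximalAtlas (𝓡 m) ∞ M) (he' : e' ∈ IsManifold.maximalAtlas (𝓡 m) ∞ M)
    {p : M} (hp : p ∈ e.source) (hp' : p ∈ e'.source) :
    tension (inducedMetric (localRep φ e)) (localRep φ e) (e p)
      = tension (inducedMetric (localRep φ e')) (localRep φ e') (e' p) := by
  obtain ⟨N, r, hr, -, hpatch'⟩ := exists_patch_localRep hφ he' (e'.map_source hp')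
  let V : Set (Euc m) := e.target ∩ e.symm ⁻¹' (e'.source ∩ e' ⁻¹' Metric.ball (e' p) r)
  have hV : IsOpen V :=
    e.isOpen_inter_preimage_symm (e'.isOpen_inter_preimage Metric.isOpen_ball)
  have hpV : e p ∈ V := by
    refine ⟨e.map_source hp, ?_⟩
    simp only [Set.mem_preimage, e.left_inv hp]
    exact ⟨hp', Metric.mem_ball_self hr⟩
  have hsmooth : ∀ u ∈ V, SmoothAt (e' ∘ e.symm) u := fun u hu =>
    ((contMDiffAt_of_mem_maximalAtlas he' hu.2.1).comp u
      (contMDiffAt_symm_of_mem_maximalAtlas he hu.1)).contDiffAt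
  have hmaps : Set.MapsTo (e' ∘ e.symm) V (Metric.ball (e' p) r) := fun u hu => hu.2.2
  have heq : Set.EqOn (localRep φ e) (localRep φ e' ∘ e' ∘ e.symm) V := fun u hu => by
    simp only [localRep, Function.comp_apply, e'.left_inv hu.2.1]
  have hpatch := hpatch'.of_eqOn_comp hV hsmooth hmaps heq fun u hu =>
    fderiv_localRep_injective hφ he hu.1
  rw [hpatch'.tension_of_eqOn_comp hpatch hsmooth hmaps heq hpV, Function.comp_apply,
    e.left_inv hp]

/-- The tension field of `φ`, as a map on `M` with values in the ambient space. It is computed in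
the preferred chart at each point, which by `tension_localRep_eq` is immaterial. -/
def tensionField (φ : M → UnitSphere (m + 1)) (p : M) : Euc (m + 2) :=
  tension (inducedMetric (localRep φ (chartAt (Euc m) p))) (localRep φ (chartAt (Euc m) p))
    (chartAt (Euc m) p p)

variable [IsManifold (𝓡 m) ∞ M]

lemma tension_localRep (hφ : IsImmersedHypersurface φ)
    (he : e ∈ IsManifold.maximalAtlas (𝓡 m) ∞ M) {u : Euc m} (hu : u ∈ e.target) :
    tension (inducedMetric (localRep φ e)) (localRep φ e) u = tensionField φ (e.symm u) := by
  have hcharts := tension_localRep_eq hφ he (IsManifold.chart_mem_maximalAtlas (e.symm u))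
    (e.map_target hu) (mem_chart_source (Euc m) (e.symm u))
  rwa [e.right_inv hu] at hcharts

lemma exists_tensionField_ne_zero (hφ : IsImmersedHypersurface φ) (hb : ¬IsHarmonic φ) :
    ∃ p, tensionField φ p ≠ 0 := by
  by_contra! hall
  exact hb fun e he u hu => by rw [tension_localRep hφ he hu, hall]

end TensionField

/-! ### Coordinate patches around the points of a biharmonic hypersurface -/

section CoordinatePatches

variable {m : ℕ} {M : Type*} [TopologicalSpace M] [ChartedSpace (Euc m) M]
  {φ : M → UnitSphere (m + 1)} {e : OpenPartialHomeomorph M (Euc m)}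
  {N : Euc m → Euc (m + 2)} {B : Set (Euc m)}

lemma exists_patch_around [IsManifold (𝓡 m) ∞ M] (hφ : IsImmersedHypersurface φ) {W : Set M}
    (hW : IsOpen W) {p : M} (hp : p ∈ W) :
    ∃ e ∈ IsManifold.maximalAtlas (𝓡 m) ∞ M, ∃ N B, p ∈ e.source ∧ e p ∈ B ∧ IsPreconnected B ∧
      B ⊆ e.target ∧ Set.MapsTo e.symm B W ∧ Patch (localRep φ e) N B := by
  have he := IsManifold.chart_mem_maximalAtlas (I := 𝓡 m) (n := ∞) p
  set e := chartAt (Euc m) p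
  have hpe : p ∈ e.source := mem_chart_source (Euc m) p
  obtain ⟨N, r, hr, hball, hN⟩ := exists_patch_localRep hφ he (e.map_source hpe)
  obtain ⟨s, hs, hsub⟩ := Metric.isOpen_iff.1 (e.isOpen_inter_preimage_symm hW) (e p)
    ⟨e.map_source hpe, by simpa [e.left_inv hpe] using hp⟩
  have hBr : Metric.ball (e p) (min r s) ⊆ Metric.ball (e p) r :=
    Metric.ball_subset_ball (min_le_left _ _)
  exact ⟨e, he, N, Metric.ball (e p) (min r s), hpe, Metric.mem_ball_self (lt_min hr hs),
    (convex_ball _ _).isPreconnected, hBr.trans hball,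
    fun u hu => (hsub (Metric.ball_subset_ball (min_le_right _ _) hu)).2,
    hN.mono Metric.isOpen_ball hBr⟩

omit [ChartedSpace (Euc m) M] in
lemma forall_mem_isOpen_of_forall_mem_patch (hB : IsOpen B) {p : M} (hp : p ∈ e.source)
    (hpB : e p ∈ B) {P : M → Prop} (hP : ∀ u ∈ B, P (e.symm u)) :
    ∃ O : Set M, IsOpen O ∧ p ∈ O ∧ ∀ q ∈ O, P q :=
  ⟨e.source ∩ e ⁻¹' B, e.isOpen_inter_preimage hB, ⟨hp, hpB⟩, fun q hq => by
    simpa only [e.left_inv hq.1] using hP (e q) hq.2⟩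

variable [IsManifold (𝓡 m) ∞ M]

lemma Patch.tensionField_eq (h : Patch (localRep φ e) N B) (hφ : IsImmersedHypersurface φ)
    (he : e ∈ IsManifold.maximalAtlas (𝓡 m) ∞ M) (hB : B ⊆ e.target) {u : Euc m} (hu : u ∈ B) :
    tensionField φ (e.symm u) = meanCurv (localRep φ e) N u • N u := by
  rw [← tension_localRep hφ he (hB hu), h.tension_eq hu]

lemma Patch.norm_tensionField (h : Patch (localRep φ e) N B) (hφ : IsImmersedHypersurface φ)
    (he : e ∈ IsManifold.maximalAtlas (𝓡 m) ∞ M) (hB : B ⊆ e.target) {u : Euc m} (hu : u ∈ B) :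
    ‖tensionField φ (e.symm u)‖ = |meanCurv (localRep φ e) N u| := by
  rw [h.tensionField_eq hφ he hB hu, norm_smul, (h.isUnitNormal hu).1, mul_one, Real.norm_eq_abs]

lemma isLocallyConstant_norm_tensionField (hφ : IsImmersedHypersurface φ) (hb : IsBiharmonic φ)
    (hc : AtMostTwoPrincipalCurvatures φ) : IsLocallyConstant fun p => ‖tensionField φ p‖ := by
  rw [IsLocallyConstant.iff_exists_open]
  intro p
  obtain ⟨e, he, N, B, hpe, hpB, hconn, hB, -, h⟩ :=
    exists_patch_around hφ isOpen_univ (Set.mem_univ p)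
  have hmean : ∀ u ∈ B, meanCurv (localRep φ e) N u = meanCurv (localRep φ e) N (e p) :=
    fun u hu => eq_of_dirDeriv_eq_zero h.isOpen hconn
      (fun x hx => (h.smoothAt_meanCurv hx).differentiableAt)
      (fun x hx => h.dirDeriv_meanCurv_eq_zero (fun y hy => hb e he y (hB hy))
        (fun y hy => hc e he y (hB hy) _ (h.isUnitNormal hy)) hx) hu hpB
  refine forall_mem_isOpen_of_forall_mem_patch h.isOpen hpe hpB fun u hu => ?_
  have hnorm := h.norm_tensionField hφ he hB hpB
  rw [e.left_inv hpe] at hnorm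
  rw [h.norm_tensionField hφ he hB hu, hnorm, hmean u hu]

lemma exists_norm_tensionField_eq [ConnectedSpace M] (hφ : IsImmersedHypersurface φ)
    (hb : IsProperBiharmonic φ) (hc : AtMostTwoPrincipalCurvatures φ) :
    ∃ c > 0, ∀ p, ‖tensionField φ p‖ = c := by
  obtain ⟨p, hp⟩ := exists_tensionField_ne_zero hφ hb.2
  exact ⟨‖tensionField φ p‖, norm_pos_iff.2 hp, fun q =>
    (isLocallyConstant_norm_tensionField hφ hb.1 hc).apply_eq_of_preconnectedSpace q p⟩

end CoordinatePatches

/-! ### Hypersurfaces of constant mean curvature with a global unit normal -/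

section CMC

variable {m : ℕ} {M : Type*} [TopologicalSpace M]
  {φ : M → UnitSphere (m + 1)} {η : M → Euc (m + 2)} {c : ℝ}
  {e : OpenPartialHomeomorph M (Euc m)} {B : Set (Euc m)}

/-- `B` is a connected coordinate patch of `φ` on which `η` is a unit normal, the mean curvature
with respect to `η` is the constant `c`, the squared norm of the shape operator is `m`, and there
are at most two principal curvatures. -/
structure CMCPatch (φ : M → UnitSphere (m + 1)) (η : M → Euc (m + 2)) (c : ℝ)
    (e : OpenPartialHomeomorph M (Euc m)) (B : Set (Euc m)) : Prop where
  isPreconnected : IsPreconnected B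
  patch : Patch (localRep φ e) (η ∘ e.symm) B
  meanCurv_eq : ∀ u ∈ B, meanCurv (localRep φ e) (η ∘ e.symm) u = c
  trace_shape_sq : ∀ u ∈ B, LinearMap.trace ℝ (Euc m)
    (shape (localRep φ e) (η ∘ e.symm) u * shape (localRep φ e) (η ∘ e.symm) u) = m
  encard_le : ∀ u ∈ B, (principalCurvatures (localRep φ e) u (η (e.symm u))).encard ≤ 2

/-- `φ` is covered by arbitrarily small patches as in `CMCPatch`. This is all that the
classification needs to know about a proper biharmonic hypersurface. -/
def IsCMC (φ : M → UnitSphere (m + 1)) (η : M → Euc (m + 2)) (c : ℝ) : Prop :=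
  ∀ (p : M) (W : Set M), IsOpen W → p ∈ W →
    ∃ e B, p ∈ e.source ∧ e p ∈ B ∧ Set.MapsTo e.symm B W ∧ CMCPatch φ η c e B

/-- The normalized tension field is a unit normal, whichever local normal one starts from. -/
lemma Patch.normalized_tensionField [ChartedSpace (Euc m) M] [IsManifold (𝓡 m) ∞ M]
  {N : Euc m → Euc (m + 2)}
    (h : Patch (localRep φ e) N B) (hφ : IsImmersedHypersurface φ)
    (he : e ∈ IsManifold.maximalAtlas (𝓡 m) ∞ M) (hB : B ⊆ e.target) (hc₀ : c ≠ 0)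
    (hn : ∀ p, ‖tensionField φ p‖ = c) :
    Patch (localRep φ e) ((fun p => c⁻¹ • tensionField φ p) ∘ e.symm) B := by
  refine h.of_eqOn_smul (a := fun u => c⁻¹ * meanCurv (localRep φ e) N u)
    (fun u hu => contDiffAt_const.mul (h.smoothAt_meanCurv hu)) (fun u hu => ?_) fun u hu => ?_
  · have hmean : meanCurv (localRep φ e) N u ^ 2 = c ^ 2 := by
      rw [← sq_abs, ← h.norm_tensionField hφ he hB hu, hn]
    rw [mul_pow, hmean, ← mul_pow, inv_mul_cancel₀ hc₀, one_pow]
  · rw [Function.comp_apply, h.tensionField_eq hφ he hB hu, smul_smul]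

lemma meanCurv_normalized_tensionField [ChartedSpace (Euc m) M] [IsManifold (𝓡 m) ∞ M]
  (hφ : IsImmersedHypersurface φ)
    (he : e ∈ IsManifold.maximalAtlas (𝓡 m) ∞ M) (hB : B ⊆ e.target) (hc₀ : c ≠ 0)
    (h : Patch (localRep φ e) ((fun p => c⁻¹ • tensionField φ p) ∘ e.symm) B) {u : Euc m}
    (hu : u ∈ B) :
    meanCurv (localRep φ e) ((fun p => c⁻¹ • tensionField φ p) ∘ e.symm) u = c := by
  have htension := h.tensionField_eq hφ he hB hu
  have hN : ((fun p => c⁻¹ • tensionField φ p) ∘ e.symm) u ≠ 0 := fun hzero => by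
    have hunit := h.inner_N_N u hu
    rw [hzero, inner_zero_left] at hunit
    exact zero_ne_one hunit
  refine smul_left_injective ℝ hN ?_
  beta_reduce
  rw [← htension, Function.comp_apply, smul_inv_smul₀ hc₀]

lemma isCMC_of_biharmonic [ChartedSpace (Euc m) M] [IsManifold (𝓡 m) ∞ M]
  (hφ : IsImmersedHypersurface φ)
    (hb : IsBiharmonic φ) (hcurv : AtMostTwoPrincipalCurvatures φ) (hc₀ : c ≠ 0)
    (hn : ∀ p, ‖tensionField φ p‖ = c) : IsCMC φ (fun p => c⁻¹ • tensionField φ p) c := by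
  intro p W hW hp
  obtain ⟨e, he, N, B, hpe, hpB, hconn, hB, hBW, hN⟩ := exists_patch_around hφ hW hp
  have h := hN.normalized_tensionField hφ he hB hc₀ hn
  have hmean := fun u hu => meanCurv_normalized_tensionField hφ he hB hc₀ h (u := u) hu
  exact ⟨e, B, hpe, hpB, hBW, hconn, h, hmean,
    fun u hu => h.trace_shape_sq_of_meanCurv_const hc₀ hmean hu (hb e he u (hB hu)),
    fun u hu => hcurv e he u (hB hu) _ (h.isUnitNormal hu)⟩

namespace IsCMC

variable (h : IsCMC φ η c)
include h

lemma inner_normal_self (p : M) : ⟪η p, η p⟫_ℝ = 1 := by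
  obtain ⟨e, B, hpe, hpB, -, hB⟩ := h p _ isOpen_univ (Set.mem_univ p)
  simpa only [Function.comp_apply, e.left_inv hpe] using hB.patch.inner_N_N _ hpB

lemma inner_position_normal (p : M) : ⟪(φ p : Euc (m + 2)), η p⟫_ℝ = 0 := by
  obtain ⟨e, B, hpe, hpB, -, hB⟩ := h p _ isOpen_univ (Set.mem_univ p)
  simpa only [localRep, Function.comp_apply, e.left_inv hpe] using hB.patch.inner_X_N _ hpB

end IsCMC

end CMC

/-! ### Open parts -/

section OpenPart

/-- The point of the normal plane at `u` with coordinates `(a, b)` in the frame `X u`, `N u`, as a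
function of `(u, a, b)`. It parametrizes a neighborhood of the hypersurface, which is given by
`a = 1`, `b = 0`. -/
def normalPlaneMap {m : ℕ} {F : Type*} [NormedAddCommGroup F] [NormedSpace ℝ F] (X N : Euc m → F)
    (x : Euc m × ℝ × ℝ) : F :=
  x.2.1 • X x.1 + x.2.2 • N x.1

namespace Patch

variable {m : ℕ} {F : Type*} [NormedAddCommGroup F] [InnerProductSpace ℝ F] {X N : Euc m → F}
  {U : Set (Euc m)} (h : Patch X N U) {u : Euc m} (hu : u ∈ U)
include h hu

lemma smoothAt_normalPlaneMap (a b : ℝ) : SmoothAt (normalPlaneMap X N) (u, a, b) := by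
  have hX : SmoothAt (fun x : Euc m × ℝ × ℝ => X x.1) (u, a, b) :=
    ContDiffAt.comp (g := X) (u, a, b) (h.smoothAt_X u hu) contDiffAt_fst
  have hN : SmoothAt (fun x : Euc m × ℝ × ℝ => N x.1) (u, a, b) :=
    ContDiffAt.comp (g := N) (u, a, b) (h.smoothAt_N u hu) contDiffAt_fst
  exact ((contDiffAt_fst.comp _ contDiffAt_snd).smul hX).add
    ((contDiffAt_snd.comp _ contDiffAt_snd).smul hN)

lemma fderiv_normalPlaneMap (v : Euc m) (s t : ℝ) :
    fderiv ℝ (normalPlaneMap X N) (u, 1, 0) (v, s, t) = dirDeriv v X u + t • N u + s • X u := by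
  have hX : HasFDerivAt (fun x : Euc m × ℝ × ℝ => X x.1) _ (u, 1, 0) :=
    HasFDerivAt.comp (g := X) (u, 1, 0) (h.differentiableAt_X hu).hasFDerivAt hasFDerivAt_fst
  have hN : HasFDerivAt (fun x : Euc m × ℝ × ℝ => N x.1) _ (u, 1, 0) :=
    HasFDerivAt.comp (g := N) (u, 1, 0) (h.differentiableAt_N hu).hasFDerivAt hasFDerivAt_fst
  have hab := hasFDerivAt_snd (𝕜 := ℝ) (p := (u, (1 : ℝ), (0 : ℝ)))
  have hderiv : HasFDerivAt (normalPlaneMap X N) _ (u, 1, 0) :=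
    (hab.fst.smul hX).add (hab.snd.smul hN)
  rw [hderiv.fderiv]
  simp only [dirDeriv, add_apply, smul_apply, ContinuousLinearMap.smulRight_apply,
    ContinuousLinearMap.comp_apply,
    ContinuousLinearMap.coe_fst', ContinuousLinearMap.coe_snd']
  module

lemma image_normalPlaneMap_mem_nhds {T : Set (Euc m × ℝ × ℝ)} (hT : T ∈ nhds (u, 1, 0)) :
    normalPlaneMap X N '' T ∈ nhds (X u) := by
  have := h.finiteDimensional
  have hsurj : (fderiv ℝ (normalPlaneMap X N) (u, 1, 0)).range = ⊤ :=
    LinearMap.range_eq_top.2 fun y => by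
      obtain ⟨v, s, t, hy⟩ := h.exists_decomp hu y
      exact ⟨(v, t, s), (h.fderiv_normalPlaneMap hu v t s).trans hy.symm⟩
  have hmap := ((h.smoothAt_normalPlaneMap hu 1 0).hasStrictFDerivAt
    (by simp)).map_nhds_eq_of_surj hsurj
  have hX : normalPlaneMap X N (u, 1, 0) = X u := by simp [normalPlaneMap]
  rw [← hX, ← hmap]
  exact Filter.image_mem_map hT

end Patch

variable {m : ℕ} {M : Type*} [TopologicalSpace M] {φ : M → UnitSphere (m + 1)}
  {η : M → Euc (m + 2)} {c : ℝ}

lemma IsCMC.exists_isOpen_inter_subset_image (h : IsCMC φ η c) {S : Set (Euc (m + 2))}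
    (hS : ∀ p, ∀ a b : ℝ, 0 < a + b → 0 < a - b →
      (a • (φ p : Euc (m + 2)) + b • η p ∈ S ↔ a = 1 ∧ b = 0))
    {W : Set M} (hW : IsOpen W) {p : M} (hp : p ∈ W) :
    ∃ O, IsOpen O ∧ (φ p : Euc (m + 2)) ∈ O ∧ O ∩ S ⊆ (fun p => (φ p : Euc (m + 2))) '' W := by
  obtain ⟨e, B, hpe, hpB, hBW, hB⟩ := h p W hW hp
  have hT : B ×ˢ {x : ℝ × ℝ | 0 < x.1 + x.2 ∧ 0 < x.1 - x.2} ∈ nhds (e p, (1 : ℝ), (0 : ℝ)) :=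
    (hB.patch.isOpen.prod ((isOpen_lt continuous_const (continuous_fst.add continuous_snd)).inter
      (isOpen_lt continuous_const (continuous_fst.sub continuous_snd)))).mem_nhds
      ⟨hpB, by norm_num, by norm_num⟩
  obtain ⟨O, hOT, hO, hpO⟩ := mem_nhds_iff.1 (hB.patch.image_normalPlaneMap_mem_nhds hpB hT)
  rw [localRep, e.left_inv hpe] at hpO
  refine ⟨O, hO, hpO, ?_⟩
  rintro _ ⟨hxO, hxS⟩
  obtain ⟨⟨u, a, b⟩, ⟨hu, hadd, hsub⟩, rfl⟩ := hOT hxO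
  obtain ⟨rfl, rfl⟩ := (hS (e.symm u) a b hadd hsub).1 hxS
  exact ⟨e.symm u, hBW hu, by simp [normalPlaneMap, localRep]⟩

/-- By the inverse function theorem every point near the hypersurface lies in one of the normal
planes, so it suffices that `S` meets those only in the hypersurface. -/
lemma IsCMC.isOpenPartOf (h : IsCMC φ η c) {S : Set (Euc (m + 2))}
    (hS : ∀ p, ∀ a b : ℝ, 0 < a + b → 0 < a - b →
      (a • (φ p : Euc (m + 2)) + b • η p ∈ S ↔ a = 1 ∧ b = 0)) : IsOpenPartOf φ S := by
  have hφS : ∀ p, (φ p : Euc (m + 2)) ∈ S := fun p => by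
    simpa using (hS p 1 0 (by norm_num) (by norm_num)).2
  refine ⟨hφS, fun W hW => ?_⟩
  choose! O hO hpO hsub using fun p (hp : p ∈ W) => h.exists_isOpen_inter_subset_image hS hW hp
  refine ⟨⋃ p ∈ W, O p, isOpen_biUnion hO, Set.Subset.antisymm ?_ ?_⟩
  · rintro _ ⟨p, hp, rfl⟩
    exact ⟨Set.mem_biUnion hp (hpO p hp), hφS p⟩
  · rintro x ⟨hx, hxS⟩
    obtain ⟨p, hp, hxp⟩ := Set.mem_iUnion₂.1 hx
    exact hsub p hp ⟨hxp, hxS⟩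

lemma IsCMC.norm_smul_add_smul_eq_one_iff (h : IsCMC φ η c) (p : M) (a b : ℝ) :
    ‖a • (φ p : Euc (m + 2)) + b • η p‖ = 1 ↔ a ^ 2 + b ^ 2 = 1 := by
  have hη : ‖η p‖ ^ 2 = 1 := by rw [← real_inner_self_eq_norm_sq, h.inner_normal_self]
  rw [← sq_eq_sq₀ (norm_nonneg _) zero_le_one, one_pow, norm_add_sq_real, norm_smul, norm_smul,
    inner_smul_left, inner_smul_right, h.inner_position_normal, norm_eq_of_mem_sphere, mul_pow,
    mul_pow, hη, Real.norm_eq_abs, Real.norm_eq_abs, sq_abs, sq_abs, one_pow, mul_one, mul_one,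
    mul_zero, mul_zero, mul_zero, add_zero]

/-- Both model hypersurfaces meet each normal plane in points of the unit circle which lie on the
axes; the inequalities single out one of the four. -/
lemma sq_add_sq_eq_one_and_mul_eq_zero_iff {a b : ℝ} (hadd : 0 < a + b) (hsub : 0 < a - b) :
    a ^ 2 + b ^ 2 = 1 ∧ a * b = 0 ↔ a = 1 ∧ b = 0 := by
  refine ⟨fun ⟨hsq, hab⟩ => ?_, by rintro ⟨rfl, rfl⟩; norm_num⟩
  obtain rfl : b = 0 := (mul_eq_zero.1 hab).resolve_left (by linarith)
  exact ⟨by nlinarith, rfl⟩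

end OpenPart

/-! ### The model hypersurfaces -/

section Models

lemma norm_eq_one_div_sqrt_two_iff {F : Type*} [NormedAddCommGroup F] [InnerProductSpace ℝ F]
    (y : F) : ‖y‖ = 1 / √2 ↔ ⟪y, y⟫_ℝ = 1 / 2 := by
  have hsq : (1 / √2) ^ 2 = (1 / 2 : ℝ) := by
    rw [div_pow, Real.sq_sqrt zero_le_two, one_pow]
  rw [real_inner_self_eq_norm_sq, ← hsq,
    pow_left_inj₀ (norm_nonneg y) (by positivity) two_ne_zero]

lemma mem_smallHypersphere_iff {n : ℕ} {v : Euc n} (hv : ‖v‖ = 1) {x : Euc n} :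
    x ∈ smallHypersphere v ↔ ‖x‖ = 1 ∧ ⟪v, x⟫_ℝ = 1 / √2 := by
  have hvv : ⟪v, v⟫_ℝ = 1 := by rw [real_inner_self_eq_norm_sq, hv, one_pow]
  have hsq : (1 / √2) * (1 / √2) = (1 / 2 : ℝ) := by
    rw [div_mul_div_comm, Real.mul_self_sqrt zero_le_two, one_mul]
  rw [← sq_eq_sq₀ (norm_nonneg x) zero_le_one, one_pow, ← real_inner_self_eq_norm_sq]
  constructor
  · rintro ⟨y, hvy, hy, rfl⟩
    rw [norm_eq_one_div_sqrt_two_iff] at hy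
    simp only [inner_add_left, inner_add_right, inner_smul_left, inner_smul_right, hvv, hvy, hy,
      real_inner_comm v y, conj_trivial]
    exact ⟨by linarith, by ring⟩
  · rintro ⟨hx, hvx⟩
    refine ⟨x - (1 / √2) • v, ?_, ?_, (sub_add_cancel _ _).symm⟩
    · rw [inner_sub_right, inner_smul_right, hvv, hvx, mul_one, sub_self]
    · rw [norm_eq_one_div_sqrt_two_iff]
      simp only [inner_sub_left, inner_sub_right, inner_smul_left, inner_smul_right, hvv, hx, hvx,
        real_inner_comm v x, conj_trivial]
      linarith

end Models

section Involution

variable {F : Type*} [NormedAddCommGroup F] [InnerProductSpace ℝ F] {R : F →ₗ[ℝ] F}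

lemma add_smul_apply_mem_eigenspace (hR : Function.Involutive R) {ε : ℝ} (hε : ε ^ 2 = 1) (y : F) :
    y + ε • R y ∈ Module.End.eigenspace R ε := by
  rw [Module.End.mem_eigenspace_iff, map_add, map_smul, hR y, smul_add, smul_smul, ← sq, hε,
    one_smul, add_comm]

lemma orthogonal_eigenspace_one (hR : Function.Involutive R) (hs : R.IsSymmetric) :
    (Module.End.eigenspace R 1)ᗮ = Module.End.eigenspace R (-1) := by
  ext y
  rw [Module.End.mem_eigenspace_iff, neg_one_smul]
  constructor
  · intro hy
    refine eq_neg_of_add_eq_zero_right (ext_inner_right ℝ fun z => ?_)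
    have horth := hy _ (add_smul_apply_mem_eigenspace hR (one_pow 2) z)
    rw [inner_zero_left, inner_add_left, hs, ← inner_add_right, real_inner_comm,
      ← horth, one_smul]
  · intro hy z hz
    have hsymm := hs z y
    rw [Module.End.mem_eigenspace_iff.1 hz, one_smul, hy, inner_neg_right] at hsymm
    linarith

lemma two_mul_finrank_eigenspace_one [FiniteDimensional ℝ F] (hR : Function.Involutive R) :
    2 * (Module.finrank ℝ (Module.End.eigenspace R 1) : ℝ)
      = Module.finrank ℝ F + LinearMap.trace ℝ F R := by
  have hproj : LinearMap.IsProj (Module.End.eigenspace R 1) ((1 / 2 : ℝ) • (LinearMap.id + R)) := by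
    refine ⟨fun y => Submodule.smul_mem _ _ ?_, fun y hy => ?_⟩
    · simpa only [one_smul] using! add_smul_apply_mem_eigenspace hR (one_pow 2) y
    · rw [LinearMap.smul_apply, LinearMap.add_apply, LinearMap.id_apply,
        Module.End.mem_eigenspace_iff.1 hy]
      module
  rw [← hproj.trace, map_smul, map_add, LinearMap.trace_id, smul_eq_mul]
  ring

lemma mem_cliffordTorus_eigenspace_iff {n : ℕ} {R : Euc n →ₗ[ℝ] Euc n}
    (hR : Function.Involutive R) (hs : R.IsSymmetric) {x : Euc n} :
    x ∈ cliffordTorus (Module.End.eigenspace R 1) ↔ ‖x‖ = 1 ∧ ⟪R x, x⟫_ℝ = 0 := by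
  rw [← sq_eq_sq₀ (norm_nonneg x) zero_le_one, one_pow, ← real_inner_self_eq_norm_sq]
  constructor
  · rintro ⟨y, hy, z, hz, hnorm_y, hnorm_z, rfl⟩
    have hyz : ⟪y, z⟫_ℝ = 0 := hz y hy
    rw [orthogonal_eigenspace_one hR hs] at hz
    rw [norm_eq_one_div_sqrt_two_iff] at hnorm_y hnorm_z
    rw [map_add, Module.End.mem_eigenspace_iff.1 hy, Module.End.mem_eigenspace_iff.1 hz, one_smul,
      neg_one_smul]
    simp only [inner_add_left, inner_add_right, inner_neg_left, hyz, real_inner_comm y z, hnorm_y,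
      hnorm_z]
    norm_num
  · rintro ⟨hx, hRx⟩
    have hRR : ⟪R x, R x⟫_ℝ = 1 := by rw [hs, hR x, hx]
    have hpart : ∀ ε : ℝ, ε ^ 2 = 1 → (1 / 2 : ℝ) • (x + ε • R x) ∈ Module.End.eigenspace R ε ∧
        ‖(1 / 2 : ℝ) • (x + ε • R x)‖ = 1 / √2 := fun ε hε => by
      refine ⟨Submodule.smul_mem _ _ (add_smul_apply_mem_eigenspace hR hε x), ?_⟩
      rw [norm_eq_one_div_sqrt_two_iff]
      simp only [inner_add_left, inner_add_right, inner_smul_left, inner_smul_right, hx, hRx, hRR,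
        real_inner_comm (R x) x, conj_trivial]
      linear_combination hε / 4
    have hpos := hpart 1 (one_pow 2)
    have hneg := hpart (-1) neg_one_sq
    rw [← orthogonal_eigenspace_one hR hs] at hneg
    exact ⟨_, hpos.1, _, hneg.1, hpos.2, hneg.2, by module⟩

lemma two_le_finrank_of_inner_eq_zero {V : Submodule ℝ F} [FiniteDimensional ℝ V] {y z : F}
    (hy : y ∈ V) (hz : z ∈ V) (hy₀ : y ≠ 0) (hz₀ : z ≠ 0) (hyz : ⟪y, z⟫_ℝ = 0) :
    2 ≤ Module.finrank ℝ V := by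
  have hindep : LinearIndependent ℝ ![(⟨y, hy⟩ : V), ⟨z, hz⟩] :=
    linearIndependent_of_ne_zero_of_inner_eq_zero (𝕜 := ℝ)
      (by simpa [Fin.forall_fin_two] using ⟨hy₀, hz₀⟩)
      (by simp [Pairwise, Fin.forall_fin_two, hyz, real_inner_comm y z])
  simpa using hindep.fintype_card_le_finrank

end Involution

/-! ### The small hypersphere -/

section SmallHypersphere

variable {m : ℕ} {M : Type*} [TopologicalSpace M] {φ : M → UnitSphere (m + 1)}
  {η : M → Euc (m + 2)} {c : ℝ}

/-- All principal curvatures are equal to `1`, so that `X + N` has zero derivative. -/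
lemma IsCMC.isLocallyConstant_position_add_normal (h : IsCMC φ η m) (hm : m ≠ 0) :
    IsLocallyConstant fun p => (φ p : Euc (m + 2)) + η p := by
  rw [IsLocallyConstant.iff_exists_open]
  intro p
  obtain ⟨e, B, hpe, hpB, -, hB⟩ := h p _ isOpen_univ (Set.mem_univ p)
  have hshape : ∀ u ∈ B, ∀ v, shape (localRep φ e) (η ∘ e.symm) u v = (1 : ℝ) • v := fun u hu v =>
    by
    rw [hB.patch.shape_eq_smul_of_meanCurv_sq_eq hm hu (by rw [hB.meanCurv_eq u hu])
      (hB.trace_shape_sq u hu) (hB.encard_le u hu), hB.meanCurv_eq u hu,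
      div_self (Nat.cast_ne_zero.2 hm)]
  refine forall_mem_isOpen_of_forall_mem_patch hB.patch.isOpen hpe hpB fun u hu => ?_
  have hconst := eq_of_dirDeriv_eq_zero hB.patch.isOpen hB.isPreconnected
    (V := fun x => localRep φ e x + (1 : ℝ) • (η ∘ e.symm) x)
    (fun x hx => (hB.patch.differentiableAt_X hx).add
      ((hB.patch.differentiableAt_N hx).fun_const_smul 1))
    (fun x hx => hB.patch.dirDeriv_add_smul_N_of_shape_eq_smul (one_pow 2) hx (hshape x hx)) hu hpB
  simpa only [localRep, Function.comp_apply, one_smul, e.left_inv hpe] using hconst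

variable [ConnectedSpace M]

theorem IsCMC.exists_isOpenPartOf_smallHypersphere (h : IsCMC φ η m) (hm : m ≠ 0) :
    ∃ v : Euc (m + 2), ‖v‖ = 1 ∧ IsOpenPartOf φ (smallHypersphere v) := by
  obtain ⟨p₀⟩ : Nonempty M := inferInstance
  set w : Euc (m + 2) := φ p₀ + η p₀ with hw
  have hsum : ∀ p, (φ p : Euc (m + 2)) + η p = w := fun p =>
    (h.isLocallyConstant_position_add_normal hm).apply_eq_of_preconnectedSpace p p₀
  have hsqrt : (1 / √2) ^ 2 = (1 / 2 : ℝ) := by rw [div_pow, Real.sq_sqrt zero_le_two, one_pow]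
  have hv : ‖(1 / √2) • w‖ = 1 := by
    rw [hw, smul_add, h.norm_smul_add_smul_eq_one_iff, hsqrt]
    norm_num
  have hinner : ∀ p, ∀ a b : ℝ,
      ⟪(1 / √2) • w, a • (φ p : Euc (m + 2)) + b • η p⟫_ℝ = 1 / √2 * (a + b) := fun p a b => by
    rw [← hsum p]
    simp only [inner_add_left, inner_add_right, inner_smul_left, inner_smul_right,
      h.inner_normal_self, h.inner_position_normal, real_inner_comm (φ p : Euc (m + 2)) (η p),
      real_inner_self_eq_norm_sq, norm_eq_of_mem_sphere, conj_trivial]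
    ring
  refine ⟨(1 / √2) • w, hv, h.isOpenPartOf fun p a b hadd hsub => ?_⟩
  rw [mem_smallHypersphere_iff hv, h.norm_smul_add_smul_eq_one_iff, hinner,
    mul_eq_left₀ (by positivity), ← sq_add_sq_eq_one_and_mul_eq_zero_iff hadd hsub]
  refine and_congr_right fun hsq => ⟨fun hab => ?_, fun hab => ?_⟩
  · nlinarith
  · nlinarith

end SmallHypersphere

/-! ### The Clifford torus -/

section CliffordTorus

lemma dirDeriv_clm_comp {E F G : Type*} [NormedAddCommGroup E] [NormedSpace ℝ E]
    [NormedAddCommGroup F] [NormedSpace ℝ F] [NormedAddCommGroup G] [NormedSpace ℝ G]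
    (L : F →L[ℝ] G) {V : E → F} {u : E} (hV : DifferentiableAt ℝ V u) (a : E) :
    dirDeriv a (fun x => L (V x)) u = L (dirDeriv a V u) :=
  congrArg (fun D => D a) (L.hasFDerivAt.comp u hV.hasFDerivAt).fderiv

namespace Patch

variable {m : ℕ} {F : Type*} [NormedAddCommGroup F] [InnerProductSpace ℝ F] {X N : Euc m → F}
  {U : Set (Euc m)} (h : Patch X N U) {u : Euc m} (hu : u ∈ U)
include h hu

lemma eq_exchange {R : F →ₗ[ℝ] F} (hR : Function.Involutive R) (hRX : ∀ x ∈ U, R (X x) = N x) :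
    R = exchange X N u := by
  have := h.finiteDimensional
  have hRDX : ∀ v, R (dirDeriv v X u) = dirDeriv v N u := fun v => by
    rw [← dirDeriv_congr h.isOpen hu hRX v]
    exact (dirDeriv_clm_comp R.toContinuousLinearMap (h.differentiableAt_X hu) v).symm
  refine LinearMap.ext fun y => ?_
  obtain ⟨v, s, t, rfl⟩ := h.exists_decomp hu y
  simp only [map_add, map_smul, hRDX, ← hRX u hu, hR (X u)]
  simp only [hRX u hu, h.exchange_X hu, h.exchange_N hu, h.exchange_DX hu]

/-- The sums `X + ε N` and `DX + ε DN` are orthogonal eigenvectors, and the latter is the image of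
`v - ε A v` under `DX`. -/
lemma two_le_finrank_eigenspace_exchange (hA : ∀ v, shape X N u (shape X N u v) = v)
    (hscalar : ∀ a : ℝ, ¬∀ v, shape X N u v = a • v) {ε : ℝ} (hε : ε ^ 2 = 1) :
    2 ≤ Module.finrank ℝ (Module.End.eigenspace (exchange X N u) ε) := by
  have := h.finiteDimensional
  obtain ⟨v, hv⟩ := not_forall.1 (hscalar ε)
  have hmem := add_smul_apply_mem_eigenspace (h.exchange_exchange hu hA) hε
  have hX := hmem (X u)
  have hDX := hmem (dirDeriv v X u)
  rw [h.exchange_X hu] at hX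
  rw [h.exchange_DX hu] at hDX
  refine two_le_finrank_of_inner_eq_zero hX hDX (fun hzero => ?_) (fun hzero => ?_) ?_
  · have hinner := congrArg (fun y => ⟪X u, y⟫_ℝ) hzero
    simp only [inner_add_right, inner_smul_right, h.inner_X_X u hu, h.inner_X_N u hu,
      inner_zero_right, mul_zero, add_zero] at hinner
    exact one_ne_zero hinner
  · refine hv (h.DX_injective hu ?_)
    rw [h.DX_shape hu, dirDeriv_smul_dir, eq_neg_of_add_eq_zero_left hzero, smul_neg, smul_smul,
      ← sq, hε, one_smul]
  · simp only [inner_add_left, inner_add_right, inner_smul_left, inner_smul_right,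
      h.inner_X_DX hu, h.inner_X_DN hu, h.inner_N_DX hu, h.inner_N_DN hu, mul_zero, add_zero]

end Patch

variable {m : ℕ} {M : Type*} [TopologicalSpace M] {φ : M → UnitSphere (m + 1)}
  {η : M → Euc (m + 2)} {c : ℝ}

namespace CMCPatch

variable {e : OpenPartialHomeomorph M (Euc m)} {B : Set (Euc m)} (h : CMCPatch φ η c e B)
  (hm : c ^ 2 ≠ m ^ 2)
include h hm

lemma exists_hasExactlyTwoEigenvalues : ∃ a b : ℝ, ∀ u ∈ B,
    HasExactlyTwoEigenvalues (shape (localRep φ e) (η ∘ e.symm) u) a b :=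
  h.patch.exists_const_principalCurvatures h.isPreconnected hm h.meanCurv_eq h.trace_shape_sq
    h.encard_le

variable (hc : c ≠ 0)
include hc

lemma shape_shape {u : Euc m} (hu : u ∈ B) (v : Euc m) :
    shape (localRep φ e) (η ∘ e.symm) u (shape (localRep φ e) (η ∘ e.symm) u v) = v := by
  obtain ⟨a, b, hA⟩ := h.exists_hasExactlyTwoEigenvalues hm
  exact h.patch.shape_shape_of_trace_sq_eq hu hA (by rwa [h.meanCurv_eq u hu])
    (h.trace_shape_sq u hu) v

lemma exchange_eq {u u' : Euc m} (hu : u ∈ B) (hu' : u' ∈ B) :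
    exchange (localRep φ e) (η ∘ e.symm) u = exchange (localRep φ e) (η ∘ e.symm) u' := by
  obtain ⟨a, b, hA⟩ := h.exists_hasExactlyTwoEigenvalues hm
  exact LinearMap.ext fun y => eq_of_dirDeriv_eq_zero h.patch.isOpen h.isPreconnected
    (V := fun x => exchange (localRep φ e) (η ∘ e.symm) x y)
    (fun x hx => (h.patch.smoothAt_exchange hx y).differentiableAt)
    (fun x hx => h.patch.dirDeriv_exchange hx (h.shape_shape hm hc hx)
      (h.patch.codazziForm_eq_zero hx hA) y) hu hu'

lemma involutive_exchange {u : Euc m} (hu : u ∈ B) :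
    Function.Involutive (exchange (localRep φ e) (η ∘ e.symm) u) :=
  h.patch.exchange_exchange hu (h.shape_shape hm hc hu)

lemma two_le_finrank_eigenspace_exchange {u : Euc m} (hu : u ∈ B) {ε : ℝ} (hε : ε ^ 2 = 1) :
    2 ≤ Module.finrank ℝ
      (Module.End.eigenspace (exchange (localRep φ e) (η ∘ e.symm) u) ε) := by
  obtain ⟨a, b, hA⟩ := h.exists_hasExactlyTwoEigenvalues hm
  exact h.patch.two_le_finrank_eigenspace_exchange hu (h.shape_shape hm hc hu)
    (hA u hu).not_scalar hε

end CMCPatch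

namespace IsCMC

variable (h : IsCMC φ η c) (hm : c ^ 2 ≠ m ^ 2) (hc : c ≠ 0)
include h hm hc

lemma exists_involutive_nhds (p : M) : ∃ R : Euc (m + 2) →ₗ[ℝ] Euc (m + 2),
    Function.Involutive R ∧ ∃ O : Set M, IsOpen O ∧ p ∈ O ∧ ∀ q ∈ O, R (φ q) = η q := by
  obtain ⟨e, B, hpe, hpB, -, hB⟩ := h p _ isOpen_univ (Set.mem_univ p)
  refine ⟨exchange (localRep φ e) (η ∘ e.symm) (e p), hB.involutive_exchange hm hc hpB,
    forall_mem_isOpen_of_forall_mem_patch hB.patch.isOpen hpe hpB fun u hu => ?_⟩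
  rw [hB.exchange_eq hm hc hpB hu]
  exact hB.patch.exchange_X hu

/-- The local involutions agree where they are both defined, by `Patch.eq_exchange`. -/
lemma exists_involutive [PreconnectedSpace M] [Nonempty M] :
    ∃ R : Euc (m + 2) →ₗ[ℝ] Euc (m + 2),
      Function.Involutive R ∧ ∀ p, R (φ p) = η p := by
  choose R hR O hO hpO hRφ using h.exists_involutive_nhds hm hc
  have hloc : IsLocallyConstant R := by
    refine (IsLocallyConstant.iff_exists_open R).2 fun p => ⟨O p, hO p, hpO p, fun q hq => ?_⟩
    obtain ⟨e, B, -, hqB, hBO, hB⟩ := h q (O p ∩ O q) ((hO p).inter (hO q)) ⟨hq, hpO q⟩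
    rw [hB.patch.eq_exchange hqB (hR q) fun u hu => hRφ q _ (hBO hu).2,
      hB.patch.eq_exchange hqB (hR p) fun u hu => hRφ p _ (hBO hu).1]
  obtain ⟨p₀⟩ : Nonempty M := inferInstance
  refine ⟨R p₀, hR p₀, fun p => ?_⟩
  rw [hloc.apply_eq_of_preconnectedSpace p₀ p]
  exact hRφ p p (hpO p)

theorem exists_isOpenPartOf_cliffordTorus [ConnectedSpace M] :
    ∃ m₁ m₂ : ℕ, 1 ≤ m₁ ∧ 1 ≤ m₂ ∧ m₁ + m₂ = m ∧ m₁ ≠ m₂ ∧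
      ∃ V : Submodule ℝ (Euc (m + 2)),
        Module.finrank ℝ V = m₁ + 1 ∧ Module.finrank ℝ Vᗮ = m₂ + 1 ∧
        IsOpenPartOf φ (cliffordTorus V) := by
  obtain ⟨R, hR, hRφ⟩ := h.exists_involutive hm hc
  obtain ⟨p⟩ : Nonempty M := inferInstance
  obtain ⟨e, B, -, hpB, -, hB⟩ := h p _ isOpen_univ (Set.mem_univ p)
  have hexchange := hB.patch.eq_exchange hpB hR fun u _ => hRφ (e.symm u)
  have hsymm : R.IsSymmetric := hexchange ▸ hB.patch.inner_exchange_comm hpB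
  have hdim_pos := hB.two_le_finrank_eigenspace_exchange hm hc hpB (one_pow 2)
  have hdim_neg := hB.two_le_finrank_eigenspace_exchange hm hc hpB neg_one_sq
  have htrace := hB.patch.trace_exchange hpB
  rw [← hexchange] at hdim_pos hdim_neg htrace
  rw [hB.meanCurv_eq _ hpB] at htrace
  rw [← orthogonal_eigenspace_one hR hsymm] at hdim_neg
  have hdim_sum := (Module.End.eigenspace R 1).finrank_add_finrank_orthogonal
  have hdim := two_mul_finrank_eigenspace_one hR
  rw [finrank_euclideanSpace_fin] at hdim_sum hdim
  refine ⟨Module.finrank ℝ (Module.End.eigenspace R 1) - 1,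
    Module.finrank ℝ (Module.End.eigenspace R 1)ᗮ - 1, by omega, by omega, by omega,
    fun heq => hc ?_, Module.End.eigenspace R 1, by omega, by omega,
      h.isOpenPartOf fun q a b hadd hsub => ?_⟩
  · have hdim_eq : 2 * Module.finrank ℝ (Module.End.eigenspace R 1) = m + 2 := by omega
    have hdim_cast : 2 * (Module.finrank ℝ (Module.End.eigenspace R 1) : ℝ) = (m + 2 : ℕ) := by
      exact_mod_cast hdim_eq
    linarith
  · have hRη : R (η q) = φ q := by rw [← hRφ, hR]
    have hinner : ⟪R (a • (φ q : Euc (m + 2)) + b • η q), a • (φ q : Euc (m + 2)) + b • η q⟫_ℝ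
        = 2 * (a * b) := by
      rw [map_add, map_smul, map_smul, hRφ, hRη]
      simp only [inner_add_left, inner_add_right, inner_smul_left, inner_smul_right,
        h.inner_normal_self, h.inner_position_normal, real_inner_comm (φ q : Euc (m + 2)) (η q),
        real_inner_self_eq_norm_sq, norm_eq_of_mem_sphere, conj_trivial]
      ring
    rw [mem_cliffordTorus_eigenspace_iff hR hsymm, h.norm_smul_add_smul_eq_one_iff, hinner,
      mul_eq_zero_iff_left two_ne_zero, sq_add_sq_eq_one_and_mul_eq_zero_iff hadd hsub]

end IsCMC

end CliffordTorus

lemma dim_ne_zero_of_not_isHarmonic {m : ℕ} {M : Type*} [TopologicalSpace M]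
    [ChartedSpace (Euc m) M] {φ : M → UnitSphere (m + 1)} (hφ : ¬IsHarmonic φ) : m ≠ 0 := by
  rintro rfl
  exact hφ fun _ _ _ _ => by simp [tension, metricTrace]

end Biharmonic

end

theorem mainTheorem1 {m : ℕ} {M : Type*} [TopologicalSpace M] [ConnectedSpace M]
    [ChartedSpace (Euc m) M] [IsManifold (𝓡 m) ∞ M]
    (φ : M → UnitSphere (m + 1))
    (himm : Biharmonic.IsImmersedHypersurface φ)
    (hbih : Biharmonic.IsProperBiharmonic φ)
    (hcurv : Biharmonic.AtMostTwoPrincipalCurvatures φ) :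
    (∃ v : Euc (m + 2), ‖v‖ = 1 ∧
      Biharmonic.IsOpenPartOf φ (Biharmonic.smallHypersphere v)) ∨
    (∃ m₁ m₂ : ℕ, 1 ≤ m₁ ∧ 1 ≤ m₂ ∧ m₁ + m₂ = m ∧ m₁ ≠ m₂ ∧
      ∃ V : Submodule ℝ (Euc (m + 2)),
        Module.finrank ℝ V = m₁ + 1 ∧ Module.finrank ℝ Vᗮ = m₂ + 1 ∧
        Biharmonic.IsOpenPartOf φ (Biharmonic.cliffordTorus V)) := by
  obtain ⟨c, hc, hnorm⟩ := Biharmonic.exists_norm_tensionField_eq himm hbih hcurv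
  have hcmc := Biharmonic.isCMC_of_biharmonic himm hbih.1 hcurv hc.ne' hnorm
  by_cases hm : c ^ 2 = m ^ 2
  · obtain rfl : c = m := (pow_left_inj₀ hc.le m.cast_nonneg two_ne_zero).1 hm
    exact .inl (hcmc.exists_isOpenPartOf_smallHypersphere
      (Biharmonic.dim_ne_zero_of_not_isHarmonic hbih.2))
  · exact .inr (hcmc.exists_isOpenPartOf_cliffordTorus hm hc.ne')
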